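/- Let $C_{4\pi}$ be the flat cone of angle $4\pi$, with polar coordinates $r>0$, $\theta\in\mathbb R/4\pi\mathbb Z$, area $dS=r\,dr\,d\theta$ and cone point $\mathbf p$; its smooth part $C_{4\pi}^\circ$ is the double cover of the punctured plane, with local coordinate $w=re^{i\theta}$. Let $\Delta$ be the Friedrichs extension on $L^2(C_{4\pi})$ of the nonnegative Euclidean Laplacian $-4\partial_w\partial_{\bar w}$ on $C_c^\infty(C_{4\pi}^\circ)$, put $\mathcal D_s=\mathrm{Dom}(\Delta^{s/2})$ for $s\ge 0$ (with $\mathcal D_2$ carrying the graph norm), and let $\mathcal D_{-2}$ be the dual of $\mathcal D_2$, where $L^2$ is included in $\mathcal D_{-2}$ by the bilinear pairing $\langle f,g\rangle=\int fg\,dS$. Let $\overline{\mathfrak D}$ be the domain of the closure of the Laplacian on $C_c^\infty(C_{4\pi}^\circ)$. Every $u\in\mathcal D_2$ has unique coefficients $L_{-1}(u),L_0(u),L_1(u)\in\mathbb C$ such that, for every smooth, compactly supported radial cutoff $\rho$ that is identically $1$ near $\mathbf p$, $$u-\bigl(L_0(u)+L_{-1}(u)\sqrt r\,e^{-i\theta/2}+L_1(u)\sqrt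 r\,e^{i\theta/2}\bigr)\rho(r)\in\overline{\mathfrak D},$$ and $L_{-1},L_0,L_1$ belong to $\mathcal D_{-2}$. Let $X=X_w\partial_w+X_{\bar w}\partial_{\bar w}$ with constants $X_w,X_{\bar w}\in\mathbb C$. Then $X$ maps $\mathcal D_2$ to $L^2$; extend $X$ and $\Delta$ by duality to maps $L^2\to\mathcal D_{-2}$, namely $\langle Xf,v\rangle=-\int f\,(Xv)\,dS$ and $\langle\Delta f,v\rangle=\int f\,(\Delta v)\,dS$ for $f\in L^2$, $v\in\mathcal D_2$, so that $[X,\Delta]=X\Delta-\Delta X$ maps $\mathcal D_2$ to $\mathcal D_{-2}$. For every real $k\ge 2$ and every $u\in\mathcal D_k$ one has $u\in\mathcal D_2$ and $$[X,\Delta]u=-2\pi\bigl(X_w\,L_1(u)\,L_1+X_{\bar w}\,L_{-1}(u)\,L_{-1}\bigr)\quad\text{in }\mathcal D_{-2}.$$ -/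

import Mathlib

open MeasureTheory
open scoped ContDiff

noncomputable section

namespace Cone

/-! ## The cone of angle `4π`

The smooth part of the flat cone of angle `4π` is the double cover of the punctured plane.  It is
modelled here by the punctured plane `ℂ ∖ {0}` with the global coordinate `z`, the covering map
being `w = z ^ 2`, and with the pulled-back metric `|dw|² = 4 |z|² |dz|²`.  In polar coordinates
`r > 0`, `θ ∈ ℝ / 4πℤ`, one has `z = √r * exp (i θ / 2)`, hence `w = r * exp (i θ)`, `‖z‖ ^ 2 = r`,
`z = √r * exp (i θ / 2)` and `conj z = √r * exp (-i θ / 2)`.  The point `z = 0` is the cone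
point. -/

/-- The Euclidean area `r dr dθ` of the cone, i.e. `4 |z|²` times Lebesgue measure in the
coordinate `z`. -/
def area : Measure ℂ := volume.withDensity fun z => ENNReal.ofReal (4 * ‖z‖ ^ 2)

/-- The Hilbert space `L²` of the cone. -/
abbrev L2 : Type := Lp ℂ 2 area

/-- Smooth functions with compact support in the cone without its cone point. -/
structure IsTest (φ : ℂ → ℂ) : Prop where
  smooth : ContDiff ℝ ∞ φ
  compact : HasCompactSupport φ
  away : (0 : ℂ) ∉ tsupport φ

/-- The constant vector field `∂_w = (2 z)⁻¹ ∂_z`. -/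
def dw (φ : ℂ → ℂ) (z : ℂ) : ℂ :=
  (2 * z)⁻¹ * ((fderiv ℝ φ z 1 - Complex.I * fderiv ℝ φ z Complex.I) / 2)

/-- The constant vector field `∂_w̄ = (2 z̄)⁻¹ ∂_z̄`. -/
def dwbar (φ : ℂ → ℂ) (z : ℂ) : ℂ :=
  (2 * (starRingEnd ℂ) z)⁻¹ * ((fderiv ℝ φ z 1 + Complex.I * fderiv ℝ φ z Complex.I) / 2)

/-- The nonnegative Euclidean Laplacian `-4 ∂_w ∂_w̄`, on smooth functions. -/
def lap (φ : ℂ → ℂ) (z : ℂ) : ℂ := -4 * dw (dwbar φ) z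

lemma IsTest.differentiable {φ : ℂ → ℂ} (h : IsTest φ) : Differentiable ℝ φ :=
  h.smooth.differentiable (by simp)

lemma IsTest.zero : IsTest (0 : ℂ → ℂ) where
  smooth := contDiff_const
  compact := HasCompactSupport.zero
  away := by simp [tsupport]

lemma IsTest.add {φ ψ : ℂ → ℂ} (hφ : IsTest φ) (hψ : IsTest ψ) : IsTest (φ + ψ) where
  smooth := hφ.smooth.add hψ.smooth
  compact := hφ.compact.add hψ.compact
  away := fun h => (tsupport_add φ ψ h).elim hφ.away hψ.away

lemma IsTest.smul {φ : ℂ → ℂ} (c : ℂ) (hφ : IsTest φ) : IsTest (c • φ) where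
  smooth := hφ.smooth.const_smul c
  compact := hφ.compact.smul_left (f := fun _ => c)
  away := fun h => hφ.away (closure_mono (Function.support_const_smul_subset c φ) h)

lemma dw_add {φ ψ : ℂ → ℂ} (hφ : IsTest φ) (hψ : IsTest ψ) : dw (φ + ψ) = dw φ + dw ψ := by
  ext z
  simp only [dw, Pi.add_apply, fderiv_add (hφ.differentiable z) (hψ.differentiable z),
    add_apply]
  ring

lemma dwbar_add {φ ψ : ℂ → ℂ} (hφ : IsTest φ) (hψ : IsTest ψ) :
    dwbar (φ + ψ) = dwbar φ + dwbar ψ := by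
  ext z
  simp only [dwbar, Pi.add_apply, fderiv_add (hφ.differentiable z) (hψ.differentiable z),
    add_apply]
  ring

lemma dw_smul {φ : ℂ → ℂ} (c : ℂ) (hφ : IsTest φ) : dw (c • φ) = c • dw φ := by
  ext z
  simp only [dw, Pi.smul_apply, fderiv_const_smul (hφ.differentiable z), smul_eq_mul,
    smul_apply]
  ring

lemma dwbar_smul {φ : ℂ → ℂ} (c : ℂ) (hφ : IsTest φ) : dwbar (c • φ) = c • dwbar φ := by
  ext z
  simp only [dwbar, Pi.smul_apply, fderiv_const_smul (hφ.differentiable z), smul_eq_mul,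
    smul_apply]
  ring

/-! ## The Friedrichs extension -/

/-- The triples `(φ, ∂_w φ, ∂_w̄ φ)` with `φ` a test function. -/
def formCore : Submodule ℂ (L2 × L2 × L2) where
  carrier := {p | ∃ φ, IsTest φ ∧ p.1 =ᵐ[area] φ ∧ p.2.1 =ᵐ[area] dw φ ∧ p.2.2 =ᵐ[area] dwbar φ}
  add_mem' := by
    rintro p q ⟨φ, hφ, h1, h2, h3⟩ ⟨ψ, hψ, k1, k2, k3⟩
    refine ⟨φ + ψ, hφ.add hψ, (Lp.coeFn_add _ _).trans (h1.add k1), ?_, ?_⟩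
    · rw [dw_add hφ hψ]; exact (Lp.coeFn_add _ _).trans (h2.add k2)
    · rw [dwbar_add hφ hψ]; exact (Lp.coeFn_add _ _).trans (h3.add k3)
  zero_mem' := by
    refine ⟨0, IsTest.zero, Lp.coeFn_zero _ _ _, ?_, ?_⟩
    · have : dw 0 = 0 := by ext z; simp [dw]
      rw [this]; exact Lp.coeFn_zero _ _ _
    · have : dwbar 0 = 0 := by ext z; simp [dwbar]
      rw [this]; exact Lp.coeFn_zero _ _ _
  smul_mem' := by
    rintro c p ⟨φ, hφ, h1, h2, h3⟩
    refine ⟨c • φ, hφ.smul c, (Lp.coeFn_smul _ _).trans (h1.const_smul c), ?_, ?_⟩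
    · rw [dw_smul c hφ]; exact (Lp.coeFn_smul _ _).trans (h2.const_smul c)
    · rw [dwbar_smul c hφ]; exact (Lp.coeFn_smul _ _).trans (h3.const_smul c)

/-- The form domain, i.e. the closure of the test functions in the norm of the Dirichlet form;
a function in it is listed together with its two derivatives, `(u, ∂_w u, ∂_w̄ u)`. -/
def formDomain : Submodule ℂ (L2 × L2 × L2) := formCore.topologicalClosure

/-- `u` is in the form domain with `∂_w u = d.1` and `∂_w̄ u = d.2`, and `Q(v, u) = ⟨v, f⟩` for all
`v` in the form domain.  Here `Q(v, u) = ∫ ⟨∇v, ∇u⟩ dS = 2 (⟨∂_w v, ∂_w u⟩ + ⟨∂_w̄ v, ∂_w̄ u⟩)` is the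
Dirichlet form. -/
def FormEq (u f : L2) (d : L2 × L2) : Prop :=
  (u, d.1, d.2) ∈ formDomain ∧
    ∀ v ∈ formDomain, 2 * (inner ℂ v.2.1 d.1 + inner ℂ v.2.2 d.2) = inner ℂ v.1 f

lemma FormEq.add {u u' f f' : L2} {d d' : L2 × L2} (h : FormEq u f d) (h' : FormEq u' f' d') :
    FormEq (u + u') (f + f') (d + d') := by
  refine ⟨formDomain.add_mem h.1 h'.1, fun v hv => ?_⟩
  have e := h.2 v hv
  have e' := h'.2 v hv
  simp only [Prod.fst_add, Prod.snd_add, inner_add_right]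
  linear_combination e + e'

lemma FormEq.smul {u f : L2} {d : L2 × L2} (c : ℂ) (h : FormEq u f d) :
    FormEq (c • u) (c • f) (c • d) := by
  refine ⟨formDomain.smul_mem c h.1, fun v hv => ?_⟩
  have e := h.2 v hv
  simp only [Prod.smul_fst, Prod.smul_snd, inner_smul_right]
  linear_combination c * e

/-- The graph `{(u, Δ u)}` of the Friedrichs extension `Δ` of the Laplacian. -/
def friedrichs : Submodule ℂ (L2 × L2) where
  carrier := {p | ∃ d, FormEq p.1 p.2 d}
  add_mem' := by
    rintro p q ⟨d, hd⟩ ⟨e, he⟩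
    exact ⟨d + e, hd.add he⟩
  zero_mem' := ⟨0, formDomain.zero_mem, fun v _ => by simp⟩
  smul_mem' := by
    rintro c p ⟨d, hd⟩
    exact ⟨c • d, hd.smul c⟩

/-- The domain `𝓓₂` of the Friedrichs extension with the graph norm: a function `u` of the domain is
represented by the pair `(u, Δ u)`. -/
def D2 : Type := friedrichs

instance : NormedAddCommGroup D2 := inferInstanceAs (NormedAddCommGroup friedrichs)

instance : NormedSpace ℂ D2 := inferInstanceAs (NormedSpace ℂ friedrichs)

/-- An element of `𝓓₂` as the pair `(u, Δ u)`. -/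
def D2.toPair : D2 →L[ℂ] L2 × L2 := friedrichs.subtypeL

/-- The space `𝓓₋₂`, the dual of `𝓓₂`. -/
abbrev DNeg2 : Type := D2 →L[ℂ] ℂ

/-- The inclusion of `𝓓₂` into `L²`. -/
def incl : D2 →L[ℂ] L2 := (ContinuousLinearMap.fst ℂ L2 L2).comp D2.toPair

/-- The Friedrichs Laplacian `𝓓₂ → L²`. -/
def Delta : D2 →L[ℂ] L2 := (ContinuousLinearMap.snd ℂ L2 L2).comp D2.toPair

/-! ### The vector fields on `𝓓₂` -/

lemma FormEq.energy {u f : L2} {d : L2 × L2} (h : FormEq u f d) :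
    2 * (‖d.1‖ ^ 2 + ‖d.2‖ ^ 2) ≤ ‖u‖ * ‖f‖ := by
  have e := h.2 _ h.1
  simp only [inner_self_eq_norm_sq_to_K] at e
  have e' : ((2 * (‖d.1‖ ^ 2 + ‖d.2‖ ^ 2) : ℝ) : ℂ) = inner ℂ u f := by
    push_cast
    exact e
  calc 2 * (‖d.1‖ ^ 2 + ‖d.2‖ ^ 2) = ‖((2 * (‖d.1‖ ^ 2 + ‖d.2‖ ^ 2) : ℝ) : ℂ)‖ := by
        rw [Complex.norm_real, Real.norm_of_nonneg (by positivity)]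
    _ ≤ ‖u‖ * ‖f‖ := by rw [e']; exact norm_inner_le_norm u f

lemma FormEq.unique {u f : L2} {d d' : L2 × L2} (h : FormEq u f d) (h' : FormEq u f d') :
    d = d' := by
  have k := (h.add (h'.smul (-1))).energy
  simp only [neg_smul, one_smul, add_neg_cancel, norm_zero, mul_zero, ← sub_eq_add_neg,
    Prod.fst_sub, Prod.snd_sub] at k
  have k1 : ‖d.1 - d'.1‖ = 0 := by nlinarith [sq_nonneg ‖d.1 - d'.1‖, sq_nonneg ‖d.2 - d'.2‖]
  have k2 : ‖d.2 - d'.2‖ = 0 := by nlinarith [sq_nonneg ‖d.1 - d'.1‖, sq_nonneg ‖d.2 - d'.2‖]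
  exact Prod.ext (sub_eq_zero.1 (norm_eq_zero.1 k1)) (sub_eq_zero.1 (norm_eq_zero.1 k2))

/-- The pair of derivatives `(∂_w u, ∂_w̄ u)` of an element of `𝓓₂`. -/
def grad (U : D2) : L2 × L2 := U.2.choose

lemma grad_spec (U : D2) : FormEq U.1.1 U.1.2 (grad U) := U.2.choose_spec

lemma norm_grad_le (U : D2) : ‖(grad U).1‖ ≤ ‖U‖ ∧ ‖(grad U).2‖ ≤ ‖U‖ := by
  have e := (grad_spec U).energy
  have a : ‖U.1.1‖ ≤ ‖U‖ := norm_fst_le (D2.toPair U)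
  have b : ‖U.1.2‖ ≤ ‖U‖ := norm_snd_le (D2.toPair U)
  have c : ‖U.1.1‖ * ‖U.1.2‖ ≤ ‖U‖ * ‖U‖ := mul_le_mul a b (norm_nonneg _) (norm_nonneg _)
  constructor <;> apply le_of_sq_le_sq _ (norm_nonneg _) <;>
    nlinarith [sq_nonneg ‖(grad U).1‖, sq_nonneg ‖(grad U).2‖]

/-- The derivative `∂_w : 𝓓₂ → L²`. -/
def partialW : D2 →L[ℂ] L2 :=
  LinearMap.mkContinuous
    { toFun := fun U => (grad U).1
      map_add' := fun U V => congrArg Prod.fst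
        ((grad_spec (U + V)).unique ((grad_spec U).add (grad_spec V)))
      map_smul' := fun c U => congrArg Prod.fst
        ((grad_spec (c • U)).unique ((grad_spec U).smul c)) }
    1 fun U => by simpa using (norm_grad_le U).1

/-- The derivative `∂_w̄ : 𝓓₂ → L²`. -/
def partialWbar : D2 →L[ℂ] L2 :=
  LinearMap.mkContinuous
    { toFun := fun U => (grad U).2
      map_add' := fun U V => congrArg Prod.snd
        ((grad_spec (U + V)).unique ((grad_spec U).add (grad_spec V)))
      map_smul' := fun c U => congrArg Prod.snd
        ((grad_spec (c • U)).unique ((grad_spec U).smul c)) }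
    1 fun U => by simpa using (norm_grad_le U).2

/-- The constant vector field `X = a ∂_w + b ∂_w̄` as an operator `𝓓₂ → L²`. -/
def vectorField (a b : ℂ) : D2 →L[ℂ] L2 := a • partialW + b • partialWbar

/-! ### Extension by duality and the commutator -/

/-- The bilinear pairing `(f, g) ↦ ∫ f g dS` on `L²`. -/
def pairing : L2 →L[ℂ] L2 →L[ℂ] ℂ :=
  (ContinuousLinearMap.mul ℂ ℂ).lpPairing area 2 2

/-- The transpose `L² → 𝓓₋₂`, `f ↦ (V ↦ ∫ f (T V) dS)`, of an operator `T : 𝓓₂ → L²`. -/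
def transpose (T : D2 →L[ℂ] L2) : L2 →L[ℂ] DNeg2 :=
  ((ContinuousLinearMap.compL ℂ D2 L2 ℂ).flip T).comp pairing

/-- The extension `L² → 𝓓₋₂` by duality of the symmetric operator `Δ`. -/
def DeltaExt : L2 →L[ℂ] DNeg2 := transpose Delta

/-- The extension `L² → 𝓓₋₂` by duality of the skew operator `X = a ∂_w + b ∂_w̄`. -/
def vectorFieldExt (a b : ℂ) : L2 →L[ℂ] DNeg2 := -transpose (vectorField a b)

/-- The commutator `[X, Δ] = X Δ - Δ X : 𝓓₂ → 𝓓₋₂` for `X = a ∂_w + b ∂_w̄`. -/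
def commutator (a b : ℂ) : D2 →L[ℂ] DNeg2 :=
  (vectorFieldExt a b).comp Delta - DeltaExt.comp (vectorField a b)

/-! ### Real powers of the Friedrichs extension -/

/-- `R = (1 + Δ)⁻¹` on `L²`: for all `f`, the function `R f` is in `𝓓₂` and `Δ (R f) = f - R f`. -/
def IsResolvent (R : L2 →L[ℂ] L2) : Prop := ∀ f, (R f, f - R f) ∈ friedrichs

/-- The power `A ^ σ` of a nonnegative bounded operator `A` on a Hilbert space, by the continuous
functional calculus. -/
def power {H : Type*} [NormedAddCommGroup H] [InnerProductSpace ℂ H] [CompleteSpace H]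
    (A : H →L[ℂ] H) (σ : ℝ) : H →L[ℂ] H := A ^ σ

/-- `u ∈ Dom (Δ ^ σ)` and `Δ ^ σ u = g`, for `σ ≥ 0`.  Through the functional calculus of the bounded
self-adjoint operator `R = (1 + Δ)⁻¹`, whose spectrum is in `[0, 1]`, one has
`Δ ^ σ = (1 - R) ^ σ R ^ (-σ)`, because `x = (1 - b) / b` if `b = (1 + x)⁻¹`. -/
def HasPower (σ : ℝ) (u g : L2) : Prop :=
  ∃ R, IsResolvent R ∧ ∃ f, u = power R σ f ∧ g = power (1 - R) σ f

/-- The space `𝓓ₛ = Dom (Δ ^ (s / 2))`, for `s ≥ 0`. -/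
def domain (s : ℝ) : Set L2 := {u | ∃ g, HasPower (s / 2) u g}

/-! ## The expansion at the cone point -/

/-- The domain of the closure of the Laplacian on the test functions. -/
def minDomain : Set L2 :=
  {v | ∃ f, (v, f) ∈ closure
    {p : L2 × L2 | ∃ φ, IsTest φ ∧ p.1 =ᵐ[area] φ ∧ p.2 =ᵐ[area] lap φ}}

/-- A smooth compactly supported function of the radius, identically `1` near the cone point. -/
structure IsCutoff (ρ : ℝ → ℝ) : Prop where
  smooth : ContDiff ℝ ∞ ρ
  compact : HasCompactSupport ρ
  eq_one : ∀ᶠ r in nhds 0, ρ r = 1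

/-- `u = (a₀ + am √r exp (-iθ/2) + ap √r exp (iθ/2)) ρ(r) + v` with `v` in the domain of the closure
of the Laplacian on the test functions, for every cutoff `ρ`. -/
def HasExpansion (u : L2) (am a₀ ap : ℂ) : Prop :=
  ∀ ρ, IsCutoff ρ → ∃ v ∈ minDomain, u =ᵐ[area] fun z =>
    (a₀ + am * (starRingEnd ℂ) z + ap * z) * (ρ (‖z‖ ^ 2) : ℂ) + v z

end Cone

end

/-!
In the coordinate `z = √w` the cone is the plane with area `4 |z|² |dz|²`, and its Laplacian is
`-|z|⁻² ∂_z ∂_z̄`. The Dirichlet form is conformally invariant and a point of the plane has capacity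
zero, so every smooth compactly supported function of `z` that is harmonic near `0` lies in `𝓓₂`
(`mem_formDomain`, `IsHarm.toD2`). This applies to `ρ`, `z ρ` and `z̄ ρ`, the functions `base ρ i`.

The commutator is a symmetric bilinear form on `𝓓₂`. It vanishes when one argument is a test
function, because constant vector fields commute with the Laplacian away from the cone point
(`IsTest.commutator_toD2`). On functions harmonic near `0` the integrand is the exact expression
`2 ∂_z̄ (∂_z e ∂_z e') / z`, and the Cauchy–Pompeiu formula (`integral_dzb_div`) gives
`-2π ∂_z e(0) ∂_z e'(0)`, and likewise with `∂_z̄` (`IsHarm.commutator_toD2`). Consequently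
`-(2π)⁻¹ [∂_w, Δ] (z ρ)` and `-(2π)⁻¹ [∂_w̄, Δ] (z̄ ρ)` are continuous functionals on `𝓓₂` that vanish
on test functions and read off the coefficients of `z` and `z̄`. The constant coefficient is read off
by Green's formula against the singular solution `ρ log r` (`IsCutoff.logForm`).

It remains to see that the test functions and the three functions `base ρ i` span a dense subspace of
`𝓓₂` (`IsCutoff.eq_top`). Since `1 + Δ` is expanding, this amounts to: a function `g` in `L²`
orthogonal to its values on these functions is zero (`Annih.ae_eq_zero`). Removing cutoffs at the
cone point and at infinity, one may test against `zⁿ (1 + a r) exp (-a r)` for all `n` and all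
`a > 0`, which turns the orthogonality into the differential equation
`a (1 - a²) G' = (1 + (n + 2) a²) G` for the Laplace transform `G(a) = ∫ g zⁿ exp (-a r) dS`. All its
nonzero solutions blow up at `a = 1`, while `G` is smooth, so `G = 0`. Differentiating in `a`, and
applying the same to the conjugate of `g`, all moments of `g exp (-r)` vanish; hence so does its
Fourier transform, and `g = 0`.

By density every element of `𝓓₂` is a combination of the `base ρ i` plus an element of the closure of
the test functions (`IsCutoff.remainder_mem`), on which the functionals and the commutator form
vanish. This gives the expansion, its uniqueness and the formula for the commutator. Finally
`Dom (Δ ^ (k / 2)) ⊆ 𝓓₂` for `k ≥ 2`, because `R ^ (k / 2) = R R ^ (k / 2 - 1)` for the resolvent `R`.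
-/

noncomputable section

namespace Cone

open Complex Filter Topology ComplexConjugate

/-! ### Wirtinger calculus -/

/-- The real-linear map `v ↦ a v + b v̄`. -/
def wirt (a b : ℂ) : ℂ →L[ℝ] ℂ :=
  a • (ContinuousLinearMap.id ℝ ℂ) + b • (conjCLE : ℂ →L[ℝ] ℂ)

lemma wirt_apply (a b v : ℂ) : wirt a b v = a * v + b * conj v := by
  simp [wirt]

/-- `φ` is real differentiable at `z` with `∂_z φ = a` and `∂_z̄ φ = b`. -/
def HasWirtAt (φ : ℂ → ℂ) (a b z : ℂ) : Prop := HasFDerivAt φ (wirt a b) z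

/-- The Wirtinger derivative `∂_z`. -/
def dz (φ : ℂ → ℂ) (z : ℂ) : ℂ := (fderiv ℝ φ z 1 - I * fderiv ℝ φ z I) / 2

/-- The Wirtinger derivative `∂_z̄`. -/
def dzb (φ : ℂ → ℂ) (z : ℂ) : ℂ := (fderiv ℝ φ z 1 + I * fderiv ℝ φ z I) / 2

lemma dw_eq (φ : ℂ → ℂ) (z : ℂ) : dw φ z = (2 * z)⁻¹ * dz φ z := rfl

lemma dwbar_eq (φ : ℂ → ℂ) (z : ℂ) : dwbar φ z = (2 * conj z)⁻¹ * dzb φ z := rfl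

namespace HasWirtAt

variable {φ ψ : ℂ → ℂ} {a b a' b' z : ℂ}

lemma dz (h : HasWirtAt φ a b z) : dz φ z = a := by
  rw [Cone.dz, HasFDerivAt.fderiv h, wirt_apply, wirt_apply]
  simp only [map_one, conj_I]
  linear_combination (-(a - b) / 2) * I_sq

lemma dzb (h : HasWirtAt φ a b z) : dzb φ z = b := by
  rw [Cone.dzb, HasFDerivAt.fderiv h, wirt_apply, wirt_apply]
  simp only [map_one, conj_I]
  linear_combination ((a - b) / 2) * I_sq

lemma dw (h : HasWirtAt φ a b z) : dw φ z = (2 * z)⁻¹ * a := by rw [dw_eq, h.dz]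

lemma dwbar (h : HasWirtAt φ a b z) : dwbar φ z = (2 * conj z)⁻¹ * b := by rw [dwbar_eq, h.dzb]

lemma congr (h : HasWirtAt φ a b z) (ha : a = a') (hb : b = b') : HasWirtAt φ a' b' z := by
  subst ha hb; exact h

lemma add (h : HasWirtAt φ a b z) (k : HasWirtAt ψ a' b' z) :
    HasWirtAt (fun y => φ y + ψ y) (a + a') (b + b') z :=
  (HasFDerivAt.add h k).congr_fderiv (by
    apply ContinuousLinearMap.ext; intro v; simp [wirt_apply]; ring)

lemma mul (h : HasWirtAt φ a b z) (k : HasWirtAt ψ a' b' z) :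
    HasWirtAt (fun y => φ y * ψ y) (φ z * a' + ψ z * a) (φ z * b' + ψ z * b) z :=
  (HasFDerivAt.mul h k).congr_fderiv (by
    apply ContinuousLinearMap.ext; intro v; simp [wirt_apply]; ring)

lemma star (h : HasWirtAt φ a b z) : HasWirtAt (fun y => conj (φ y)) (conj b) (conj a) z :=
  ((conjCLE : ℂ →L[ℝ] ℂ).hasFDerivAt.comp z h).congr_fderiv (by
    apply ContinuousLinearMap.ext; intro v; simp [wirt_apply]; ring)

lemma congr_of_eventuallyEq (h : HasWirtAt φ a b z) (e : ψ =ᶠ[𝓝 z] φ) : HasWirtAt ψ a b z :=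
  HasFDerivAt.congr_of_eventuallyEq h e

end HasWirtAt

lemma hasWirtAt_const (c z : ℂ) : HasWirtAt (fun _ => c) 0 0 z :=
  (hasFDerivAt_const c z).congr_fderiv (by
    apply ContinuousLinearMap.ext; intro v; simp [wirt_apply])

lemma hasWirtAt_id (z : ℂ) : HasWirtAt (fun y => y) 1 0 z :=
  (hasFDerivAt_id z).congr_fderiv (by
    apply ContinuousLinearMap.ext; intro v; simp [wirt_apply])

/-- A holomorphic function is killed by `∂_z̄`. -/
lemma _root_.HasDerivAt.hasWirtAt {φ : ℂ → ℂ} {a z : ℂ} (h : HasDerivAt φ a z) :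
    HasWirtAt φ a 0 z :=
  (h.hasFDerivAt.restrictScalars ℝ).congr_fderiv (by
    apply ContinuousLinearMap.ext; intro v; simp [wirt_apply]; ring)

lemma hasWirtAt_conj (z : ℂ) : HasWirtAt (fun y => conj y) 0 1 z :=
  (hasWirtAt_id z).star.congr (by simp) (by simp)

lemma hasWirtAt_pow (n : ℕ) (z : ℂ) : HasWirtAt (fun y => y ^ n) (n * z ^ (n - 1)) 0 z :=
  (hasDerivAt_pow n z).hasWirtAt

lemma hasWirtAt_inv {z : ℂ} (hz : z ≠ 0) : HasWirtAt (fun y => (2 * y)⁻¹) (-(2 * z ^ 2)⁻¹) 0 z := by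
  have h : HasDerivAt (fun y : ℂ => (2 * y)⁻¹) (-(2 * z ^ 2)⁻¹) z := by
    have h1 : HasDerivAt (fun y : ℂ => 2 * y) 2 z := by
      simpa using (hasDerivAt_id z).const_mul (2 : ℂ)
    refine (h1.inv (by simpa using hz)).congr_deriv ?_
    simp only [mul_pow]
    field_simp
  exact h.hasWirtAt

lemma hasWirtAt_inv_conj {z : ℂ} (hz : z ≠ 0) :
    HasWirtAt (fun y => (2 * conj y)⁻¹) 0 (-(2 * conj z ^ 2)⁻¹) z := by
  have h := (hasWirtAt_inv hz).star
  simpa only [map_inv₀, map_mul, map_neg, map_pow, conj_ofNat, map_zero] using h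

lemma _root_.DifferentiableAt.hasWirtAt {φ : ℂ → ℂ} {z : ℂ} (h : DifferentiableAt ℝ φ z) :
    HasWirtAt φ (dz φ z) (dzb φ z) z := by
  refine h.hasFDerivAt.congr_fderiv ?_
  apply ContinuousLinearMap.ext
  intro v
  have e : fderiv ℝ φ z v = v.re * fderiv ℝ φ z 1 + v.im * fderiv ℝ φ z I := by
    conv_lhs => rw [show v = v.re • (1 : ℂ) + v.im • I by simp [re_add_im]]
    rw [map_add, map_smul, map_smul]
    simp
  rw [e, wirt_apply, dz, dzb]
  conv_rhs => rw [show conj v = v.re - v.im * I from by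
    apply Complex.ext <;> simp]
  generalize fderiv ℝ φ z I = q, fderiv ℝ φ z 1 = p
  have hv : v = v.re + v.im * I := (re_add_im v).symm
  linear_combination (v.im * q) * I_sq - (p - I * q) / 2 * hv

/-- A radial function `F (|z|²)`. -/
lemma hasWirtAt_radial {F : ℝ → ℝ} {F' : ℝ} {z : ℂ} (h : HasDerivAt F F' (‖z‖ ^ 2)) :
    HasWirtAt (fun y => (F (‖y‖ ^ 2) : ℂ)) (F' * conj z) (F' * z) z := by
  have h1 : HasFDerivAt (fun y : ℂ => ‖y‖ ^ 2) (2 • innerSL ℝ z) z :=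
    (hasStrictFDerivAt_norm_sq z).hasFDerivAt
  have h2 := ofRealCLM.hasFDerivAt.comp z (h.hasFDerivAt.comp z h1)
  refine h2.congr_fderiv ?_
  apply ContinuousLinearMap.ext
  intro v
  have : (inner ℝ z v : ℝ) = z.re * v.re + z.im * v.im := by
    rw [Complex.inner]; simp; ring
  simp [wirt_apply]
  apply Complex.ext <;> simp <;> ring

lemma conj_mul_self (z : ℂ) : conj z * z = ((‖z‖ ^ 2 : ℝ) : ℂ) := by
  rw [mul_comm, mul_conj, normSq_eq_norm_sq]

/-! ### Functions smooth away from the cone point -/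

/-- Smoothness on the cone without its cone point. -/
def SmoothOff (ψ : ℂ → ℂ) : Prop := ContDiffOn ℝ ∞ ψ {0}ᶜ

lemma isOpen_off : IsOpen ({0}ᶜ : Set ℂ) := isOpen_compl_singleton

namespace SmoothOff

variable {φ ψ : ℂ → ℂ}

lemma contDiffAt (h : SmoothOff ψ) {z : ℂ} (hz : z ≠ 0) : ContDiffAt ℝ ∞ ψ z :=
  ContDiffOn.contDiffAt h (isOpen_off.mem_nhds hz)

lemma of_contDiffAt (h : ∀ z ≠ 0, ContDiffAt ℝ ∞ ψ z) : SmoothOff ψ :=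
  fun z hz => (h z hz).contDiffWithinAt

lemma differentiableAt (h : SmoothOff ψ) {z : ℂ} (hz : z ≠ 0) : DifferentiableAt ℝ ψ z :=
  (h.contDiffAt hz).differentiableAt (by simp)

lemma hasWirtAt (h : SmoothOff ψ) {z : ℂ} (hz : z ≠ 0) :
    HasWirtAt ψ (Cone.dz ψ z) (Cone.dzb ψ z) z := (h.differentiableAt hz).hasWirtAt

lemma add (h : SmoothOff φ) (k : SmoothOff ψ) : SmoothOff (fun z => φ z + ψ z) :=
  ContDiffOn.add h k

lemma mul (h : SmoothOff φ) (k : SmoothOff ψ) : SmoothOff (fun z => φ z * ψ z) :=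
  ContDiffOn.mul h k

lemma star (h : SmoothOff φ) : SmoothOff (fun z => conj (φ z)) :=
  (conjCLE : ℂ →L[ℝ] ℂ).contDiff.comp_contDiffOn h

lemma const (c : ℂ) : SmoothOff fun _ => c := contDiffOn_const

lemma id : SmoothOff fun z => z := contDiffOn_id

lemma inv : SmoothOff fun z => (2 * z)⁻¹ :=
  ContDiffOn.inv (contDiffOn_const.mul contDiffOn_id) fun z hz => by simpa using hz

lemma fderiv_apply (h : SmoothOff ψ) (v : ℂ) : SmoothOff fun z => fderiv ℝ ψ z v :=
  (ContDiffOn.fderiv_of_isOpen h isOpen_off (by simp)).clm_apply contDiffOn_const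

lemma dz (h : SmoothOff ψ) : SmoothOff (dz ψ) := by
  have : Cone.dz ψ = fun z => (fderiv ℝ ψ z 1 + (-I) * fderiv ℝ ψ z I) * (1 / 2) := by
    ext z; rw [Cone.dz]; ring
  rw [this]
  exact (((h.fderiv_apply 1).add ((const _).mul (h.fderiv_apply I))).mul (const _))

lemma dzb (h : SmoothOff ψ) : SmoothOff (dzb ψ) := by
  have : Cone.dzb ψ = fun z => (fderiv ℝ ψ z 1 + I * fderiv ℝ ψ z I) * (1 / 2) := by
    ext z; rw [Cone.dzb]; ring
  rw [this]
  exact (((h.fderiv_apply 1).add ((const _).mul (h.fderiv_apply I))).mul (const _))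

lemma dw (h : SmoothOff ψ) : SmoothOff (dw ψ) := inv.mul h.dz

lemma dwbar (h : SmoothOff ψ) : SmoothOff (dwbar ψ) := by
  have := (inv.star).mul h.dzb
  refine this.congr fun z _ => ?_
  simp only [dwbar_eq, map_inv₀, map_mul, conj_ofNat]

lemma lap (h : SmoothOff ψ) : SmoothOff (lap ψ) := (const (-4)).mul h.dwbar.dw

end SmoothOff

lemma dz_dzb_comm {φ : ℂ → ℂ} {z : ℂ} (h : ContDiffAt ℝ 2 φ z) :
    dz (dzb φ) z = dzb (dz φ) z := by
  have hs : IsSymmSndFDerivAt ℝ φ z := h.isSymmSndFDerivAt (by simp)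
  have hd : DifferentiableAt ℝ (fderiv ℝ φ) z :=
    (h.fderiv_right (m := 1) (by norm_num)).differentiableAt (by simp)
  have e : ∀ v w : ℂ, fderiv ℝ (fun y => fderiv ℝ φ y v) z w = fderiv ℝ (fderiv ℝ φ) z w v := by
    intro v w
    rw [fderiv_clm_apply hd (differentiableAt_const _)]
    simp
  have hv : ∀ v : ℂ, DifferentiableAt ℝ (fun y => fderiv ℝ φ y v) z := fun v =>
    hd.clm_apply (differentiableAt_const _)
  have e1 : ∀ w, fderiv ℝ (dz φ) z w
      = (fderiv ℝ (fderiv ℝ φ) z w 1 - I * fderiv ℝ (fderiv ℝ φ) z w I) / 2 := by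
    intro w
    have : dz φ = fun y => (1 / 2 : ℂ) * (fderiv ℝ φ y 1 - I * fderiv ℝ φ y I) := by
      ext y; rw [dz]; ring
    rw [this, fderiv_const_mul (by exact (hv 1).sub ((hv I).const_mul I)),
      fderiv_fun_sub (hv 1) ((hv I).const_mul I), fderiv_const_mul (hv I)]
    simp [e]; ring
  have e2 : ∀ w, fderiv ℝ (dzb φ) z w
      = (fderiv ℝ (fderiv ℝ φ) z w 1 + I * fderiv ℝ (fderiv ℝ φ) z w I) / 2 := by
    intro w
    have : dzb φ = fun y => (1 / 2 : ℂ) * (fderiv ℝ φ y 1 + I * fderiv ℝ φ y I) := by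
      ext y; rw [dzb]; ring
    rw [this, fderiv_const_mul (by exact (hv 1).add ((hv I).const_mul I)),
      fderiv_fun_add (hv 1) ((hv I).const_mul I), fderiv_const_mul (hv I)]
    simp [e]; ring
  rw [dz, dzb, e1, e1, e2, e2, hs.eq 1 I]
  ring

lemma dw_dwbar {φ : ℂ → ℂ} (h : SmoothOff φ) {z : ℂ} (hz : z ≠ 0) :
    dw (dwbar φ) z = (2 * z)⁻¹ * (2 * conj z)⁻¹ * dzb (dz φ) z := by
  have := (hasWirtAt_inv_conj hz).mul (h.dzb.hasWirtAt hz)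
  rw [show dwbar φ = fun y => (2 * conj y)⁻¹ * dzb φ y from funext fun y => dwbar_eq φ y, this.dw,
    dz_dzb_comm ((h.contDiffAt hz).of_le (by norm_cast))]
  ring

lemma dwbar_dw {φ : ℂ → ℂ} (h : SmoothOff φ) {z : ℂ} (hz : z ≠ 0) :
    dwbar (dw φ) z = (2 * z)⁻¹ * (2 * conj z)⁻¹ * dzb (dz φ) z := by
  have := (hasWirtAt_inv hz).mul (h.dz.hasWirtAt hz)
  rw [show dw φ = fun y => (2 * y)⁻¹ * dz φ y from funext fun y => dw_eq φ y, this.dwbar]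
  ring

/-- Both sides vanish at the cone point, where the factor `z⁻¹` takes the value `0`. -/
lemma dw_dwbar_comm {φ : ℂ → ℂ} (h : SmoothOff φ) : dw (dwbar φ) = dwbar (dw φ) := by
  ext z
  rcases eq_or_ne z 0 with rfl | hz
  · simp [dw, dwbar]
  · rw [dw_dwbar h hz, dwbar_dw h hz]

lemma lap_eq {φ : ℂ → ℂ} (h : SmoothOff φ) {z : ℂ} (hz : z ≠ 0) :
    lap φ z = -((‖z‖ ^ 2 : ℝ) : ℂ)⁻¹ * dzb (dz φ) z := by
  have hz' : conj z ≠ 0 := by simpa using hz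
  rw [lap, dw_dwbar h hz, ← conj_mul_self]
  field_simp
  norm_num

lemma dw_conj {φ : ℂ → ℂ} (h : SmoothOff φ) (z : ℂ) :
    dw (fun y => conj (φ y)) z = conj (dwbar φ z) := by
  rcases eq_or_ne z 0 with rfl | hz
  · simp [dw, dwbar]
  · rw [(h.hasWirtAt hz).star.dw, dwbar_eq]
    simp only [map_inv₀, map_mul, conj_ofNat, conj_conj]

lemma dwbar_conj {φ : ℂ → ℂ} (h : SmoothOff φ) (z : ℂ) :
    dwbar (fun y => conj (φ y)) z = conj (dw φ z) := by
  rcases eq_or_ne z 0 with rfl | hz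
  · simp [dw, dwbar]
  · rw [(h.hasWirtAt hz).star.dwbar, dw_eq]
    simp only [map_inv₀, map_mul, conj_ofNat]

lemma lap_conj {φ : ℂ → ℂ} (h : SmoothOff φ) (z : ℂ) :
    lap (fun y => conj (φ y)) z = conj (lap φ z) := by
  rw [lap, show dwbar (fun y => conj (φ y)) = fun y => conj (dw φ y) from
    funext (dwbar_conj h), dw_conj h.dw, lap, dw_dwbar_comm h]
  simp only [map_mul, map_neg, conj_ofNat]

lemma dw_mul {φ ψ : ℂ → ℂ} (h : SmoothOff φ) (k : SmoothOff ψ) (z : ℂ) :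
    dw (fun y => φ y * ψ y) z = φ z * dw ψ z + dw φ z * ψ z := by
  rcases eq_or_ne z 0 with rfl | hz
  · simp [dw]
  · rw [((h.hasWirtAt hz).mul (k.hasWirtAt hz)).dw, dw_eq, dw_eq]; ring

lemma dwbar_mul {φ ψ : ℂ → ℂ} (h : SmoothOff φ) (k : SmoothOff ψ) (z : ℂ) :
    dwbar (fun y => φ y * ψ y) z = φ z * dwbar ψ z + dwbar φ z * ψ z := by
  rcases eq_or_ne z 0 with rfl | hz
  · simp [dwbar]
  · rw [((h.hasWirtAt hz).mul (k.hasWirtAt hz)).dwbar, dwbar_eq, dwbar_eq]; ring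

/-! ### Test functions -/

lemma IsTest.eventually_zero {φ : ℂ → ℂ} (h : IsTest φ) : φ =ᶠ[𝓝 0] 0 :=
  notMem_tsupport_iff_eventuallyEq.1 h.away

lemma IsTest.smoothOff {φ : ℂ → ℂ} (h : IsTest φ) : SmoothOff φ := h.smooth.contDiffOn

/-- A function smooth away from the cone point that vanishes near the cone point and outside a
compact set is a test function. -/
lemma IsTest.of_smoothOff {φ : ℂ → ℂ} (h : SmoothOff φ) (hc : HasCompactSupport φ)
    (h0 : φ =ᶠ[𝓝 0] 0) : IsTest φ where
  smooth := contDiff_iff_contDiffAt.2 fun z => by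
    rcases eq_or_ne z 0 with rfl | hz
    · exact contDiffAt_const.congr_of_eventuallyEq h0
    · exact h.contDiffAt hz
  compact := hc
  away := notMem_tsupport_iff_eventuallyEq.2 h0

lemma IsTest.mul {φ ψ : ℂ → ℂ} (h : IsTest φ) (k : SmoothOff ψ) : IsTest (fun z => φ z * ψ z) :=
  .of_smoothOff (h.smoothOff.mul k) h.compact.mul_right (by
    filter_upwards [h.eventually_zero] with z hz using by simp [hz])

lemma IsTest.star {φ : ℂ → ℂ} (h : IsTest φ) : IsTest (fun z => conj (φ z)) :=
  .of_smoothOff h.smoothOff.star (h.compact.comp_left (g := fun z => conj z) (by simp)) (by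
    filter_upwards [h.eventually_zero] with z hz using by simp [hz])

lemma fderiv_eq_zero_of_eventuallyEq {φ : ℂ → ℂ} {z : ℂ} (h : φ =ᶠ[𝓝 z] 0) :
    fderiv ℝ φ =ᶠ[𝓝 z] 0 := by
  filter_upwards [h.fderiv (𝕜 := ℝ)] with y hy
  rw [hy]; simp

lemma support_dw_subset (φ : ℂ → ℂ) : Function.support (dw φ) ⊆ tsupport φ := by
  intro z hz
  by_contra h
  have := (fderiv_eq_zero_of_eventuallyEq (notMem_tsupport_iff_eventuallyEq.1 h)).self_of_nhds
  exact hz (by simp [dw, this])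

lemma support_dwbar_subset (φ : ℂ → ℂ) : Function.support (dwbar φ) ⊆ tsupport φ := by
  intro z hz
  by_contra h
  have := (fderiv_eq_zero_of_eventuallyEq (notMem_tsupport_iff_eventuallyEq.1 h)).self_of_nhds
  exact hz (by simp [dwbar, this])

lemma hasCompactSupport_dw {φ : ℂ → ℂ} (h : HasCompactSupport φ) : HasCompactSupport (dw φ) :=
  h.mono' (support_dw_subset φ)

lemma hasCompactSupport_dwbar {φ : ℂ → ℂ} (h : HasCompactSupport φ) :
    HasCompactSupport (dwbar φ) :=
  h.mono' (support_dwbar_subset φ)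

lemma hasCompactSupport_lap {φ : ℂ → ℂ} (h : HasCompactSupport φ) : HasCompactSupport (lap φ) :=
  (hasCompactSupport_dw (hasCompactSupport_dwbar h)).mul_left (f := fun _ => (-4 : ℂ))

lemma IsTest.dw {φ : ℂ → ℂ} (h : IsTest φ) : IsTest (dw φ) :=
  .of_smoothOff h.smoothOff.dw (hasCompactSupport_dw h.compact) (by
    filter_upwards [fderiv_eq_zero_of_eventuallyEq h.eventually_zero] with z hz
    simp [Cone.dw, hz])

lemma IsTest.dwbar {φ : ℂ → ℂ} (h : IsTest φ) : IsTest (dwbar φ) :=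
  .of_smoothOff h.smoothOff.dwbar (hasCompactSupport_dwbar h.compact) (by
    filter_upwards [fderiv_eq_zero_of_eventuallyEq h.eventually_zero] with z hz
    simp [Cone.dwbar, hz])

lemma IsTest.lap {φ : ℂ → ℂ} (h : IsTest φ) : IsTest (lap φ) := h.dwbar.dw.smul (-4)

lemma lap_add {φ ψ : ℂ → ℂ} (hφ : IsTest φ) (hψ : IsTest ψ) : lap (φ + ψ) = lap φ + lap ψ := by
  ext z
  simp only [lap, dwbar_add hφ hψ, dw_add hφ.dwbar hψ.dwbar, Pi.add_apply]
  ring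

lemma lap_smul {φ : ℂ → ℂ} (c : ℂ) (hφ : IsTest φ) : lap (c • φ) = c • lap φ := by
  ext z
  simp only [lap, dwbar_smul c hφ, dw_smul c hφ.dwbar, Pi.smul_apply, smul_eq_mul]
  ring

lemma lap_dw {φ : ℂ → ℂ} (h : IsTest φ) : lap (dw φ) = dw (lap φ) := by
  have : lap φ = (-4 : ℂ) • dw (dwbar φ) := rfl
  rw [this, dw_smul _ h.dwbar.dw, dw_dwbar_comm h.smoothOff]
  rfl

lemma lap_dwbar {φ : ℂ → ℂ} (h : IsTest φ) : lap (dwbar φ) = dwbar (lap φ) := by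
  have : lap φ = (-4 : ℂ) • dw (dwbar φ) := rfl
  rw [this, dwbar_smul _ h.dwbar.dw, ← dw_dwbar_comm h.dwbar.smoothOff]
  rfl

/-! ### Integration on the cone -/

lemma measurable_density : Measurable fun z : ℂ => ENNReal.ofReal (4 * ‖z‖ ^ 2) := by fun_prop

lemma integral_area (f : ℂ → ℂ) : ∫ z, f z ∂area = ∫ z, ((4 * ‖z‖ ^ 2 : ℝ) : ℂ) * f z := by
  rw [area, integral_withDensity_eq_integral_toReal_smul measurable_density
    (ae_of_all _ fun _ => ENNReal.ofReal_lt_top)]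
  refine integral_congr_ae (ae_of_all _ fun z => ?_)
  simp only [ENNReal.toReal_ofReal (show (0 : ℝ) ≤ 4 * ‖z‖ ^ 2 by positivity), real_smul]

lemma integrable_area_iff {E : Type*} [NormedAddCommGroup E] [NormedSpace ℝ E] {f : ℂ → E} :
    Integrable f area ↔ Integrable fun z => (4 * ‖z‖ ^ 2 : ℝ) • f z := by
  rw [area, integrable_withDensity_iff_integrable_smul' measurable_density
    (ae_of_all _ fun _ => ENNReal.ofReal_lt_top)]
  refine integrable_congr (ae_of_all _ fun z => ?_)
  simp only [ENNReal.toReal_ofReal (show (0 : ℝ) ≤ 4 * ‖z‖ ^ 2 by positivity)]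

lemma area_absolutelyContinuous : area ≪ volume := withDensity_absolutelyContinuous _ _

lemma ae_ne_zero : ∀ᵐ z : ℂ, z ≠ 0 := by simp [ae_iff]

lemma ae_area_ne_zero : ∀ᵐ z ∂area, z ≠ 0 := area_absolutelyContinuous.ae_le ae_ne_zero

lemma integrable_exp_neg_mul_norm_sq {c : ℝ} (hc : 0 < c) :
    Integrable fun z : ℂ => Real.exp (-c * ‖z‖ ^ 2) := by
  have h := (GaussianFourier.integrable_cexp_neg_mul_sq_norm_add (V := ℂ) (b := (c : ℂ))
    (by simpa using hc) 0 0).norm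
  refine h.congr (ae_of_all _ fun z => ?_)
  simp [norm_exp, ← ofReal_pow]

/-- Only `f(z) |z|` has to be bounded, because the area has density `4 |z|²`. -/
lemma memLp_of_bound {f : ℂ → ℂ} (hf : AEStronglyMeasurable f) {C c : ℝ} (hc : 0 < c)
    (h : ∀ z, ‖f z‖ * ‖z‖ ≤ C * Real.exp (-c * ‖z‖ ^ 2)) : MemLp f 2 area := by
  rw [memLp_two_iff_integrable_sq_norm (hf.mono_ac area_absolutelyContinuous),
    integrable_area_iff]
  refine ((integrable_exp_neg_mul_norm_sq (c := 2 * c) (by positivity)).const_mul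
    (4 * C ^ 2)).mono' (((by fun_prop : Measurable fun z : ℂ => 4 * ‖z‖ ^ 2)
      |>.aestronglyMeasurable).smul (hf.norm.pow 2)) (ae_of_all _ fun z => ?_)
  have h2 := pow_le_pow_left₀ (by positivity) (h z) 2
  have e : Real.exp (-(2 * c) * ‖z‖ ^ 2) = Real.exp (-c * ‖z‖ ^ 2) ^ 2 := by
    rw [← Real.exp_nat_mul]; congr 1; push_cast; ring
  rw [Real.norm_of_nonneg (by simp only [smul_eq_mul]; positivity), e, smul_eq_mul]
  nlinarith

lemma memLp_of_bound_of_support {f : ℂ → ℂ} (hf : AEStronglyMeasurable f) {C R : ℝ}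
    (h : ∀ z, ‖f z‖ * ‖z‖ ≤ C) (hR : ∀ z, R ≤ ‖z‖ → f z = 0) : MemLp f 2 area := by
  have hC : 0 ≤ C := le_trans (by positivity) (h 0)
  refine memLp_of_bound hf one_pos (C := C * Real.exp (R ^ 2)) fun z => ?_
  rcases le_or_gt R ‖z‖ with hz | hz
  · rw [hR z hz, norm_zero, zero_mul]; positivity
  · refine (h z).trans ?_
    rw [mul_assoc, ← Real.exp_add]
    refine le_mul_of_one_le_right hC (Real.one_le_exp ?_)
    nlinarith [norm_nonneg z]

lemma SmoothOff.aestronglyMeasurable {ψ : ℂ → ℂ} (h : SmoothOff ψ) : AEStronglyMeasurable ψ := by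
  have h1 := (ContDiffOn.continuousOn h).aestronglyMeasurable (μ := (volume : Measure ℂ))
    isOpen_off.measurableSet
  rwa [Measure.restrict_eq_self_of_ae_mem (s := {0}ᶜ) ae_ne_zero] at h1

lemma exists_radius {E : Type*} [Zero E] {φ : ℂ → E} (h : HasCompactSupport φ) :
    ∃ R, ∀ z, R ≤ ‖z‖ → φ z = 0 := by
  obtain ⟨R, hR⟩ := h.isCompact.isBounded.exists_norm_le
  refine ⟨R + 1, fun z hz => ?_⟩
  by_contra hne
  linarith [hR z (subset_tsupport _ hne)]

lemma IsTest.memLp {φ : ℂ → ℂ} (h : IsTest φ) : MemLp φ 2 area := by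
  obtain ⟨R, hR⟩ := exists_radius h.compact
  obtain ⟨C, hC⟩ := (h.compact.mul_right (f' := fun z => z)).exists_bound_of_continuous
    (h.smooth.continuous.mul continuous_id)
  exact memLp_of_bound_of_support h.smooth.continuous.aestronglyMeasurable
    (fun z => by simpa using hC z) hR

lemma integrable_fderiv {h : ℂ → ℂ} (h1 : ContDiff ℝ 1 h) (hc : HasCompactSupport h)
    (v : ℂ) : Integrable fun z => fderiv ℝ h z v :=
  ((h1.continuous_fderiv (by simp)).clm_apply continuous_const).integrable_of_hasCompactSupport
    (hc.fderiv_apply (𝕜 := ℝ) v)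

lemma integral_fderiv_eq_zero {h : ℂ → ℂ} (h1 : ContDiff ℝ 1 h) (hc : HasCompactSupport h)
    (v : ℂ) : ∫ z, fderiv ℝ h z v = 0 := by
  have hd : Differentiable ℝ h := h1.differentiable (by simp)
  have := integral_mul_fderiv_eq_neg_fderiv_mul_of_integrable (μ := (volume : Measure ℂ))
    (f := fun _ => (1 : ℂ)) (g := h) (v := v) (by simp) (by simpa using integrable_fderiv h1 hc v)
    (by simpa using h1.continuous.integrable_of_hasCompactSupport hc)
    (fun _ _ => differentiableAt_const _) (fun z _ => hd z)
  simpa using this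

lemma integral_dz {h : ℂ → ℂ} (h1 : ContDiff ℝ 1 h) (hc : HasCompactSupport h) :
    ∫ z, dz h z = 0 := by
  simp only [dz]
  rw [integral_div, integral_sub (integrable_fderiv h1 hc 1)
    ((integrable_fderiv h1 hc I).const_mul I), integral_const_mul, integral_fderiv_eq_zero h1 hc,
    integral_fderiv_eq_zero h1 hc]
  simp

/-- The integrand is `4 |z|² (2 z)⁻¹ ∂_z φ = ∂_z (2 z̄ φ)` in the coordinate `z`. -/
lemma IsTest.integral_dw {φ : ℂ → ℂ} (h : IsTest φ) : ∫ z, Cone.dw φ z ∂area = 0 := by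
  have k : IsTest fun z => φ z * (2 * conj z) :=
    h.mul ((SmoothOff.const 2).mul SmoothOff.id.star)
  rw [integral_area, ← integral_dz (k.smooth.of_le (by simp)) k.compact]
  refine integral_congr_ae ?_
  filter_upwards [ae_ne_zero] with z hz
  rw [((h.smoothOff.hasWirtAt hz).mul ((hasWirtAt_const 2 z).mul (hasWirtAt_conj z))).dz, dw_eq]
  push_cast
  rw [← mul_conj', mul_inv]
  field_simp
  ring

lemma IsTest.integral_dwbar {φ : ℂ → ℂ} (h : IsTest φ) : ∫ z, Cone.dwbar φ z ∂area = 0 := by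
  have e := h.star.integral_dw
  simp only [dw_conj h.smoothOff] at e
  rw [integral_conj] at e
  simpa using e

lemma IsTest.integrable {φ : ℂ → ℂ} (h : IsTest φ) : Integrable φ area := by
  have hc : Continuous fun z : ℂ => (4 * ‖z‖ ^ 2 : ℝ) • φ z := by
    have := h.smooth.continuous
    fun_prop
  refine integrable_area_iff.2 (hc.integrable_of_hasCompactSupport ?_)
  exact h.compact.mono fun z hz hφ => hz (by simp [hφ])

/-- Integration by parts for `∂_w`; no growth condition at the cone point is needed on `ψ`. -/
lemma IsTest.integral_dw_mul {φ ψ : ℂ → ℂ} (h : IsTest φ) (k : SmoothOff ψ) :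
    ∫ z, Cone.dw φ z * ψ z ∂area = -∫ z, φ z * Cone.dw ψ z ∂area := by
  have e := (h.mul k).integral_dw
  simp only [dw_mul h.smoothOff k] at e
  rw [integral_add (h.mul k.dw).integrable (h.dw.mul k).integrable] at e
  linear_combination e

lemma IsTest.integral_dwbar_mul {φ ψ : ℂ → ℂ} (h : IsTest φ) (k : SmoothOff ψ) :
    ∫ z, Cone.dwbar φ z * ψ z ∂area = -∫ z, φ z * Cone.dwbar ψ z ∂area := by
  have e := (h.mul k).integral_dwbar
  simp only [dwbar_mul h.smoothOff k] at e
  rw [integral_add (h.mul k.dwbar).integrable (h.dwbar.mul k).integrable] at e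
  linear_combination e

/-- Green's identity in the weak form. -/
lemma IsTest.integral_dw_dwbar {φ ψ : ℂ → ℂ} (h : IsTest φ) (k : SmoothOff ψ) :
    2 * (∫ z, Cone.dwbar φ z * Cone.dw ψ z ∂area + ∫ z, Cone.dw φ z * Cone.dwbar ψ z ∂area)
      = ∫ z, φ z * Cone.lap ψ z ∂area := by
  rw [h.integral_dwbar_mul k.dw, h.integral_dw_mul k.dwbar, ← dw_dwbar_comm k]
  simp only [Cone.lap]
  have : ∀ z, φ z * (-4 * Cone.dw (Cone.dwbar ψ) z) = -4 * (φ z * Cone.dw (Cone.dwbar ψ) z) :=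
    fun z => by ring
  simp only [this]
  rw [integral_const_mul]
  ring

/-- Green's second identity. -/
lemma IsTest.integral_lap_mul {φ ψ : ℂ → ℂ} (h : IsTest φ) (k : SmoothOff ψ) :
    ∫ z, Cone.lap φ z * ψ z ∂area = ∫ z, φ z * Cone.lap ψ z ∂area := by
  simp only [Cone.lap]
  have e1 : ∀ z, φ z * (-4 * Cone.dw (Cone.dwbar ψ) z) = -4 * (φ z * Cone.dw (Cone.dwbar ψ) z) :=
    fun z => by ring
  simp only [e1, mul_assoc]
  rw [integral_const_mul, integral_const_mul, h.dwbar.integral_dw_mul k,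
    h.integral_dwbar_mul k.dw, dw_dwbar_comm k, neg_neg]

/-! ### The Cauchy–Pompeiu formula at the origin -/

/-- The point `exp (iθ)` of the unit circle. -/
def circ (θ : ℝ) : ℂ := Real.cos θ + Real.sin θ * I

lemma circ_mul_conj (θ : ℝ) : circ θ * conj (circ θ) = 1 := by
  have := Real.sin_sq_add_cos_sq θ
  rw [circ]
  apply Complex.ext <;> simp [cos_ofReal_re, sin_ofReal_re] <;> nlinarith

lemma norm_circ (θ : ℝ) : ‖circ θ‖ = 1 := by
  have h := circ_mul_conj θ
  rw [mul_conj, normSq_eq_norm_sq] at h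
  have h2 : ‖circ θ‖ ^ 2 = 1 := by exact_mod_cast h
  nlinarith [norm_nonneg (circ θ)]

lemma continuous_circ : Continuous circ := by unfold circ; fun_prop

lemma hasDerivAt_circ (θ : ℝ) : HasDerivAt circ (I * circ θ) θ := by
  have h1 := (Real.hasDerivAt_cos θ).ofReal_comp
  have h2 := ((Real.hasDerivAt_sin θ).ofReal_comp).mul_const I
  refine (h1.add h2).congr_deriv ?_
  rw [circ]
  push_cast
  linear_combination (-Complex.sin θ) * I_sq

section

variable {h : ℂ → ℂ}

lemma integrableOn_polar {D : ℝ × ℝ → ℂ} (hD : Continuous D) {R : ℝ}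
    (hR : ∀ r θ, R ≤ r → D (r, θ) = 0) :
    IntegrableOn D (Set.Ioi (0 : ℝ) ×ˢ Set.Ioo (-Real.pi) Real.pi) := by
  have h1 : IntegrableOn D (Set.Icc 0 R ×ˢ Set.Icc (-Real.pi) Real.pi) :=
    hD.continuousOn.integrableOn_compact (isCompact_Icc.prod isCompact_Icc)
  refine h1.of_forall_sdiff_eq_zero (measurableSet_Ioi.prod measurableSet_Ioo) ?_
  rintro ⟨r, θ⟩ ⟨⟨hr, hθ⟩, hn⟩
  apply hR
  by_contra hlt
  exact hn ⟨⟨(Set.mem_Ioi.1 hr).le, (not_le.1 hlt).le⟩, Set.Ioo_subset_Icc_self hθ⟩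

lemma continuous_fderiv_polar (h1 : ContDiff ℝ 1 h) (c : ℂ) :
    Continuous fun p : ℝ × ℝ => fderiv ℝ h (p.1 * circ p.2) (c * circ p.2) := by
  have := h1.continuous_fderiv (by simp)
  have hc := continuous_circ
  exact (this.comp (by fun_prop)).clm_apply (by fun_prop)

lemma integral_radial_derivative (h1 : ContDiff ℝ 1 h) {R : ℝ} (hR : ∀ z, R ≤ ‖z‖ → h z = 0)
    (hR' : ∀ z, R ≤ ‖z‖ → fderiv ℝ h z = 0) (θ : ℝ) :
    ∫ r in Set.Ioi (0 : ℝ), fderiv ℝ h (r * circ θ) (circ θ) = -h 0 := by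
  have hn : ∀ r : ℝ, R ≤ r → 0 ≤ r → R ≤ ‖(r : ℂ) * circ θ‖ := by
    intro r hr h0
    rwa [norm_mul, norm_circ, mul_one, norm_real, Real.norm_of_nonneg h0]
  have hd : ∀ r : ℝ, HasDerivAt (fun r : ℝ => h (r * circ θ))
      (fderiv ℝ h (r * circ θ) (circ θ)) r := by
    intro r
    have h2 : HasDerivAt (fun r : ℝ => (r : ℂ) * circ θ) (circ θ) r := by
      simpa using (HasDerivAt.ofReal_comp (hasDerivAt_id r)).mul_const (circ θ)
    exact ((h1.differentiable (by simp)) _).hasFDerivAt.comp_hasDerivAt r h2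
  have hc : Continuous fun r : ℝ => fderiv ℝ h (r * circ θ) (circ θ) := by
    have := h1.continuous_fderiv (by simp)
    exact (this.comp (by fun_prop)).clm_apply (by fun_prop)
  rw [integral_Ioi_of_hasDerivAt_of_tendsto' (m := 0) (fun r _ => hd r)]
  · simp
  · refine (hc.continuousOn.integrableOn_compact (isCompact_Icc (a := 0) (b := R))
      ).of_forall_sdiff_eq_zero measurableSet_Ioi ?_
    rintro r ⟨hr, hn'⟩
    have hr0 : 0 ≤ r := (Set.mem_Ioi.1 hr).le
    have : R ≤ r := by
      by_contra hlt
      exact hn' ⟨hr0, (not_le.1 hlt).le⟩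
    rw [hR' _ (hn r this hr0)]; simp
  · refine tendsto_const_nhds.congr' ?_
    filter_upwards [eventually_ge_atTop R, eventually_ge_atTop 0] with r h3 h4
    rw [hR _ (hn r h3 h4)]

lemma integral_angular_derivative (h1 : ContDiff ℝ 1 h) {r : ℝ} (hr : 0 < r) :
    ∫ θ in Set.Ioo (-Real.pi) Real.pi, fderiv ℝ h (r * circ θ) (I * circ θ) = 0 := by
  have hd : ∀ θ : ℝ, HasDerivAt (fun θ : ℝ => h (r * circ θ))
      (r * fderiv ℝ h (r * circ θ) (I * circ θ)) θ := by
    intro θ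
    have h2 : HasDerivAt (fun θ : ℝ => (r : ℂ) * circ θ) (r • (I * circ θ)) θ := by
      simpa using (hasDerivAt_circ θ).const_mul (r : ℂ)
    have h3 := ((h1.differentiable (by simp)) (r * circ θ)).hasFDerivAt.comp_hasDerivAt θ h2
    rwa [map_smul, real_smul] at h3
  have hc : Continuous fun θ : ℝ => r * fderiv ℝ h (r * circ θ) (I * circ θ) :=
    continuous_const.mul ((continuous_fderiv_polar h1 I).comp
      (by fun_prop : Continuous fun θ : ℝ => (r, θ)))
  have e := intervalIntegral.integral_eq_sub_of_hasDerivAt (a := -Real.pi) (b := Real.pi)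
    (fun θ _ => hd θ) (hc.intervalIntegrable _ _)
  have e2 : circ (-Real.pi) = circ Real.pi := by simp [circ]
  rw [e2, sub_self, intervalIntegral.integral_const_mul,
    intervalIntegral.integral_of_le (by linarith [Real.pi_pos]), integral_Ioc_eq_integral_Ioo] at e
  exact (mul_eq_zero.1 e).resolve_left (by exact_mod_cast hr.ne')

/-- In polar coordinates `h_z̄ / z · r = (∂_r h + i r⁻¹ ∂_θ h) / 2`, and both terms integrate
explicitly. -/
theorem integral_dzb_div (h1 : ContDiff ℝ 1 h) (hc : HasCompactSupport h) :
    ∫ z, dzb h z / z = -Real.pi * h 0 := by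
  obtain ⟨R, hR⟩ := exists_radius hc
  obtain ⟨R', hR'⟩ := exists_radius (hc.fderiv (𝕜 := ℝ))
  have hpt : ∀ p : ℝ × ℝ, p ∈ Set.Ioi (0 : ℝ) ×ˢ Set.Ioo (-Real.pi) Real.pi →
      p.1 • (dzb h (Complex.polarCoord.symm p) / Complex.polarCoord.symm p)
      = 1 / 2 * fderiv ℝ h (p.1 * circ p.2) (1 * circ p.2)
        + I / 2 * fderiv ℝ h (p.1 * circ p.2) (I * circ p.2) := by
    rintro ⟨r, θ⟩ ⟨hr, -⟩
    have hr : (r : ℂ) ≠ 0 := by exact_mod_cast (Set.mem_Ioi.1 hr).ne'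
    rw [Complex.polarCoord_symm_apply]
    change r • (dzb h (r * circ θ) / (r * circ θ)) = _
    have hw : HasFDerivAt h _ (r * circ θ) :=
      ((h1.differentiable (by simp)) (r * circ θ)).hasWirtAt
    have hu := circ_mul_conj θ
    have hne : circ θ ≠ 0 := left_ne_zero_of_mul_eq_one hu
    simp only [hw.fderiv, wirt_apply, real_smul, map_mul, conj_I, one_mul]
    rw [← mul_div_assoc, mul_div_mul_left _ _ hr, div_eq_iff hne]
    linear_combination (-dzb h (r * circ θ)) * hu
      + (dz h (r * circ θ) * circ θ ^ 2 - dzb h (r * circ θ) * circ θ * conj (circ θ)) * (-1 / 2)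
        * I_sq
  have hnorm : ∀ r θ : ℝ, 0 ≤ r → ‖(r : ℂ) * circ θ‖ = r := by
    intro r θ h0
    rw [norm_mul, norm_circ, mul_one, norm_real, Real.norm_of_nonneg h0]
  have hint : ∀ c : ℂ, IntegrableOn
      (fun p : ℝ × ℝ => fderiv ℝ h (p.1 * circ p.2) (c * circ p.2))
      (Set.Ioi (0 : ℝ) ×ˢ Set.Ioo (-Real.pi) Real.pi) := by
    intro c
    refine integrableOn_polar (continuous_fderiv_polar h1 c) (R := max R' 0) fun r θ hr => ?_
    rw [hR' _ (by rw [hnorm r θ (le_of_max_le_right hr)]; exact le_of_max_le_left hr)]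
    simp
  rw [← Complex.integral_comp_polarCoord_symm]
  change ∫ p in Set.Ioi (0 : ℝ) ×ˢ Set.Ioo (-Real.pi) Real.pi, _ = _
  rw [setIntegral_congr_fun (measurableSet_Ioi.prod measurableSet_Ioo) hpt,
    integral_add ((hint 1).const_mul _) ((hint I).const_mul _), integral_const_mul,
    integral_const_mul]
  have e2 : ∫ p in Set.Ioi (0 : ℝ) ×ˢ Set.Ioo (-Real.pi) Real.pi,
      fderiv ℝ h (p.1 * circ p.2) (I * circ p.2) = 0 := by
    rw [Measure.volume_eq_prod, setIntegral_prod _ (hint I)]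
    exact setIntegral_eq_zero_of_forall_eq_zero fun r hr => integral_angular_derivative h1 hr
  have e1 : ∫ p in Set.Ioi (0 : ℝ) ×ˢ Set.Ioo (-Real.pi) Real.pi,
      fderiv ℝ h (p.1 * circ p.2) (1 * circ p.2) = -(2 * Real.pi) * h 0 := by
    have hi := hint 1
    rw [IntegrableOn, Measure.volume_eq_prod, ← Measure.prod_restrict] at hi
    rw [Measure.volume_eq_prod, ← Measure.prod_restrict, integral_prod_symm _ hi]
    have hr : ∀ θ : ℝ, ∫ r in Set.Ioi (0 : ℝ), fderiv ℝ h (r * circ θ) (1 * circ θ) = -h 0 := by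
      intro θ
      rw [one_mul]
      exact integral_radial_derivative h1 (R := max R R')
        (fun z hz => hR z (le_of_max_le_left hz)) (fun z hz => hR' z (le_of_max_le_right hz)) θ
    simp only [hr]
    rw [setIntegral_const, Real.volume_real_Ioo_of_le (by linarith [Real.pi_pos]), real_smul]
    push_cast
    ring
  rw [e1, e2]
  ring

theorem integral_dz_div_conj (h1 : ContDiff ℝ 1 h) (hc : HasCompactSupport h) :
    ∫ z, dz h z / conj z = -Real.pi * h 0 := by
  have k1 : ContDiff ℝ 1 fun z => conj (h z) := (conjCLE : ℂ →L[ℝ] ℂ).contDiff.comp h1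
  have e := integral_dzb_div k1 (hc.comp_left (g := fun z => conj z) (by simp))
  have e2 : ∀ z, dzb (fun z => conj (h z)) z / z = conj (dz h z / conj z) := by
    intro z
    rw [((h1.differentiable (by simp)) z).hasWirtAt.star.dzb]
    simp
  simp only [e2] at e
  rw [integral_conj] at e
  have e3 := congrArg conj e
  simpa using e3

end

/-! ### Cutting off near the cone point -/

lemma hasCompactSupport_deriv_smoothTransition :
    HasCompactSupport (deriv Real.smoothTransition) := by
  refine HasCompactSupport.intro (isCompact_Icc (a := 0) (b := 1)) fun x hx => ?_
  rcases lt_or_ge x 0 with h | h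
  · have : Real.smoothTransition =ᶠ[𝓝 x] fun _ => 0 := by
      filter_upwards [Iio_mem_nhds h] with y hy
      exact Real.smoothTransition.zero_of_nonpos (le_of_lt hy)
    rw [this.deriv_eq]; simp
  · have h1 : 1 < x := by
      by_contra h1
      exact hx ⟨h, not_lt.1 h1⟩
    have : Real.smoothTransition =ᶠ[𝓝 x] fun _ => 1 := by
      filter_upwards [Ioi_mem_nhds h1] with y hy
      exact Real.smoothTransition.one_of_one_le (le_of_lt hy)
    rw [this.deriv_eq]; simp

lemma deriv_smoothTransition_of_one_lt {x : ℝ} (h : 1 < x) : deriv Real.smoothTransition x = 0 := by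
  have : Real.smoothTransition =ᶠ[𝓝 x] fun _ => 1 := by
    filter_upwards [Ioi_mem_nhds h] with y hy
    exact Real.smoothTransition.one_of_one_le (le_of_lt hy)
  rw [this.deriv_eq]; simp

lemma deriv_deriv_smoothTransition_of_one_lt {x : ℝ} (h : 1 < x) :
    deriv (deriv Real.smoothTransition) x = 0 := by
  have : deriv Real.smoothTransition =ᶠ[𝓝 x] fun _ => 0 := by
    filter_upwards [Ioi_mem_nhds h] with y hy
    exact deriv_smoothTransition_of_one_lt hy
  rw [this.deriv_eq]; simp

lemma contDiff_smoothTransition : ContDiff ℝ ∞ Real.smoothTransition :=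
  Real.smoothTransition.contDiff

lemma contDiff_deriv {F : ℝ → ℝ} (h : ContDiff ℝ ∞ F) : ContDiff ℝ ∞ (deriv F) :=
  (contDiff_infty_iff_deriv.1 h).2

lemma differentiable_of_smooth {F : ℝ → ℝ} (h : ContDiff ℝ ∞ F) : Differentiable ℝ F :=
  h.differentiable (by simp)

lemma exists_bound_smoothTransition : ∃ K, 0 ≤ K ∧ ∀ x, |deriv Real.smoothTransition x| ≤ K ∧
    |deriv (deriv Real.smoothTransition) x| ≤ K := by
  have h1 := contDiff_deriv contDiff_smoothTransition
  obtain ⟨K, hK⟩ := hasCompactSupport_deriv_smoothTransition.exists_bound_of_continuous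
    h1.continuous
  obtain ⟨K', hK'⟩ := hasCompactSupport_deriv_smoothTransition.deriv.exists_bound_of_continuous
    (contDiff_deriv h1).continuous
  refine ⟨max K K', le_trans (abs_nonneg _) ((hK 0).trans (le_max_left _ _)), fun x => ⟨?_, ?_⟩⟩
  · exact (hK x).trans (le_max_left _ _)
  · exact (hK' x).trans (le_max_right _ _)

/-- The radial profile of the cutoff that vanishes for `r ≤ 1 / j` and equals `1` for
`r ≥ 2 / j`. -/
def innerCut (j : ℕ) (r : ℝ) : ℝ := Real.smoothTransition (j * r - 1)

lemma contDiff_innerCut (j : ℕ) : ContDiff ℝ ∞ (innerCut j) :=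
  contDiff_smoothTransition.comp (by fun_prop)

lemma hasDerivAt_affine (c d r : ℝ) : HasDerivAt (fun r : ℝ => c * r + d) c r := by
  simpa using ((hasDerivAt_id r).const_mul c).add_const d

lemma deriv_comp_affine {F : ℝ → ℝ} (h : Differentiable ℝ F) (c d : ℝ) :
    deriv (fun r => F (c * r + d)) = fun r => c * deriv F (c * r + d) := by
  ext r
  have := (h (c * r + d)).hasDerivAt.comp r (hasDerivAt_affine c d r)
  rw [mul_comm]
  exact this.deriv

lemma deriv_deriv_comp_affine {F : ℝ → ℝ} (h : ContDiff ℝ ∞ F) (c d : ℝ) :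
    deriv (deriv fun r => F (c * r + d)) = fun r => c ^ 2 * deriv (deriv F) (c * r + d) := by
  rw [deriv_comp_affine (differentiable_of_smooth h)]
  ext r
  have h1 := differentiable_of_smooth (contDiff_deriv h)
  have h2 : DifferentiableAt ℝ (fun r => deriv F (c * r + d)) r :=
    (h1 _).comp r (hasDerivAt_affine c d r).differentiableAt
  rw [deriv_const_mul _ h2, deriv_comp_affine h1]
  ring

lemma innerCut_eq (j : ℕ) : innerCut j = fun r => Real.smoothTransition (j * r + -1) := by
  ext r; rw [innerCut, sub_eq_add_neg]

lemma deriv_innerCut (j : ℕ) (r : ℝ) :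
    deriv (innerCut j) r = j * deriv Real.smoothTransition (j * r + -1) := by
  rw [innerCut_eq, deriv_comp_affine (differentiable_of_smooth contDiff_smoothTransition)]

lemma deriv_deriv_innerCut (j : ℕ) (r : ℝ) :
    deriv (deriv (innerCut j)) r =
      (j : ℝ) ^ 2 * deriv (deriv Real.smoothTransition) (j * r + -1) := by
  rw [innerCut_eq, deriv_deriv_comp_affine contDiff_smoothTransition]

lemma innerCut_zero {j : ℕ} {r : ℝ} (h : j * r ≤ 1) : innerCut j r = 0 :=
  Real.smoothTransition.zero_of_nonpos (by linarith)

lemma innerCut_one {j : ℕ} {r : ℝ} (h : 2 ≤ j * r) : innerCut j r = 1 :=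
  Real.smoothTransition.one_of_one_le (by linarith)

lemma abs_innerCut_le (j : ℕ) (r : ℝ) : |innerCut j r| ≤ 1 := by
  rw [innerCut, abs_of_nonneg (Real.smoothTransition.nonneg _)]
  exact Real.smoothTransition.le_one _

/-- A radial function on the cone, given by its profile in the variable `r = |z|²`. -/
def radial (F : ℝ → ℝ) (z : ℂ) : ℂ := (F (‖z‖ ^ 2) : ℂ)

lemma contDiff_radial {F : ℝ → ℝ} (h : ContDiff ℝ ∞ F) : ContDiff ℝ ∞ (radial F) :=
  ofRealCLM.contDiff.comp (h.comp (contDiff_norm_sq ℝ))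

lemma smoothOff_radial {F : ℝ → ℝ} (h : ContDiff ℝ ∞ F) : SmoothOff (radial F) :=
  (contDiff_radial h).contDiffOn

lemma hasWirtAt_radial_of_smooth {F : ℝ → ℝ} (h : ContDiff ℝ ∞ F) (z : ℂ) :
    HasWirtAt (radial F) (deriv F (‖z‖ ^ 2) * conj z) (deriv F (‖z‖ ^ 2) * z) z :=
  hasWirtAt_radial (differentiable_of_smooth h _).hasDerivAt

lemma radial_innerCut_eventually_zero (j : ℕ) : radial (innerCut j) =ᶠ[𝓝 0] 0 := by
  have : ∀ᶠ z : ℂ in 𝓝 0, (j : ℝ) * ‖z‖ ^ 2 < 1 := by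
    have hc : Continuous fun z : ℂ => (j : ℝ) * ‖z‖ ^ 2 := by fun_prop
    exact hc.continuousAt.eventually_lt continuousAt_const (by simp)
  filter_upwards [this] with z hz
  simp [radial, innerCut_zero hz.le]

lemma isTest_innerCut_mul {e : ℂ → ℂ} (he : SmoothOff e) (hc : HasCompactSupport e) (j : ℕ) :
    IsTest fun z => radial (innerCut j) z * e z :=
  .of_smoothOff ((smoothOff_radial (contDiff_innerCut j)).mul he) hc.mul_left (by
    filter_upwards [radial_innerCut_eventually_zero j] with z hz using by simp [hz])

lemma tendsto_radial_innerCut {z : ℂ} (hz : z ≠ 0) :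
    Tendsto (fun j => radial (innerCut j) z) atTop (𝓝 1) := by
  refine tendsto_const_nhds.congr' ?_
  have h : 0 < ‖z‖ ^ 2 := by positivity
  obtain ⟨N, hN⟩ := exists_nat_gt (2 / ‖z‖ ^ 2)
  filter_upwards [eventually_ge_atTop N] with j hj
  have : 2 ≤ j * ‖z‖ ^ 2 := by
    rw [div_lt_iff₀ h] at hN
    have : (N : ℝ) ≤ j := by exact_mod_cast hj
    nlinarith
  simp [radial, innerCut_one this]

lemma memLp_two_integrable_mul {g f : ℂ → ℂ} (hg : MemLp g 2 area) (hf : MemLp f 2 area) :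
    Integrable (fun z => g z * f z) area := MemLp.integrable_mul hg hf

/-- Bounded multipliers converging to `1` may be inserted in an integral. -/
lemma tendsto_integral_cut {g f : ℂ → ℂ} (hg : MemLp g 2 area) (hf : MemLp f 2 area)
    {χ : ℕ → ℝ → ℝ} (hχ : ∀ j, Continuous (χ j)) (h1 : ∀ j r, |χ j r| ≤ 1)
    (hlim : ∀ z ≠ 0, Tendsto (fun j => radial (χ j) z) atTop (𝓝 1)) :
    Tendsto (fun j => ∫ z, g z * (radial (χ j) z * f z) ∂area) atTop
      (𝓝 (∫ z, g z * f z ∂area)) := by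
  have hgf := memLp_two_integrable_mul hg hf
  refine tendsto_integral_of_dominated_convergence (fun z => ‖g z * f z‖) (fun j => ?_) hgf.norm
    (fun j => ae_of_all _ fun z => ?_) ?_
  · refine hg.1.mul (AEStronglyMeasurable.mul ?_ hf.1)
    have hc := hχ j
    exact (show Continuous (radial (χ j)) by unfold radial; fun_prop).aestronglyMeasurable
  · rw [norm_mul, norm_mul, norm_mul]
    have : ‖radial (χ j) z‖ ≤ 1 := by
      rw [radial, norm_real]; exact h1 _ _
    gcongr
    exact mul_le_of_le_one_left (norm_nonneg _) this
  · filter_upwards [ae_area_ne_zero] with z hz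
    have := ((hlim z hz).mul_const (f z)).const_mul (g z)
    simpa using this

/-- The discs `r ≤ 2 / j` around the cone point. -/
def disc (j : ℕ) : Set ℂ := {z | (j : ℝ) * ‖z‖ ^ 2 ≤ 2}

lemma measurableSet_disc (j : ℕ) : MeasurableSet (disc j) :=
  measurableSet_le (by fun_prop) measurable_const

lemma area_disc_le {j : ℕ} (hj : 0 < j) :
    area (disc j) ≤ ENNReal.ofReal (16 * Real.pi / j ^ 2) := by
  have hj' : (0 : ℝ) < j := by exact_mod_cast hj
  have hsub : disc j ⊆ Metric.closedBall 0 (√(2 / j)) := by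
    intro z hz
    rw [mem_closedBall_zero_iff]
    refine Real.le_sqrt_of_sq_le ?_
    rw [le_div_iff₀ hj']
    have : (j : ℝ) * ‖z‖ ^ 2 ≤ 2 := hz
    linarith
  rw [area, withDensity_apply _ (measurableSet_disc j)]
  calc ∫⁻ z in disc j, ENNReal.ofReal (4 * ‖z‖ ^ 2)
      ≤ ∫⁻ _ in disc j, ENNReal.ofReal (8 / j) := by
        refine setLIntegral_mono' (measurableSet_disc j) fun z hz => ENNReal.ofReal_le_ofReal ?_
        rw [le_div_iff₀ hj']
        have : (j : ℝ) * ‖z‖ ^ 2 ≤ 2 := hz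
        linarith
    _ = ENNReal.ofReal (8 / j) * volume (disc j) := setLIntegral_const _ _
    _ ≤ ENNReal.ofReal (8 / j) * ENNReal.ofReal (2 * Real.pi / j) := by
        gcongr
        refine (measure_mono hsub).trans (le_of_eq ?_)
        rw [Complex.volume_closedBall, ← ENNReal.ofReal_pow (by positivity),
          Real.sq_sqrt (by positivity), ← NNReal.coe_real_pi,
          ENNReal.ofReal_div_of_pos hj', ENNReal.ofReal_div_of_pos hj',
          ENNReal.ofReal_mul (by norm_num), ENNReal.ofReal_coe_nnreal]
        simp only [div_eq_mul_inv]
        ring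
    _ = ENNReal.ofReal (16 * Real.pi / j ^ 2) := by
        rw [← ENNReal.ofReal_mul (by positivity)]
        congr 1
        field_simp
        norm_num

/-- Errors of size `O(j)` supported in the disc of area `O(j⁻²)` are bounded in `L²`, and
tend weakly to `0` since the support shrinks to the cone point. -/
lemma tendsto_integral_disc {g : ℂ → ℂ} (hg : MemLp g 2 area) {E : ℕ → ℂ → ℂ} {C : ℝ}
    (hE : ∀ j z, ‖E j z‖ ≤ C * j) (hS : ∀ j z, z ∉ disc j → E j z = 0) :
    Tendsto (fun j => ∫ z, g z * E j z ∂area) atTop (𝓝 0) := by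
  have hC : 0 ≤ C := by simpa using (norm_nonneg _).trans (hE 1 0)
  have hsq := (memLp_two_iff_integrable_sq_norm hg.1).1 hg
  have ha : Tendsto (fun j => ∫ z in disc j, ‖g z‖ ^ 2 ∂area) atTop (𝓝 0) := by
    have h1 := tendsto_setIntegral_of_antitone (μ := area) (f := fun z => ‖g z‖ ^ 2) (s := disc)
      measurableSet_disc (fun i j hij z hz => by
        have h2 : (i : ℝ) ≤ j := by exact_mod_cast hij
        have h3 : (j : ℝ) * ‖z‖ ^ 2 ≤ 2 := hz
        change (i : ℝ) * ‖z‖ ^ 2 ≤ 2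
        nlinarith [sq_nonneg ‖z‖]) ⟨0, hsq.integrableOn⟩
    have h0 : area (⋂ n, disc n) = 0 := by
      refine measure_mono_null (t := {z | ¬ z ≠ 0}) (fun z hz hne => ?_) (ae_iff.1 ae_area_ne_zero)
      have h : 0 < ‖z‖ ^ 2 := by positivity
      obtain ⟨N, hN⟩ := exists_nat_gt (2 / ‖z‖ ^ 2)
      rw [div_lt_iff₀ h] at hN
      exact absurd (Set.mem_iInter.1 hz N) (not_le.2 hN)
    rwa [setIntegral_measure_zero _ h0] at h1
  have hb : ∀ j : ℕ, 0 < j → ‖∫ z, g z * E j z ∂area‖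
      ≤ √(∫ z in disc j, ‖g z‖ ^ 2 ∂area) * √(C ^ 2 * (16 * Real.pi)) := by
    intro j hj
    have hj' : (0 : ℝ) < j := by exact_mod_cast hj
    have hfin : IsFiniteMeasure (area.restrict (disc j)) :=
      ⟨by rw [Measure.restrict_apply_univ]; exact (area_disc_le hj).trans_lt ENNReal.ofReal_lt_top⟩
    have hg' : MemLp g (ENNReal.ofReal 2) (area.restrict (disc j)) := by
      simpa using hg.restrict (disc j)
    have hc : MemLp (fun _ : ℂ => ((C * j : ℝ) : ℂ)) (ENNReal.ofReal 2) (area.restrict (disc j)) :=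
      memLp_const _
    have h1 := integral_mul_norm_le_Lp_mul_Lq Real.HolderConjugate.two_two hg' hc
    have hint : Integrable (fun z => ‖g z‖ * (C * j)) (area.restrict (disc j)) :=
      ((hg'.integrable (by simp)).norm).mul_const _
    have h2 : ‖∫ z, g z * E j z ∂area‖ ≤ ∫ z in disc j, ‖g z‖ * (C * j) ∂area := by
      rw [← integral_indicator (measurableSet_disc j)]
      refine norm_integral_le_of_norm_le ((integrable_indicator_iff (measurableSet_disc j)).2 hint)
        (ae_of_all _ fun z => ?_)
      by_cases hz : z ∈ disc j
      · rw [Set.indicator_of_mem hz, norm_mul]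
        exact mul_le_mul_of_nonneg_left (hE j z) (norm_nonneg _)
      · simp [hS j z hz, Set.indicator_of_notMem hz]
    refine h2.trans ?_
    have hCj : ‖((C * j : ℝ) : ℂ)‖ = C * j := by
      rw [norm_real, Real.norm_of_nonneg (by positivity)]
    simp only [hCj, Real.rpow_ofNat, ← Real.sqrt_eq_rpow] at h1
    refine h1.trans ?_
    gcongr
    rw [setIntegral_const, smul_eq_mul]
    have h3 : area.real (disc j) ≤ 16 * Real.pi / j ^ 2 :=
      ENNReal.toReal_le_of_le_ofReal (by positivity) (area_disc_le hj)
    calc area.real (disc j) * (C * j) ^ 2 ≤ 16 * Real.pi / j ^ 2 * (C * j) ^ 2 := by gcongr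
      _ = C ^ 2 * (16 * Real.pi) := by field_simp
  refine squeeze_zero_norm' (a := fun j : ℕ =>
    √(∫ z in disc j, ‖g z‖ ^ 2 ∂area) * √(C ^ 2 * (16 * Real.pi))) ?_ ?_
  · filter_upwards [eventually_gt_atTop 0] with j hj using hb j hj
  · have := (ha.sqrt).mul_const (√(C ^ 2 * (16 * Real.pi)))
    simpa using this

lemma dw_radial_innerCut_bound : ∃ C, ∀ (j : ℕ) z, ‖dw (radial (innerCut j)) z‖ ≤ C * j ∧
    ‖dwbar (radial (innerCut j)) z‖ ≤ C * j ∧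
    (z ∉ disc j → dw (radial (innerCut j)) z = 0 ∧ dwbar (radial (innerCut j)) z = 0) := by
  obtain ⟨K, hK0, hK⟩ := exists_bound_smoothTransition
  refine ⟨K, fun j z => ?_⟩
  have hw := hasWirtAt_radial_of_smooth (contDiff_innerCut j) z
  have hd : |deriv (innerCut j) (‖z‖ ^ 2)| ≤ K * j := by
    rw [deriv_innerCut, abs_mul, Nat.abs_cast, mul_comm]
    gcongr
    exact (hK _).1
  rw [hw.dw, hw.dwbar]
  rcases eq_or_ne z 0 with rfl | hz
  · simp; positivity
  have hn : ‖z‖ ≠ 0 := by simpa using hz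
  refine ⟨?_, ?_, fun hj => ?_⟩
  · simp only [norm_mul, norm_inv, RCLike.norm_conj, norm_real, Real.norm_eq_abs, norm_ofNat]
    field_simp
    nlinarith [abs_nonneg (deriv (innerCut j) (‖z‖ ^ 2))]
  · simp only [norm_mul, norm_inv, RCLike.norm_conj, norm_real, Real.norm_eq_abs, norm_ofNat]
    field_simp
    nlinarith [abs_nonneg (deriv (innerCut j) (‖z‖ ^ 2))]
  · have h2 : 2 < (j : ℝ) * ‖z‖ ^ 2 := not_le.1 hj
    have : deriv (innerCut j) (‖z‖ ^ 2) = 0 := by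
      rw [deriv_innerCut, deriv_smoothTransition_of_one_lt (by linarith), mul_zero]
    simp [this]

/-! ### Elements of the Friedrichs domain -/

/-- The Hahn–Banach criterion for membership in the closure of a subspace. -/
lemma mem_topologicalClosure_of_dual {E : Type*} [NormedAddCommGroup E] [NormedSpace ℂ E]
    (S : Submodule ℂ E) (x : E) (h : ∀ f : E →L[ℂ] ℂ, (∀ y ∈ S, f y = 0) → f x = 0) :
    x ∈ S.topologicalClosure := by
  by_contra hx
  have hcl : IsClosed (S.topologicalClosure : Set E) := S.isClosed_topologicalClosure
  have hne : S.topologicalClosure.mkQL x ≠ 0 := by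
    rw [Submodule.mkQL_apply, Submodule.mkQ_apply, Ne, Submodule.Quotient.mk_eq_zero]
    exact hx
  obtain ⟨f, hf⟩ := SeparatingDual.exists_ne_zero (R := ℂ) hne
  refine hf (h (f.comp S.topologicalClosure.mkQL) fun y hy => ?_)
  have : S.topologicalClosure.mkQL y = 0 := by
    rw [Submodule.mkQL_apply, Submodule.mkQ_apply, Submodule.Quotient.mk_eq_zero]
    exact S.le_topologicalClosure hy
  rw [ContinuousLinearMap.comp_apply, this, map_zero]

lemma inner_eq_integral (g u : L2) {f : ℂ → ℂ} (h : u =ᵐ[area] f) :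
    inner ℂ g u = ∫ z, conj (g z) * f z ∂area := by
  rw [L2.inner_def]
  refine integral_congr_ae ?_
  filter_upwards [h] with z hz
  rw [hz, RCLike.inner_apply]
  ring

lemma memLp_conj {g : ℂ → ℂ} (h : MemLp g 2 area) : MemLp (fun z => conj (g z)) 2 area :=
  h.star

lemma pairing_apply (f g : L2) : pairing f g = ∫ z, f z * g z ∂area :=
  ContinuousLinearMap.lpPairing_eq_integral _ f g

lemma pairing_comm (f g : L2) : pairing f g = pairing g f := by
  rw [pairing_apply, pairing_apply]; simp only [mul_comm]

lemma pairing_eq {f g : L2} {φ ψ : ℂ → ℂ} (hf : f =ᵐ[area] φ) (hg : g =ᵐ[area] ψ) :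
    pairing f g = ∫ z, φ z * ψ z ∂area := by
  rw [pairing_apply]
  refine integral_congr_ae ?_
  filter_upwards [hf, hg] with z h1 h2
  rw [h1, h2]

section

variable {e : ℂ → ℂ}

lemma exists_bound_wirt (he : ContDiff ℝ ∞ e) (hc : HasCompactSupport e) :
    ∃ C, ∀ z, ‖dz e z‖ ≤ C ∧ ‖dzb e z‖ ≤ C := by
  obtain ⟨C, hC⟩ := (hc.fderiv (𝕜 := ℝ)).exists_bound_of_continuous
    (he.continuous_fderiv (by simp))
  have hb : ∀ z, ‖fderiv ℝ e z 1‖ ≤ C ∧ ‖I * fderiv ℝ e z I‖ ≤ C := by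
    intro z
    have h1 := (fderiv ℝ e z).le_of_opNorm_le (hC z) 1
    have h2 := (fderiv ℝ e z).le_of_opNorm_le (hC z) I
    exact ⟨by simpa using h1, by simpa using h2⟩
  refine ⟨C, fun z => ⟨?_, ?_⟩⟩
  · rw [dz, norm_div, RCLike.norm_ofNat, div_le_iff₀ two_pos]
    linarith [norm_sub_le (fderiv ℝ e z 1) (I * fderiv ℝ e z I), (hb z).1, (hb z).2]
  · rw [dzb, norm_div, RCLike.norm_ofNat, div_le_iff₀ two_pos]
    linarith [norm_add_le (fderiv ℝ e z 1) (I * fderiv ℝ e z I), (hb z).1, (hb z).2]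

lemma memLp_of_continuous (he : Continuous e) (hc : HasCompactSupport e) : MemLp e 2 area := by
  obtain ⟨R, hR⟩ := exists_radius hc
  obtain ⟨C, hC⟩ := (hc.mul_right (f' := fun z => z)).exists_bound_of_continuous
    (he.mul continuous_id)
  exact memLp_of_bound_of_support he.aestronglyMeasurable (fun z => by simpa using hC z) hR

lemma norm_inv_mul_mul_le {z d : ℂ} {C : ℝ} (h : ‖d‖ ≤ C) : ‖(2 * z)⁻¹ * d‖ * ‖z‖ ≤ C := by
  rcases eq_or_ne z 0 with rfl | hz
  · simpa using (norm_nonneg d).trans h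
  · have hn : ‖z‖ ≠ 0 := by simpa using hz
    rw [norm_mul, norm_inv, norm_mul, norm_ofNat]
    field_simp
    linarith [norm_nonneg d]

lemma memLp_dw (he : ContDiff ℝ ∞ e) (hc : HasCompactSupport e) : MemLp (dw e) 2 area := by
  obtain ⟨R, hR⟩ := exists_radius (hasCompactSupport_dw hc)
  obtain ⟨C, hC⟩ := exists_bound_wirt he hc
  exact memLp_of_bound_of_support (SmoothOff.dw he.contDiffOn).aestronglyMeasurable
    (fun z => by rw [dw_eq]; exact norm_inv_mul_mul_le (hC z).1) hR

lemma memLp_dwbar (he : ContDiff ℝ ∞ e) (hc : HasCompactSupport e) : MemLp (dwbar e) 2 area := by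
  obtain ⟨R, hR⟩ := exists_radius (hasCompactSupport_dwbar hc)
  obtain ⟨C, hC⟩ := exists_bound_wirt he hc
  refine memLp_of_bound_of_support (SmoothOff.dwbar he.contDiffOn).aestronglyMeasurable
    (fun z => ?_) hR (C := C)
  have := norm_inv_mul_mul_le (z := conj z) (hC z).2
  rwa [RCLike.norm_conj, ← dwbar_eq] at this

/-- Cutting off at radius `1 / j` changes the gradient by an error bounded in `L²` and tending
weakly to `0`, so the cone point has capacity zero: no vanishing at the cone point is required for
a function to lie in the form domain. -/
lemma mem_formDomain (he : ContDiff ℝ ∞ e) (hc : HasCompactSupport e) {u d d' : L2}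
    (hu : u =ᵐ[area] e) (hd : d =ᵐ[area] dw e) (hd' : d' =ᵐ[area] dwbar e) :
    (u, d, d') ∈ formDomain := by
  refine mem_topologicalClosure_of_dual _ _ fun f hf => ?_
  obtain ⟨g₁, hg₁⟩ := (InnerProductSpace.toDual ℂ L2).surjective
    (f.comp (ContinuousLinearMap.inl ℂ L2 (L2 × L2)))
  obtain ⟨g₂, hg₂⟩ := (InnerProductSpace.toDual ℂ L2).surjective
    (f.comp ((ContinuousLinearMap.inr ℂ L2 (L2 × L2)).comp (ContinuousLinearMap.inl ℂ L2 L2)))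
  obtain ⟨g₃, hg₃⟩ := (InnerProductSpace.toDual ℂ L2).surjective
    (f.comp ((ContinuousLinearMap.inr ℂ L2 (L2 × L2)).comp (ContinuousLinearMap.inr ℂ L2 L2)))
  have hrep : ∀ (a b c : L2) (α β γ : ℂ → ℂ), a =ᵐ[area] α → b =ᵐ[area] β → c =ᵐ[area] γ →
      f (a, b, c) = ∫ z, conj (g₁ z) * α z ∂area + ∫ z, conj (g₂ z) * β z ∂area
        + ∫ z, conj (g₃ z) * γ z ∂area := by
    intro a b c α β γ ha hb hcc
    have e1 := DFunLike.congr_fun hg₁ a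
    have e2 := DFunLike.congr_fun hg₂ b
    have e3 := DFunLike.congr_fun hg₃ c
    rw [InnerProductSpace.toDual_apply_apply] at e1 e2 e3
    rw [← inner_eq_integral g₁ a ha, ← inner_eq_integral g₂ b hb, ← inner_eq_integral g₃ c hcc,
      e1, e2, e3]
    simp only [ContinuousLinearMap.comp_apply, ← map_add]
    simp
  have m₁ := memLp_conj (Lp.memLp g₁)
  have m₂ := memLp_conj (Lp.memLp g₂)
  have m₃ := memLp_conj (Lp.memLp g₃)
  have hoff : SmoothOff e := he.contDiffOn
  have me : MemLp e 2 area := memLp_of_continuous he.continuous hc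
  have mdw := memLp_dw he hc
  have mdwbar := memLp_dwbar he hc
  obtain ⟨M, hM⟩ := hc.exists_bound_of_continuous he.continuous
  have hM0 : 0 ≤ M := (norm_nonneg _).trans (hM 0)
  obtain ⟨C, hC⟩ := dw_radial_innerCut_bound
  have hχc : ∀ j, Continuous (innerCut j) := fun j => (contDiff_innerCut j).continuous
  have hlim : ∀ z ≠ 0, Tendsto (fun j => radial (innerCut j) z) atTop (𝓝 1) :=
    fun z hz => tendsto_radial_innerCut hz
  have t₁ := tendsto_integral_cut m₁ me hχc abs_innerCut_le hlim
  have t₂ := tendsto_integral_cut m₂ mdw hχc abs_innerCut_le hlim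
  have t₃ := tendsto_integral_cut m₃ mdwbar hχc abs_innerCut_le hlim
  have s₂ := tendsto_integral_disc m₂ (E := fun j z => dw (radial (innerCut j)) z * e z)
    (C := C * M) (fun j z => by
      have h1 := (hC j z).1
      rw [norm_mul]
      calc _ ≤ (C * j) * M := mul_le_mul h1 (hM z) (norm_nonneg _) ((norm_nonneg _).trans h1)
        _ = _ := by ring) (fun j z hz => by simp [((hC j z).2.2 hz).1])
  have s₃ := tendsto_integral_disc m₃ (E := fun j z => dwbar (radial (innerCut j)) z * e z)
    (C := C * M) (fun j z => by
      have h1 := (hC j z).2.1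
      rw [norm_mul]
      calc _ ≤ (C * j) * M := mul_le_mul h1 (hM z) (norm_nonneg _) ((norm_nonneg _).trans h1)
        _ = _ := by ring) (fun j z hz => by simp [((hC j z).2.2 hz).2])
  have key := (t₁.add (t₂.add s₂)).add (t₃.add s₃)
  have hzero : ∀ j, (∫ z, conj (g₁ z) * (radial (innerCut j) z * e z) ∂area
      + (∫ z, conj (g₂ z) * (radial (innerCut j) z * dw e z) ∂area
        + ∫ z, conj (g₂ z) * (dw (radial (innerCut j)) z * e z) ∂area))
      + (∫ z, conj (g₃ z) * (radial (innerCut j) z * dwbar e z) ∂area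
        + ∫ z, conj (g₃ z) * (dwbar (radial (innerCut j)) z * e z) ∂area) = 0 := by
    intro j
    have hχ := smoothOff_radial (contDiff_innerCut j)
    have ht := isTest_innerCut_mul hoff hc j
    have hta : IsTest fun z => radial (innerCut j) z * dw e z :=
      isTest_innerCut_mul hoff.dw (hasCompactSupport_dw hc) j
    have htb : IsTest fun z => radial (innerCut j) z * dwbar e z :=
      isTest_innerCut_mul hoff.dwbar (hasCompactSupport_dwbar hc) j
    have hda : dw (fun z => radial (innerCut j) z * e z) = fun z =>
        radial (innerCut j) z * dw e z + dw (radial (innerCut j)) z * e z :=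
      funext fun z => dw_mul hχ hoff z
    have hdb : dwbar (fun z => radial (innerCut j) z * e z) = fun z =>
        radial (innerCut j) z * dwbar e z + dwbar (radial (innerCut j)) z * e z :=
      funext fun z => dwbar_mul hχ hoff z
    have hma : MemLp (fun z => dw (radial (innerCut j)) z * e z) 2 area := by
      have := ht.dw.memLp.sub hta.memLp
      rw [hda] at this
      exact (memLp_congr_ae (ae_of_all _ fun z => by simp)).1 this
    have hmb : MemLp (fun z => dwbar (radial (innerCut j)) z * e z) 2 area := by
      have := ht.dwbar.memLp.sub htb.memLp
      rw [hdb] at this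
      exact (memLp_congr_ae (ae_of_all _ fun z => by simp)).1 this
    rw [← integral_add (memLp_two_integrable_mul m₂ hta.memLp) (memLp_two_integrable_mul m₂ hma),
      ← integral_add (memLp_two_integrable_mul m₃ htb.memLp) (memLp_two_integrable_mul m₃ hmb)]
    have := hf (ht.memLp.toLp _, ht.dw.memLp.toLp _, ht.dwbar.memLp.toLp _)
      ⟨_, ht, ht.memLp.coeFn_toLp, ht.dw.memLp.coeFn_toLp, ht.dwbar.memLp.coeFn_toLp⟩
    rw [hrep _ _ _ _ _ _ ht.memLp.coeFn_toLp ht.dw.memLp.coeFn_toLp ht.dwbar.memLp.coeFn_toLp,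
      hda, hdb] at this
    simpa only [mul_add] using this
  rw [hrep _ _ _ _ _ _ hu hd hd']
  simp only [hzero, add_zero] at key
  exact (tendsto_nhds_unique tendsto_const_nhds key).symm

/-- A smooth compactly supported function of the coordinate `z` that is harmonic near the cone
point. -/
structure IsHarm (e : ℂ → ℂ) : Prop where
  smooth : ContDiff ℝ ∞ e
  compact : HasCompactSupport e
  lap : IsTest (Cone.lap e)

lemma IsTest.isHarm {φ : ℂ → ℂ} (h : IsTest φ) : IsHarm φ := ⟨h.smooth, h.compact, h.lap⟩

lemma IsHarm.smoothOff (h : IsHarm e) : SmoothOff e := h.smooth.contDiffOn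

lemma IsHarm.memLp (h : IsHarm e) : MemLp e 2 area :=
  memLp_of_continuous h.smooth.continuous h.compact

lemma IsHarm.formEq (h : IsHarm e) : FormEq (h.memLp.toLp e) (h.lap.memLp.toLp (Cone.lap e))
    ((memLp_dw h.smooth h.compact).toLp (dw e),
      (memLp_dwbar h.smooth h.compact).toLp (dwbar e)) := by
  refine ⟨mem_formDomain h.smooth h.compact h.memLp.coeFn_toLp
    (memLp_dw h.smooth h.compact).coeFn_toLp (memLp_dwbar h.smooth h.compact).coeFn_toLp, ?_⟩
  set d := (memLp_dw h.smooth h.compact).toLp (dw e)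
  set d' := (memLp_dwbar h.smooth h.compact).toLp (dwbar e)
  have hcl : IsClosed {v : L2 × L2 × L2 | 2 * (inner ℂ v.2.1 d + inner ℂ v.2.2 d')
      = inner ℂ v.1 (h.lap.memLp.toLp (Cone.lap e))} :=
    isClosed_eq (by fun_prop) (by fun_prop)
  refine fun v hv => closure_minimal (s := (formCore : Set (L2 × L2 × L2))) ?_ hcl hv
  rintro v ⟨φ, hφ, h1, h2, h3⟩
  have hI : ∀ (a b : L2) (α β : ℂ → ℂ), a =ᵐ[area] α → b =ᵐ[area] β →
      inner ℂ a b = ∫ z, conj (α z) * β z ∂area := by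
    intro a b α β ha hb
    rw [inner_eq_integral a b hb]
    refine integral_congr_ae ?_
    filter_upwards [ha] with z hz
    rw [hz]
  have e := hφ.star.integral_dw_dwbar h.smoothOff
  simp only [dw_conj hφ.smoothOff, dwbar_conj hφ.smoothOff] at e
  change 2 * (inner ℂ v.2.1 d + inner ℂ v.2.2 d') = _
  rw [hI _ _ _ _ h2 (memLp_dw h.smooth h.compact).coeFn_toLp,
    hI _ _ _ _ h3 (memLp_dwbar h.smooth h.compact).coeFn_toLp,
    hI _ _ _ _ h1 h.lap.memLp.coeFn_toLp, e]

/-- The element of `𝓓₂` given by a function harmonic near the cone point. -/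
def IsHarm.toD2 (h : IsHarm e) : D2 :=
  ⟨(h.memLp.toLp e, h.lap.memLp.toLp (Cone.lap e)), _, h.formEq⟩

lemma IsHarm.incl_toD2 (h : IsHarm e) : incl h.toD2 =ᵐ[area] e := h.memLp.coeFn_toLp

lemma IsHarm.Delta_toD2 (h : IsHarm e) : Delta h.toD2 =ᵐ[area] Cone.lap e :=
  h.lap.memLp.coeFn_toLp

lemma IsHarm.grad_toD2 (h : IsHarm e) : grad h.toD2 =
    ((memLp_dw h.smooth h.compact).toLp (dw e),
      (memLp_dwbar h.smooth h.compact).toLp (dwbar e)) :=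
  (grad_spec h.toD2).unique h.formEq

lemma IsHarm.partialW_toD2 (h : IsHarm e) : partialW h.toD2 =ᵐ[area] dw e := by
  have : partialW h.toD2 = (memLp_dw h.smooth h.compact).toLp (dw e) :=
    congrArg Prod.fst h.grad_toD2
  rw [this]
  exact (memLp_dw h.smooth h.compact).coeFn_toLp

lemma IsHarm.partialWbar_toD2 (h : IsHarm e) : partialWbar h.toD2 =ᵐ[area] dwbar e := by
  have : partialWbar h.toD2 = (memLp_dwbar h.smooth h.compact).toLp (dwbar e) :=
    congrArg Prod.snd h.grad_toD2
  rw [this]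
  exact (memLp_dwbar h.smooth h.compact).coeFn_toLp

end

/-! ### The commutator form -/

lemma vectorField_apply (a b : ℂ) (U : D2) :
    vectorField a b U = a • partialW U + b • partialWbar U := rfl

lemma commutator_apply (a b : ℂ) (U V : D2) : commutator a b U V =
    -pairing (Delta U) (vectorField a b V) - pairing (vectorField a b U) (Delta V) := rfl

lemma commutator_symm (a b : ℂ) (U V : D2) : commutator a b U V = commutator a b V U := by
  rw [commutator_apply, commutator_apply, pairing_comm (Delta U), pairing_comm _ (Delta V)]
  ring

lemma commutator_eq (a b : ℂ) (U V : D2) : commutator a b U V =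
    a * (-pairing (Delta U) (partialW V) - pairing (partialW U) (Delta V)) +
    b * (-pairing (Delta U) (partialWbar V) - pairing (partialWbar U) (Delta V)) := by
  rw [commutator_apply, vectorField_apply, vectorField_apply]
  simp only [map_add, map_smul, add_apply, smul_apply, smul_eq_mul]
  ring

section

variable {ψ : ℂ → ℂ}

/-- On the form domain, `∂_w` is the distributional derivative. -/
lemma IsTest.pairing_formDomain (h : IsTest ψ) {v : L2 × L2 × L2} (hv : v ∈ formDomain) :
    pairing (h.memLp.toLp ψ) v.2.1 = -pairing (h.dw.memLp.toLp _) v.1 ∧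
    pairing (h.memLp.toLp ψ) v.2.2 = -pairing (h.dwbar.memLp.toLp _) v.1 := by
  have hcl : IsClosed {v : L2 × L2 × L2 |
      pairing (h.memLp.toLp ψ) v.2.1 = -pairing (h.dw.memLp.toLp _) v.1 ∧
      pairing (h.memLp.toLp ψ) v.2.2 = -pairing (h.dwbar.memLp.toLp _) v.1} := by
    refine (isClosed_eq ?_ ?_).inter (isClosed_eq ?_ ?_) <;> fun_prop
  refine closure_minimal (s := (formCore : Set (L2 × L2 × L2))) ?_ hcl hv
  rintro v ⟨φ, hφ, h1, h2, h3⟩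
  refine ⟨?_, ?_⟩
  · rw [pairing_eq h.memLp.coeFn_toLp h2, pairing_eq h.dw.memLp.coeFn_toLp h1,
      h.integral_dw_mul hφ.smoothOff, neg_neg]
  · rw [pairing_eq h.memLp.coeFn_toLp h3, pairing_eq h.dwbar.memLp.coeFn_toLp h1,
      h.integral_dwbar_mul hφ.smoothOff, neg_neg]

lemma grad_mem (V : D2) : (incl V, partialW V, partialWbar V) ∈ formDomain := (grad_spec V).1

/-- On `𝓓₂`, the Friedrichs Laplacian is the distributional Laplacian. -/
lemma IsTest.pairing_Delta (h : IsTest ψ) (V : D2) :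
    pairing (h.memLp.toLp ψ) (Delta V) = pairing (h.lap.memLp.toLp _) (incl V) := by
  have e := (grad_spec V).2 _ h.star.isHarm.formEq.1
  have k1 := ((h.dwbar.pairing_formDomain (grad_mem V)).1)
  have k2 := ((h.dw.pairing_formDomain (grad_mem V)).2)
  have hI : ∀ {α β : ℂ → ℂ} (a : L2) (hα : MemLp α 2 area) (hβ : MemLp β 2 area),
      (∀ z, conj (α z) = β z) → inner ℂ (hα.toLp α) a = pairing (hβ.toLp β) a := by
    intro α β a hα hβ hab
    rw [inner_eq_integral _ a (f := a) (ae_eq_refl _), pairing_apply]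
    refine integral_congr_ae ?_
    filter_upwards [hα.coeFn_toLp, hβ.coeFn_toLp] with z h1 h2
    rw [h1, h2, hab]
  change 2 * (inner ℂ _ (partialW V) + inner ℂ _ (partialWbar V)) = inner ℂ _ (Delta V) at e
  rw [hI (partialW V) _ h.dwbar.memLp (fun z => by rw [dw_conj h.smoothOff, conj_conj]),
    hI (partialWbar V) _ h.dw.memLp (fun z => by rw [dwbar_conj h.smoothOff, conj_conj]),
    hI (Delta V) _ h.memLp (fun z => conj_conj _), k1, k2] at e
  rw [← e, pairing_eq h.dwbar.dw.memLp.coeFn_toLp (ae_eq_refl _),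
    pairing_eq h.dw.dwbar.memLp.coeFn_toLp (ae_eq_refl _),
    pairing_eq h.lap.memLp.coeFn_toLp (ae_eq_refl _), ← dw_dwbar_comm h.smoothOff]
  simp only [Cone.lap, mul_assoc]
  rw [integral_const_mul]
  ring

/-- Away from the cone point the constant vector fields commute with the Laplacian. -/
lemma IsTest.commutator_toD2 (h : IsTest ψ) (a b : ℂ) (V : D2) :
    commutator a b h.isHarm.toD2 V = 0 := by
  have hΔ : Delta h.isHarm.toD2 = h.lap.memLp.toLp _ := rfl
  have hw : partialW h.isHarm.toD2 = h.dw.memLp.toLp _ :=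
    Lp.ext (h.isHarm.partialW_toD2.trans h.dw.memLp.coeFn_toLp.symm)
  have hwb : partialWbar h.isHarm.toD2 = h.dwbar.memLp.toLp _ :=
    Lp.ext (h.isHarm.partialWbar_toD2.trans h.dwbar.memLp.coeFn_toLp.symm)
  rw [commutator_eq, hΔ, hw, hwb, h.dw.pairing_Delta, h.dwbar.pairing_Delta,
    (h.lap.pairing_formDomain (grad_mem V)).1, (h.lap.pairing_formDomain (grad_mem V)).2]
  simp only [lap_dw h, lap_dwbar h]
  ring

lemma contDiff_dz {e : ℂ → ℂ} (h : ContDiff ℝ ∞ e) : ContDiff ℝ ∞ (dz e) := by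
  have hv : ∀ v, ContDiff ℝ ∞ fun z => fderiv ℝ e z v := fun v =>
    (h.fderiv_right (by simp)).clm_apply contDiff_const
  exact ((hv 1).sub (contDiff_const.mul (hv I))).div_const 2

lemma contDiff_dzb {e : ℂ → ℂ} (h : ContDiff ℝ ∞ e) : ContDiff ℝ ∞ (dzb e) := by
  have hv : ∀ v, ContDiff ℝ ∞ fun z => fderiv ℝ e z v := fun v =>
    (h.fderiv_right (by simp)).clm_apply contDiff_const
  exact ((hv 1).add (contDiff_const.mul (hv I))).div_const 2

lemma hasCompactSupport_dz {e : ℂ → ℂ} (h : HasCompactSupport e) : HasCompactSupport (dz e) :=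
  (h.fderiv (𝕜 := ℝ)).mono fun z hz hn => hz (by simp [dz, hn])

lemma hasCompactSupport_dzb {e : ℂ → ℂ} (h : HasCompactSupport e) : HasCompactSupport (dzb e) :=
  (h.fderiv (𝕜 := ℝ)).mono fun z hz hn => hz (by simp [dzb, hn])

variable {e e' : ℂ → ℂ}

lemma hasWirtAt_of_smooth (h : ContDiff ℝ ∞ e) (z : ℂ) : HasWirtAt e (dz e z) (dzb e z) z :=
  (h.differentiable (by simp) z).hasWirtAt

/-- The integrand is `2 ∂_z̄ (∂_z e ∂_z e') / z`, and the Cauchy–Pompeiu formula evaluates its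
integral at the cone point. -/
lemma IsHarm.integral_lap_dw (h : IsHarm e) (h' : IsHarm e') :
    -(∫ z, Cone.lap e z * dw e' z ∂area) - ∫ z, dw e z * Cone.lap e' z ∂area
      = -2 * Real.pi * (dz e 0 * dz e' 0) := by
  have i1 := memLp_two_integrable_mul h.lap.memLp (memLp_dw h'.smooth h'.compact)
  have i2 := memLp_two_integrable_mul (memLp_dw h.smooth h.compact) h'.lap.memLp
  have hs := (contDiff_dz h.smooth).mul (contDiff_dz h'.smooth)
  have hc : HasCompactSupport fun z => dz e z * dz e' z :=
    (hasCompactSupport_dz h.compact).mul_right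
  have key := integral_dzb_div (hs.of_le (by simp)) hc
  have e1 : ∫ z, (Cone.lap e z * dw e' z + dw e z * Cone.lap e' z) ∂area
      = -2 * ∫ z, dzb (fun z => dz e z * dz e' z) z / z := by
    rw [integral_area, ← integral_const_mul]
    refine integral_congr_ae ?_
    filter_upwards [ae_ne_zero] with z hz
    have hz' : conj z ≠ 0 := by simpa using hz
    rw [((hasWirtAt_of_smooth (contDiff_dz h.smooth) z).mul
      (hasWirtAt_of_smooth (contDiff_dz h'.smooth) z)).dzb, lap_eq h.smoothOff hz,
      lap_eq h'.smoothOff hz, dw_eq, dw_eq]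
    push_cast
    rw [← mul_conj']
    field_simp
    ring
  rw [integral_add i1 i2] at e1
  linear_combination -e1 - (-2) * key

lemma IsHarm.integral_lap_dwbar (h : IsHarm e) (h' : IsHarm e') :
    -(∫ z, Cone.lap e z * dwbar e' z ∂area) - ∫ z, dwbar e z * Cone.lap e' z ∂area
      = -2 * Real.pi * (dzb e 0 * dzb e' 0) := by
  have i1 := memLp_two_integrable_mul h.lap.memLp (memLp_dwbar h'.smooth h'.compact)
  have i2 := memLp_two_integrable_mul (memLp_dwbar h.smooth h.compact) h'.lap.memLp
  have hs := (contDiff_dzb h.smooth).mul (contDiff_dzb h'.smooth)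
  have hc : HasCompactSupport fun z => dzb e z * dzb e' z :=
    (hasCompactSupport_dzb h.compact).mul_right
  have key := integral_dz_div_conj (hs.of_le (by simp)) hc
  have e1 : ∫ z, (Cone.lap e z * dwbar e' z + dwbar e z * Cone.lap e' z) ∂area
      = -2 * ∫ z, dz (fun z => dzb e z * dzb e' z) z / conj z := by
    rw [integral_area, ← integral_const_mul]
    refine integral_congr_ae ?_
    filter_upwards [ae_ne_zero] with z hz
    have hz' : conj z ≠ 0 := by simpa using hz
    rw [((hasWirtAt_of_smooth (contDiff_dzb h.smooth) z).mul
      (hasWirtAt_of_smooth (contDiff_dzb h'.smooth) z)).dz, lap_eq h.smoothOff hz,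
      lap_eq h'.smoothOff hz, dwbar_eq, dwbar_eq,
      ← dz_dzb_comm ((h.smoothOff.contDiffAt hz).of_le (by norm_cast)),
      ← dz_dzb_comm ((h'.smoothOff.contDiffAt hz).of_le (by norm_cast))]
    push_cast
    rw [← mul_conj']
    field_simp
    ring
  rw [integral_add i1 i2] at e1
  linear_combination -e1 - (-2) * key

lemma IsHarm.commutator_toD2 (h : IsHarm e) (h' : IsHarm e') (a b : ℂ) :
    commutator a b h.toD2 h'.toD2
      = -2 * Real.pi * (a * (dz e 0 * dz e' 0) + b * (dzb e 0 * dzb e' 0)) := by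
  rw [commutator_eq, pairing_eq h.Delta_toD2 h'.partialW_toD2,
    pairing_eq h.partialW_toD2 h'.Delta_toD2, pairing_eq h.Delta_toD2 h'.partialWbar_toD2,
    pairing_eq h.partialWbar_toD2 h'.Delta_toD2, h.integral_lap_dw h', h.integral_lap_dwbar h']
  ring

end

/-! ### Angular modes and the functions spanning the expansion -/

/-- The function `zⁿ F(r)`, i.e. `r ^ (n / 2) F(r) exp (i n θ / 2)`. -/
def mode (n : ℕ) (F : ℝ → ℝ) (z : ℂ) : ℂ := z ^ n * radial F z

section

variable {F : ℝ → ℝ} {n : ℕ}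

lemma contDiff_mode (h : ContDiff ℝ ∞ F) : ContDiff ℝ ∞ (mode n F) :=
  (contDiff_id.pow n).mul (contDiff_radial h)

lemma smoothOff_mode (h : ContDiff ℝ ∞ F) : SmoothOff (mode n F) := (contDiff_mode h).contDiffOn

lemma hasWirtAt_mode (h : ContDiff ℝ ∞ F) (z : ℂ) : HasWirtAt (mode n F)
    (n * z ^ (n - 1) * radial F z + z ^ n * (radial (deriv F) z * conj z))
    (mode (n + 1) (deriv F) z) z :=
  ((hasWirtAt_pow n z).mul (hasWirtAt_radial_of_smooth h z)).congr (by rw [radial, radial]; ring)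
    (by simp only [mode, radial]; ring)

/-- The Laplacian of `zⁿ F(r)` is `-zⁿ (F'' + (n + 1) F' / r)`. -/
lemma lap_mode (h : ContDiff ℝ ∞ F) {z : ℂ} (hz : z ≠ 0) : lap (mode n F) z =
    -z ^ n * (deriv (deriv F) (‖z‖ ^ 2) + (n + 1) * deriv F (‖z‖ ^ 2) / (‖z‖ ^ 2 : ℝ)) := by
  have e : dzb (mode n F) = mode (n + 1) (deriv F) := funext fun y => (hasWirtAt_mode h y).dzb
  rw [lap_eq (smoothOff_mode h) hz,
    ← dz_dzb_comm (((smoothOff_mode h).contDiffAt hz).of_le (by norm_cast)), e,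
    (hasWirtAt_mode (contDiff_deriv h) z).dz, radial, radial]
  have hz' : conj z ≠ 0 := by simpa using hz
  simp only [Nat.add_sub_cancel]
  rw [← conj_mul_self, pow_succ]
  push_cast
  field_simp
  ring

lemma lap_apply_zero (φ : ℂ → ℂ) : lap φ 0 = 0 := by simp [lap, dw]

lemma eventually_apply_norm_sq_eq_zero {G : ℝ → ℝ} (h : ∀ᶠ r in 𝓝 0, G r = 0) :
    ∀ᶠ z : ℂ in 𝓝 0, G (‖z‖ ^ 2) = 0 := by
  have hc : Tendsto (fun z : ℂ => ‖z‖ ^ 2) (𝓝 0) (𝓝 0) := by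
    have : Continuous fun z : ℂ => ‖z‖ ^ 2 := by fun_prop
    simpa using this.tendsto 0
  exact hc.eventually h

lemma hasCompactSupport_radial {G : ℝ → ℝ} (h : HasCompactSupport G) :
    HasCompactSupport (radial G) := by
  obtain ⟨R, hR⟩ := h.isCompact.isBounded.exists_norm_le
  refine HasCompactSupport.intro (isCompact_closedBall (0 : ℂ) (√R)) fun z hz => ?_
  rw [mem_closedBall_zero_iff, not_le] at hz
  have h2 : R < ‖z‖ ^ 2 := Real.lt_sq_of_sqrt_lt hz
  rw [radial, ofReal_eq_zero]
  by_contra hne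
  have := hR _ (subset_tsupport _ hne)
  rw [Real.norm_of_nonneg (by positivity)] at this
  linarith

end

section

variable {ρ : ℝ → ℝ}

lemma IsCutoff.deriv_eventually (h : IsCutoff ρ) : ∀ᶠ r in 𝓝 0, deriv ρ r = 0 := by
  have h1 : ρ =ᶠ[𝓝 0] fun _ => 1 := h.eq_one
  filter_upwards [h1.eventuallyEq_nhds] with r hr
  rw [hr.deriv_eq]; simp

lemma IsCutoff.deriv_deriv_eventually (h : IsCutoff ρ) : ∀ᶠ r in 𝓝 0, deriv (deriv ρ) r = 0 := by
  have h1 : deriv ρ =ᶠ[𝓝 0] fun _ => 0 := h.deriv_eventually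
  filter_upwards [h1.eventuallyEq_nhds] with r hr
  rw [hr.deriv_eq]; simp

lemma IsCutoff.apply_zero (h : IsCutoff ρ) : ρ 0 = 1 := h.eq_one.self_of_nhds

lemma IsCutoff.isHarm_mode (h : IsCutoff ρ) (n : ℕ) : IsHarm (mode n ρ) where
  smooth := contDiff_mode h.smooth
  compact := (hasCompactSupport_radial h.compact).mul_left
  lap := .of_smoothOff (smoothOff_mode h.smooth).lap
    (hasCompactSupport_lap (hasCompactSupport_radial h.compact).mul_left) (by
      filter_upwards [eventually_apply_norm_sq_eq_zero h.deriv_eventually,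
        eventually_apply_norm_sq_eq_zero h.deriv_deriv_eventually] with z h1 h2
      rcases eq_or_ne z 0 with rfl | hz
      · exact lap_apply_zero _
      · rw [lap_mode h.smooth hz, h1, h2]; simp)

lemma IsHarm.star {e : ℂ → ℂ} (h : IsHarm e) : IsHarm fun z => conj (e z) where
  smooth := (conjCLE : ℂ →L[ℝ] ℂ).contDiff.comp h.smooth
  compact := h.compact.comp_left (g := fun z => conj z) (by simp)
  lap := by
    rw [funext (lap_conj h.smoothOff)]
    exact h.lap.star

/-- The functions `ρ`, `z ρ` and `z̄ ρ`, indexed by `0`, `1` and `2`. -/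
def base (ρ : ℝ → ℝ) : Fin 3 → ℂ → ℂ
  | 0 => mode 0 ρ
  | 1 => mode 1 ρ
  | 2 => fun z => conj (mode 1 ρ z)

lemma IsCutoff.isHarm_base (h : IsCutoff ρ) : ∀ i, IsHarm (base ρ i)
  | 0 => h.isHarm_mode 0
  | 1 => h.isHarm_mode 1
  | 2 => (h.isHarm_mode 1).star

lemma IsCutoff.hasWirtAt_mode_zero (h : IsCutoff ρ) (n : ℕ) :
    HasWirtAt (mode n ρ) (n * 0 ^ (n - 1)) 0 0 :=
  (hasWirtAt_mode h.smooth 0).congr (by simp [radial, h.apply_zero]) (by simp [mode])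

lemma IsCutoff.hasWirtAt_base (h : IsCutoff ρ) : ∀ i, HasWirtAt (base ρ i)
    (if i = 1 then 1 else 0) (if i = 2 then 1 else 0) 0
  | 0 => (h.hasWirtAt_mode_zero 0).congr (by simp) (by simp)
  | 1 => (h.hasWirtAt_mode_zero 1).congr (by simp) (by simp)
  | 2 => (h.hasWirtAt_mode_zero 1).star.congr (by simp) (by simp)

/-! ### The logarithmic solution -/

/-- The function `log r`. -/
def logr (z : ℂ) : ℂ := (Real.log (‖z‖ ^ 2) : ℂ)

lemma hasWirtAt_logr {z : ℂ} (hz : z ≠ 0) : HasWirtAt logr z⁻¹ (conj z)⁻¹ z := by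
  have hr : (‖z‖ : ℂ) ≠ 0 := by simpa using hz
  have hz' : conj z ≠ 0 := by simpa using hz
  have hr2 := conj_mul_self z
  refine (hasWirtAt_radial (Real.hasDerivAt_log (by positivity))).congr ?_ ?_
  · push_cast at hr2 ⊢
    field_simp
    linear_combination hr2
  · push_cast at hr2 ⊢
    field_simp
    linear_combination hr2

lemma smoothOff_logr : SmoothOff logr := by
  refine SmoothOff.of_contDiffAt fun z hz => ?_
  have h1 : ContDiffAt ℝ ∞ (fun z : ℂ => Real.log (‖z‖ ^ 2)) z :=
    (contDiff_norm_sq ℝ).contDiffAt.log (by positivity)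
  exact ofRealCLM.contDiff.contDiffAt.comp z h1

lemma lap_logr {z : ℂ} (hz : z ≠ 0) : lap logr z = 0 := by
  have e : dz logr =ᶠ[𝓝 z] fun y => 2 * (2 * y)⁻¹ := by
    filter_upwards [isOpen_off.mem_nhds hz] with y hy
    rw [(hasWirtAt_logr hy).dz, mul_inv]
    ring
  have h2 := (((hasWirtAt_const 2 z).mul (hasWirtAt_inv hz)).congr_of_eventuallyEq e).dzb
  rw [lap_eq smoothOff_logr hz, h2]
  simp

lemma lap_mul {φ ψ : ℂ → ℂ} (h : SmoothOff φ) (k : SmoothOff ψ) (z : ℂ) :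
    lap (fun y => φ y * ψ y) z = φ z * lap ψ z + lap φ z * ψ z
      - 4 * (dw φ z * dwbar ψ z + dwbar φ z * dw ψ z) := by
  have e : dwbar (fun y => φ y * ψ y) = fun y => φ y * dwbar ψ y + dwbar φ y * ψ y :=
    funext (dwbar_mul h k)
  rcases eq_or_ne z 0 with rfl | hz
  · simp [lap, dw, dwbar]
  · have h1 := (h.hasWirtAt hz).mul (k.dwbar.hasWirtAt hz)
    have h2 := (h.dwbar.hasWirtAt hz).mul (k.hasWirtAt hz)
    rw [lap, e, (h1.add h2).dw, lap, lap, dw_eq (dwbar ψ), dw_eq (dwbar φ), dw_eq φ, dw_eq ψ]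
    ring

/-- The function `ρ(r) log r`. -/
def kappa (ρ : ℝ → ℝ) (z : ℂ) : ℂ := radial ρ z * logr z

lemma IsCutoff.smoothOff_kappa (h : IsCutoff ρ) : SmoothOff (kappa ρ) :=
  (smoothOff_radial h.smooth).mul smoothOff_logr

lemma IsCutoff.lap_kappa (h : IsCutoff ρ) {z : ℂ} (hz : z ≠ 0) : lap (kappa ρ) z =
    lap (radial ρ) z * logr z - 2 * deriv ρ (‖z‖ ^ 2) / (‖z‖ ^ 2 : ℝ) := by
  have e := lap_mul (smoothOff_radial h.smooth) smoothOff_logr z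
  have hz' : conj z ≠ 0 := by simpa using hz
  rw [lap_logr hz, (hasWirtAt_radial_of_smooth h.smooth z).dw,
    (hasWirtAt_radial_of_smooth h.smooth z).dwbar,
    (hasWirtAt_logr hz).dw, (hasWirtAt_logr hz).dwbar] at e
  change lap (kappa ρ) z = _ at e
  rw [e, ← conj_mul_self]
  field_simp
  ring

lemma mode_zero (F : ℝ → ℝ) : mode 0 F = radial F := by
  ext z; simp [mode]

lemma IsCutoff.isTest_lap_kappa (h : IsCutoff ρ) : IsTest (lap (kappa ρ)) := by
  have hc : HasCompactSupport (kappa ρ) := (hasCompactSupport_radial h.compact).mul_right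
  refine .of_smoothOff h.smoothOff_kappa.lap (hasCompactSupport_lap hc) ?_
  have h0 := (h.isHarm_mode 0).lap.eventually_zero
  rw [mode_zero] at h0
  filter_upwards [h0, eventually_apply_norm_sq_eq_zero h.deriv_eventually] with z h1 h2
  rcases eq_or_ne z 0 with rfl | hz
  · exact lap_apply_zero _
  · rw [h.lap_kappa hz, h1, h2]; simp

lemma IsCutoff.memLp_kappa (h : IsCutoff ρ) : MemLp (kappa ρ) 2 area := by
  have hc : HasCompactSupport (kappa ρ) := (hasCompactSupport_radial h.compact).mul_right
  obtain ⟨R, hR⟩ := exists_radius hc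
  have hk : Continuous fun z : ℂ => radial ρ z * ((2 * (‖z‖ * Real.log ‖z‖) : ℝ) : ℂ) := by
    have h1 := (contDiff_radial h.smooth).continuous
    have h2 := Real.continuous_mul_log.comp (continuous_norm (E := ℂ))
    exact h1.mul (continuous_ofReal.comp (continuous_const.mul h2))
  obtain ⟨C, hC⟩ := ((hasCompactSupport_radial h.compact).mul_right
    (f' := fun z : ℂ => ((2 * (‖z‖ * Real.log ‖z‖) : ℝ) : ℂ))).exists_bound_of_continuous hk
  refine memLp_of_bound_of_support h.smoothOff_kappa.aestronglyMeasurable (fun z => ?_) hR (C := C)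
  refine le_trans (le_of_eq ?_) (hC z)
  rw [kappa, logr, Real.log_pow, Pi.mul_apply]
  simp only [norm_mul, norm_real, Real.norm_eq_abs, abs_norm, Nat.abs_ofNat,
    Nat.cast_ofNat]
  ring

lemma fderiv_comp_neg (φ : ℂ → ℂ) (z : ℂ) :
    fderiv ℝ (fun y => φ (-y)) z = -fderiv ℝ φ (-z) := by
  simpa using fderiv_comp_smul (f := φ) (x := z) (-1 : ℝ)

lemma dw_comp_neg (φ : ℂ → ℂ) (z : ℂ) : dw (fun y => φ (-y)) z = dw φ (-z) := by
  rw [dw, dw, fderiv_comp_neg]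
  simp only [neg_apply, mul_neg, inv_neg]
  ring

lemma dwbar_comp_neg (φ : ℂ → ℂ) (z : ℂ) : dwbar (fun y => φ (-y)) z = dwbar φ (-z) := by
  rw [dwbar, dwbar, fderiv_comp_neg]
  simp only [neg_apply, mul_neg, inv_neg, map_neg]
  ring

lemma lap_comp_neg (φ : ℂ → ℂ) (z : ℂ) : lap (fun y => φ (-y)) z = lap φ (-z) := by
  rw [lap, funext (dwbar_comp_neg φ), dw_comp_neg, lap]

lemma lap_neg (φ : ℂ → ℂ) (z : ℂ) : lap (fun y => -φ y) z = -lap φ z := by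
  have e1 : dwbar (fun y => -φ y) = fun y => -dwbar φ y := by
    ext y; rw [dwbar, dwbar, fderiv_fun_neg]; simp only [neg_apply]; ring
  have e2 : dw (fun y => -dwbar φ y) z = -dw (dwbar φ) z := by
    rw [dw, dw, fderiv_fun_neg]; simp only [neg_apply]; ring
  rw [lap, e1, e2, lap]; ring

/-- The functional `u ↦ ∫ (κ Δu - u Δκ) dS` with `κ = ρ(r) log r`. Green's formula fails for it only
through the logarithmic singularity, so that it picks out `-4π` times the constant term of `u`. -/
def IsCutoff.logForm (h : IsCutoff ρ) : D2 →L[ℂ] ℂ :=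
  (pairing.flip (h.memLp_kappa.toLp _)).comp Delta
    - (pairing.flip (h.isTest_lap_kappa.memLp.toLp _)).comp incl

lemma IsCutoff.logForm_toD2 (h : IsCutoff ρ) {e : ℂ → ℂ} (he : IsHarm e) :
    h.logForm he.toD2 = ∫ z, (lap e z * kappa ρ z - e z * lap (kappa ρ) z) ∂area := by
  rw [integral_sub (memLp_two_integrable_mul he.lap.memLp h.memLp_kappa)
    (memLp_two_integrable_mul he.memLp h.isTest_lap_kappa.memLp),
    ← pairing_eq he.Delta_toD2 h.memLp_kappa.coeFn_toLp,
    ← pairing_eq he.incl_toD2 h.isTest_lap_kappa.memLp.coeFn_toLp]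
  rfl

lemma IsCutoff.logForm_test (h : IsCutoff ρ) {φ : ℂ → ℂ} (hφ : IsTest φ) :
    h.logForm hφ.isHarm.toD2 = 0 := by
  rw [h.logForm_toD2, integral_sub (memLp_two_integrable_mul hφ.lap.memLp h.memLp_kappa)
    (memLp_two_integrable_mul hφ.memLp h.isTest_lap_kappa.memLp),
    hφ.integral_lap_mul h.smoothOff_kappa, sub_self]

lemma integral_area_eq_zero_of_odd {q : ℂ → ℂ} (h : ∀ z, q (-z) = -q z) :
    ∫ z, q z ∂area = 0 := by
  rw [integral_area]
  have e := integral_neg_eq_self (fun z : ℂ => ((4 * ‖z‖ ^ 2 : ℝ) : ℂ) * q z) volume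
  simp only [h, norm_neg, mul_neg] at e
  rw [integral_neg] at e
  exact self_eq_neg.1 e.symm

lemma kappa_neg (ρ : ℝ → ℝ) (z : ℂ) : kappa ρ (-z) = kappa ρ z := by
  simp [kappa, radial, logr]

lemma IsCutoff.logForm_odd (h : IsCutoff ρ) {e : ℂ → ℂ} (he : IsHarm e)
    (ho : ∀ z, e (-z) = -e z) : h.logForm he.toD2 = 0 := by
  rw [h.logForm_toD2]
  refine integral_area_eq_zero_of_odd fun z => ?_
  rw [← lap_comp_neg e, ← lap_comp_neg (kappa ρ), show (fun y => e (-y)) = fun y => -e y from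
    funext ho, lap_neg, ho, kappa_neg, show (fun y => kappa ρ (-y)) = kappa ρ from
    funext (kappa_neg ρ)]
  ring

/-- The integrand is `4 ∂_z̄ (ρ²) / z` in the coordinate `z`. -/
lemma IsCutoff.logForm_mode_zero (h : IsCutoff ρ) :
    h.logForm (h.isHarm_mode 0).toD2 = -4 * Real.pi := by
  have hs : ContDiff ℝ ∞ (fun r => ρ r * ρ r) := h.smooth.mul h.smooth
  have key := integral_dzb_div ((contDiff_radial hs).of_le (by simp))
    (hasCompactSupport_radial h.compact.mul_right)
  rw [h.logForm_toD2, integral_area]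
  have e : ∫ z, ((4 * ‖z‖ ^ 2 : ℝ) : ℂ) * (lap (mode 0 ρ) z * kappa ρ z
      - mode 0 ρ z * lap (kappa ρ) z) = ∫ z, 4 * (dzb (radial fun r => ρ r * ρ r) z / z) := by
    refine integral_congr_ae ?_
    filter_upwards [ae_ne_zero] with z hz
    have hd : deriv (fun r => ρ r * ρ r) (‖z‖ ^ 2) = 2 * ρ (‖z‖ ^ 2) * deriv ρ (‖z‖ ^ 2) := by
      have := (differentiable_of_smooth h.smooth (‖z‖ ^ 2)).hasDerivAt
      rw [(this.fun_mul this).deriv]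
      ring
    have hr : (‖z‖ : ℂ) ≠ 0 := by simpa using hz
    rw [(hasWirtAt_radial_of_smooth hs z).dzb, hd, h.lap_kappa hz, mode_zero, kappa, radial]
    push_cast
    field_simp
    ring
  rw [e, integral_const_mul, key, radial]
  simp [h.apply_zero]

end

/-! ### Rapidly decreasing radial profiles -/

lemma exists_pow_mul_exp_le (n : ℕ) {c : ℝ} (hc : 0 < c) : ∃ A, 0 ≤ A ∧ ∀ z : ℂ,
    ‖z‖ ^ n * Real.exp (-c * ‖z‖ ^ 2) ≤ A * Real.exp (-(c / 2) * ‖z‖ ^ 2) := by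
  refine ⟨1 + n.factorial / (c / 2) ^ n, by positivity, fun z => ?_⟩
  set x := ‖z‖
  have hx : 0 ≤ x := norm_nonneg z
  have h1 : x ^ n ≤ 1 + (x ^ 2) ^ n := by
    rw [← pow_mul, mul_comm, pow_mul]
    nlinarith [sq_nonneg (x ^ n - 1), pow_nonneg hx n]
  have h2 := Real.pow_div_factorial_le_exp ((c / 2) * x ^ 2) (by positivity) n
  have h3 : (x ^ 2) ^ n ≤ n.factorial / (c / 2) ^ n * Real.exp ((c / 2) * x ^ 2) := by
    rw [mul_pow, div_le_iff₀ (by positivity)] at h2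
    rw [div_mul_eq_mul_div, le_div_iff₀ (by positivity)]
    linarith
  have h4 : 1 ≤ Real.exp ((c / 2) * x ^ 2) := Real.one_le_exp (by positivity)
  calc x ^ n * Real.exp (-c * x ^ 2)
      ≤ ((1 + n.factorial / (c / 2) ^ n) * Real.exp ((c / 2) * x ^ 2)) * Real.exp (-c * x ^ 2) := by
        gcongr
        linarith
    _ = (1 + n.factorial / (c / 2) ^ n) * Real.exp (-(c / 2) * x ^ 2) := by
        rw [mul_assoc, ← Real.exp_add]
        congr 2
        ring

lemma memLp_of_pow_exp {f : ℂ → ℂ} (hf : AEStronglyMeasurable f) (n : ℕ) {C c : ℝ} (hc : 0 < c)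
    (h : ∀ z, ‖f z‖ ≤ C * (‖z‖ ^ n * Real.exp (-c * ‖z‖ ^ 2))) : MemLp f 2 area := by
  obtain ⟨A, hA0, hA⟩ := exists_pow_mul_exp_le (n + 1) hc
  refine memLp_of_bound hf (half_pos hc) (C := |C| * A) fun z => ?_
  calc ‖f z‖ * ‖z‖ ≤ C * (‖z‖ ^ n * Real.exp (-c * ‖z‖ ^ 2)) * ‖z‖ := by gcongr; exact h z
    _ = C * (‖z‖ ^ (n + 1) * Real.exp (-c * ‖z‖ ^ 2)) := by ring
    _ ≤ |C| * (‖z‖ ^ (n + 1) * Real.exp (-c * ‖z‖ ^ 2)) := by gcongr; exact le_abs_self C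
    _ ≤ |C| * (A * Real.exp (-(c / 2) * ‖z‖ ^ 2)) :=
        mul_le_mul_of_nonneg_left (hA z) (abs_nonneg C)
    _ = _ := by ring

/-- A profile `F(r)` such that all functions `zⁿ F(r)` and their Laplacians are in `L²`: it
decreases exponentially with two derivatives, and `F'(0) = 0` makes `F'(r) / r` bounded. -/
structure Rapid (F : ℝ → ℝ) : Prop where
  smooth : ContDiff ℝ ∞ F
  deriv_zero : deriv F 0 = 0
  bound : ∃ C c, 0 < c ∧ ∀ r, 0 ≤ r → |F r| ≤ C * Real.exp (-c * r) ∧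
    |deriv F r| ≤ C * Real.exp (-c * r) ∧ |deriv (deriv F) r| ≤ C * Real.exp (-c * r)

namespace Rapid

variable {F G χ : ℝ → ℝ} {n : ℕ}

lemma sub (h : Rapid F) (k : Rapid G) : Rapid (fun r => F r - G r) := by
  have e1 : deriv (fun r => F r - G r) = fun r => deriv F r - deriv G r := funext fun r =>
    deriv_fun_sub (differentiable_of_smooth h.smooth r) (differentiable_of_smooth k.smooth r)
  have e2 : deriv (deriv fun r => F r - G r) = fun r => deriv (deriv F) r - deriv (deriv G) r := by
    rw [e1]
    exact funext fun r => deriv_fun_sub (differentiable_of_smooth (contDiff_deriv h.smooth) r)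
      (differentiable_of_smooth (contDiff_deriv k.smooth) r)
  refine ⟨h.smooth.sub k.smooth, by rw [e1]; simp [h.deriv_zero, k.deriv_zero], ?_⟩
  obtain ⟨C, c, hc, hb⟩ := h.bound
  obtain ⟨C', c', hc', hb'⟩ := k.bound
  have hC : 0 ≤ C := by simpa using (abs_nonneg _).trans (hb 0 le_rfl).1
  have hC' : 0 ≤ C' := by simpa using (abs_nonneg _).trans (hb' 0 le_rfl).1
  refine ⟨C + C', min c c', lt_min hc hc', fun r hr => ?_⟩
  have m1 : C * Real.exp (-c * r) ≤ C * Real.exp (-min c c' * r) := by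
    gcongr; exact min_le_left _ _
  have m2 : C' * Real.exp (-c' * r) ≤ C' * Real.exp (-min c c' * r) := by
    gcongr; exact min_le_right _ _
  obtain ⟨a1, a2, a3⟩ := hb r hr
  obtain ⟨b1, b2, b3⟩ := hb' r hr
  rw [e2, e1]
  refine ⟨?_, ?_, ?_⟩
  · linarith [abs_sub (F r) (G r)]
  · linarith [abs_sub (deriv F r) (deriv G r)]
  · linarith [abs_sub (deriv (deriv F) r) (deriv (deriv G) r)]

lemma deriv_mul (hF : ContDiff ℝ ∞ F) (hχ : ContDiff ℝ ∞ χ) :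
    deriv (fun r => F r * χ r) = fun r => deriv F r * χ r + F r * deriv χ r := funext fun r =>
  deriv_fun_mul (differentiable_of_smooth hF r) (differentiable_of_smooth hχ r)

lemma deriv_deriv_mul (hF : ContDiff ℝ ∞ F) (hχ : ContDiff ℝ ∞ χ) :
    deriv (deriv fun r => F r * χ r) = fun r => deriv (deriv F) r * χ r
      + 2 * (deriv F r * deriv χ r) + F r * deriv (deriv χ) r := by
  have hF' := contDiff_deriv hF
  have hχ' := contDiff_deriv hχ
  rw [deriv_mul hF hχ]
  ext r
  rw [deriv_fun_add ((differentiable_of_smooth hF' r).fun_mul (differentiable_of_smooth hχ r))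
    ((differentiable_of_smooth hF r).fun_mul (differentiable_of_smooth hχ' r)),
    deriv_fun_mul (differentiable_of_smooth hF' r) (differentiable_of_smooth hχ r),
    deriv_fun_mul (differentiable_of_smooth hF r) (differentiable_of_smooth hχ' r)]
  ring

lemma mul (h : Rapid F) (hχ : ContDiff ℝ ∞ χ) (h0 : deriv χ 0 = 0) {M : ℝ}
    (hM : ∀ r, |χ r| ≤ M ∧ |deriv χ r| ≤ M ∧ |deriv (deriv χ) r| ≤ M) :
    Rapid fun r => F r * χ r := by
  refine ⟨h.smooth.mul hχ, by rw [deriv_mul h.smooth hχ]; simp [h.deriv_zero, h0], ?_⟩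
  obtain ⟨C, c, hc, hb⟩ := h.bound
  have hC : 0 ≤ C := by simpa using (abs_nonneg _).trans (hb 0 le_rfl).1
  have hM0 : 0 ≤ M := (abs_nonneg _).trans (hM 0).1
  refine ⟨4 * (C * M), c, hc, fun r hr => ?_⟩
  obtain ⟨a1, a2, a3⟩ := hb r hr
  obtain ⟨b1, b2, b3⟩ := hM r
  have key : ∀ {x y : ℝ}, |x| ≤ C * Real.exp (-c * r) → |y| ≤ M →
      |x * y| ≤ C * M * Real.exp (-c * r) := by
    intro x y hx hy
    rw [abs_mul]
    calc |x| * |y| ≤ C * Real.exp (-c * r) * M :=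
          mul_le_mul hx hy (abs_nonneg _) (by positivity)
      _ = _ := by ring
  have hpos : 0 ≤ C * M * Real.exp (-c * r) := by positivity
  have ab1 := abs_le.1 (key a1 b1)
  have ab2 := abs_le.1 (key a2 b1)
  have ab3 := abs_le.1 (key a1 b2)
  have ab4 := abs_le.1 (key a3 b1)
  have ab5 := abs_le.1 (key a2 b2)
  have ab6 := abs_le.1 (key a1 b3)
  rw [deriv_deriv_mul h.smooth hχ, deriv_mul h.smooth hχ]
  refine ⟨?_, ?_, ?_⟩ <;> rw [abs_le] <;> constructor <;> linarith

lemma norm_mode (n : ℕ) (G : ℝ → ℝ) (z : ℂ) : ‖mode n G z‖ = ‖z‖ ^ n * |G (‖z‖ ^ 2)| := by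
  rw [mode, radial, norm_mul, norm_pow, norm_real, Real.norm_eq_abs]

lemma memLp_mode (h : Rapid F) (n : ℕ) : MemLp (mode n F) 2 area := by
  obtain ⟨C, c, hc, hb⟩ := h.bound
  refine memLp_of_pow_exp (contDiff_mode h.smooth).continuous.aestronglyMeasurable n hc (C := C)
    fun z => ?_
  rw [norm_mode]
  nlinarith [(hb (‖z‖ ^ 2) (by positivity)).1, pow_nonneg (norm_nonneg z) n]

lemma memLp_mode_deriv (h : Rapid F) (n : ℕ) : MemLp (mode n (deriv F)) 2 area := by
  obtain ⟨C, c, hc, hb⟩ := h.bound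
  refine memLp_of_pow_exp (contDiff_mode (contDiff_deriv h.smooth)).continuous.aestronglyMeasurable
    n hc (C := C) fun z => ?_
  rw [norm_mode]
  nlinarith [(hb (‖z‖ ^ 2) (by positivity)).2.1, pow_nonneg (norm_nonneg z) n]

lemma exists_bound_deriv (h : Rapid F) :
    ∃ C, ∀ r, 0 ≤ r → |F r| ≤ C ∧ |deriv F r| ≤ C ∧ |deriv (deriv F) r| ≤ C := by
  obtain ⟨C, c, hc, hb⟩ := h.bound
  have hC : 0 ≤ C := by simpa using (abs_nonneg _).trans (hb 0 le_rfl).1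
  refine ⟨C, fun r hr => ?_⟩
  have : C * Real.exp (-c * r) ≤ C :=
    mul_le_of_le_one_right hC (Real.exp_le_one_iff.2 (by nlinarith))
  obtain ⟨a1, a2, a3⟩ := hb r hr
  exact ⟨a1.trans this, a2.trans this, a3.trans this⟩

lemma abs_sub_le {G : ℝ → ℝ} (hG : ContDiff ℝ ∞ G) {C : ℝ} (h : ∀ r, 0 ≤ r → |deriv G r| ≤ C)
    {r : ℝ} (hr : 0 ≤ r) : |G r - G 0| ≤ C * r := by
  have := (convex_Icc (0 : ℝ) r).norm_image_sub_le_of_norm_deriv_le (f := G) (C := C)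
    (fun x _ => differentiable_of_smooth hG x) (fun x hx => h x hx.1) (Set.left_mem_Icc.2 hr)
    (Set.right_mem_Icc.2 hr)
  simpa [abs_of_nonneg hr] using this

lemma memLp_lap_mode (h : Rapid F) (n : ℕ) : MemLp (lap (mode n F)) 2 area := by
  obtain ⟨C, c, hc, hb⟩ := h.bound
  obtain ⟨C', hC'⟩ := h.exists_bound_deriv
  have hC : 0 ≤ C := by simpa using (abs_nonneg _).trans (hb 0 le_rfl).1
  have hC0 : 0 ≤ C' := (abs_nonneg _).trans (hC' 0 le_rfl).1
  have hq : ∀ r, 0 < r → |deriv F r| / r ≤ (C + C') * Real.exp c * Real.exp (-c * r) := by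
    intro r hr
    rw [mul_assoc, ← Real.exp_add, div_le_iff₀ hr]
    rcases le_total r 1 with h1 | h1
    · have := abs_sub_le (contDiff_deriv h.smooth) (fun r hr => (hC' r hr).2.2) hr.le
      rw [h.deriv_zero, sub_zero] at this
      have he : 1 ≤ Real.exp (c + -c * r) := Real.one_le_exp (by nlinarith)
      refine this.trans ?_
      gcongr
      nlinarith
    · refine (hb r hr.le).2.1.trans ?_
      have he : Real.exp (-c * r) ≤ Real.exp (c + -c * r) := Real.exp_le_exp.2 (by linarith)
      have he0 := Real.exp_pos (-c * r)
      have he1 := Real.exp_pos (c + -c * r)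
      calc C * Real.exp (-c * r) ≤ (C + C') * Real.exp (c + -c * r) := by gcongr; linarith
        _ ≤ (C + C') * Real.exp (c + -c * r) * r := le_mul_of_one_le_right (by positivity) h1
  refine memLp_of_pow_exp (smoothOff_mode h.smooth).lap.aestronglyMeasurable n hc
    (C := C + (n + 1) * ((C + C') * Real.exp c)) fun z => ?_
  rcases eq_or_ne z 0 with rfl | hz
  · rw [lap_apply_zero, norm_zero]; positivity
  · have hr : 0 < ‖z‖ ^ 2 := by positivity
    rw [lap_mode h.smooth hz]
    have e : ((deriv (deriv F) (‖z‖ ^ 2) : ℝ) : ℂ)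
        + (n + 1) * (deriv F (‖z‖ ^ 2) : ℝ) / ((‖z‖ ^ 2 : ℝ) : ℂ)
        = ((deriv (deriv F) (‖z‖ ^ 2) + (n + 1) * (deriv F (‖z‖ ^ 2) / ‖z‖ ^ 2) : ℝ) : ℂ) := by
      push_cast; ring
    rw [e, norm_mul, norm_neg, norm_pow, norm_real, Real.norm_eq_abs]
    have h1 := (hb (‖z‖ ^ 2) hr.le).2.2
    have h2 := hq (‖z‖ ^ 2) hr
    have h3 : |deriv (deriv F) (‖z‖ ^ 2) + (n + 1) * (deriv F (‖z‖ ^ 2) / ‖z‖ ^ 2)|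
        ≤ (C + (n + 1) * ((C + C') * Real.exp c)) * Real.exp (-c * ‖z‖ ^ 2) := by
      refine (abs_add_le _ _).trans ?_
      rw [abs_mul, abs_div, abs_of_pos hr, abs_of_nonneg (by positivity : (0 : ℝ) ≤ n + 1)]
      nlinarith
    calc _ ≤ ‖z‖ ^ n * ((C + (n + 1) * ((C + C') * Real.exp c)) * Real.exp (-c * ‖z‖ ^ 2)) := by
          gcongr
      _ = _ := by ring

end Rapid

lemma IsCutoff.rapid {ρ : ℝ → ℝ} (h : IsCutoff ρ) : Rapid ρ := by
  have key : ∀ {G : ℝ → ℝ}, Continuous G → HasCompactSupport G →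
      ∃ C, ∀ r, |G r| ≤ C * Real.exp (-1 * r) := by
    intro G hG hc
    obtain ⟨C, hC⟩ := (hc.mul_right (f' := Real.exp)).exists_bound_of_continuous
      (hG.mul Real.continuous_exp)
    refine ⟨C, fun r => ?_⟩
    have := hC r
    rw [Pi.mul_apply, norm_mul, Real.norm_eq_abs, Real.norm_of_nonneg (Real.exp_pos r).le] at this
    rwa [neg_one_mul, Real.exp_neg, ← div_eq_mul_inv, le_div_iff₀ (Real.exp_pos r)]
  have h1 := contDiff_deriv h.smooth
  obtain ⟨C₀, h₀⟩ := key h.smooth.continuous h.compact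
  obtain ⟨C₁, h₁⟩ := key h1.continuous h.compact.deriv
  obtain ⟨C₂, h₂⟩ := key (contDiff_deriv h1).continuous h.compact.deriv.deriv
  refine ⟨h.smooth, h.deriv_eventually.self_of_nhds, max C₀ (max C₁ C₂), 1, one_pos,
    fun r _ => ⟨(h₀ r).trans ?_, (h₁ r).trans ?_, (h₂ r).trans ?_⟩⟩ <;> gcongr <;> simp

/-! ### Functions annihilating the range of `1 + Δ` -/

/-- `g` is in `L²` and is annihilated by `(1 + Δ) φ` for all test functions `φ` and for the three
functions spanning the singular part of the expansion. -/
structure Annih (ρ : ℝ → ℝ) (g : ℂ → ℂ) : Prop where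
  memLp : MemLp g 2 area
  test : ∀ φ, IsTest φ → ∫ z, g z * (φ z + lap φ z) ∂area = 0
  base : ∀ i, ∫ z, g z * (base ρ i z + lap (base ρ i) z) ∂area = 0

section

variable {ρ F χ : ℝ → ℝ} {g : ℂ → ℂ} {n : ℕ}

lemma Annih.star (hρ : IsCutoff ρ) (h : Annih ρ g) : Annih ρ fun z => conj (g z) := by
  have key : ∀ φ, SmoothOff φ → ∫ z, g z * (conj (φ z) + lap (fun y => conj (φ y)) z) ∂area = 0 →
      ∫ z, conj (g z) * (φ z + lap φ z) ∂area = 0 := by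
    intro φ hφ e
    have e2 := congrArg conj e
    rw [← integral_conj, map_zero] at e2
    rw [← e2]
    refine integral_congr_ae (ae_of_all _ fun z => ?_)
    simp [lap_conj hφ]
  have hb : ∀ i j, (fun y => conj (Cone.base ρ i y)) = Cone.base ρ j →
      ∫ z, conj (g z) * (Cone.base ρ i z + lap (Cone.base ρ i) z) ∂area = 0 := by
    intro i j hij
    refine key _ (hρ.isHarm_base i).smoothOff ?_
    rw [hij, ← h.base j]
    exact integral_congr_ae (ae_of_all _ fun z => by
      simp only [show conj (Cone.base ρ i z) = Cone.base ρ j z from congrFun hij z])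
  refine ⟨memLp_conj h.memLp, fun φ hφ => key φ hφ.smoothOff (h.test _ hφ.star), fun i => ?_⟩
  match i with
  | 0 => exact hb 0 0 (by ext z; simp [Cone.base, mode, radial])
  | 1 => exact hb 1 2 (by ext z; simp [Cone.base])
  | 2 => exact hb 2 1 (by ext z; simp [Cone.base])

/-- The commutator term `χ (1 + Δ) (zⁿ F) - (1 + Δ) (zⁿ F χ)` of a radial multiplier `χ(r)`. -/
def cutErr (n : ℕ) (F χ : ℝ → ℝ) (z : ℂ) : ℂ :=
  z ^ n * ((2 * (deriv F (‖z‖ ^ 2) * deriv χ (‖z‖ ^ 2))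
    + F (‖z‖ ^ 2) * deriv (deriv χ) (‖z‖ ^ 2)
    + (n + 1) * (F (‖z‖ ^ 2) * deriv χ (‖z‖ ^ 2) / ‖z‖ ^ 2) : ℝ) : ℂ)

lemma lap_mode_mul (hF : ContDiff ℝ ∞ F) (hχ : ContDiff ℝ ∞ χ) {z : ℂ} (hz : z ≠ 0) :
    mode n (fun r => F r * χ r) z + lap (mode n fun r => F r * χ r) z =
      radial χ z * (mode n F z + lap (mode n F) z) - cutErr n F χ z := by
  rw [lap_mode (hF.mul hχ) hz, lap_mode hF hz, Rapid.deriv_deriv_mul hF hχ, Rapid.deriv_mul hF hχ,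
    cutErr, mode, mode, radial, radial, radial]
  push_cast
  ring

/-- Passage to the limit in a sequence of multipliers. -/
lemma integral_eq_zero_of_cut (hg : MemLp g 2 area) (hF : Rapid F) {χ : ℕ → ℝ → ℝ}
    (hχ : ∀ j, ContDiff ℝ ∞ (χ j)) (h1 : ∀ j r, |χ j r| ≤ 1)
    (hFχ : ∀ j, Rapid fun r => F r * χ j r)
    (hlim : ∀ z ≠ 0, Tendsto (fun j => radial (χ j) z) atTop (𝓝 1))
    (herr : Tendsto (fun j => ∫ z, g z * cutErr n F (χ j) z ∂area) atTop (𝓝 0))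
    (hP : ∀ j, ∫ z, g z * (mode n (fun r => F r * χ j r) z
      + lap (mode n fun r => F r * χ j r) z) ∂area = 0) :
    ∫ z, g z * (mode n F z + lap (mode n F) z) ∂area = 0 := by
  have hm : MemLp (fun z => mode n F z + lap (mode n F) z) 2 area :=
    (hF.memLp_mode n).add (hF.memLp_lap_mode n)
  have t := tendsto_integral_cut hg hm (fun j => (hχ j).continuous) h1 hlim
  have hcut : ∀ j, MemLp (fun z => radial (χ j) z * (mode n F z + lap (mode n F) z)) 2 area := by
    intro j
    refine hm.of_le ((contDiff_radial (hχ j)).continuous.aestronglyMeasurable.mul hm.1)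
      (ae_of_all _ fun z => ?_)
    rw [norm_mul]
    refine mul_le_of_le_one_left (norm_nonneg _) ?_
    rw [radial, norm_real]
    exact h1 j _
  have e : ∀ j, ∫ z, g z * (radial (χ j) z * (mode n F z + lap (mode n F) z)) ∂area
      = ∫ z, g z * cutErr n F (χ j) z ∂area := by
    intro j
    rw [← sub_eq_zero]
    have hmj : MemLp (fun z => mode n (fun r => F r * χ j r) z
        + lap (mode n fun r => F r * χ j r) z) 2 area :=
      ((hFχ j).memLp_mode n).add ((hFχ j).memLp_lap_mode n)
    have hae : (fun z => g z * cutErr n F (χ j) z) =ᵐ[area] fun z =>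
        g z * (radial (χ j) z * (mode n F z + lap (mode n F) z))
          - g z * (mode n (fun r => F r * χ j r) z + lap (mode n fun r => F r * χ j r) z) := by
      filter_upwards [ae_area_ne_zero] with z hz
      rw [lap_mode_mul hF.smooth (hχ j) hz]
      ring
    rw [integral_congr_ae hae, integral_sub (memLp_two_integrable_mul hg (hcut j))
      (memLp_two_integrable_mul hg hmj), hP j]
    ring
  simp only [e] at t
  exact tendsto_nhds_unique t herr

/-- The bounds `A` and `B` include the factor `|z|ⁿ`, and `r'` bounds `1 / r`. -/
lemma norm_cutErr_le {z : ℂ} {A B X Y r' : ℝ} (hA : ‖z‖ ^ n * |F (‖z‖ ^ 2)| ≤ A)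
    (hB : ‖z‖ ^ n * |deriv F (‖z‖ ^ 2)| ≤ B) (hX : |deriv χ (‖z‖ ^ 2)| ≤ X)
    (hY : |deriv (deriv χ) (‖z‖ ^ 2)| ≤ Y) (hr' : (‖z‖ ^ 2)⁻¹ ≤ r') :
    ‖cutErr n F χ z‖ ≤ 2 * (B * X) + A * Y + (n + 1) * (A * X * r') := by
  have hA0 : 0 ≤ A := le_trans (by positivity) hA
  have hB0 : 0 ≤ B := le_trans (by positivity) hB
  have hX0 : 0 ≤ X := (abs_nonneg _).trans hX
  rw [cutErr, norm_mul, norm_pow, norm_real, Real.norm_eq_abs]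
  have h1 : |2 * (deriv F (‖z‖ ^ 2) * deriv χ (‖z‖ ^ 2)) + F (‖z‖ ^ 2) * deriv (deriv χ) (‖z‖ ^ 2)
      + (n + 1) * (F (‖z‖ ^ 2) * deriv χ (‖z‖ ^ 2) / ‖z‖ ^ 2)|
      ≤ 2 * (|deriv F (‖z‖ ^ 2)| * |deriv χ (‖z‖ ^ 2)|)
        + |F (‖z‖ ^ 2)| * |deriv (deriv χ) (‖z‖ ^ 2)|
        + (n + 1) * (|F (‖z‖ ^ 2)| * |deriv χ (‖z‖ ^ 2)| * (‖z‖ ^ 2)⁻¹) := by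
    refine (abs_add_three _ _ _).trans (le_of_eq ?_)
    simp only [abs_mul, abs_div, abs_pow, abs_norm, Nat.abs_ofNat]
    rw [abs_of_nonneg (by positivity : (0 : ℝ) ≤ n + 1), div_eq_mul_inv]
  have k1 := mul_le_mul hB hX (abs_nonneg _) hB0
  have k2 := mul_le_mul hA hY (abs_nonneg _) hA0
  have k3 := mul_le_mul (mul_le_mul hA hX (abs_nonneg _) hA0) hr' (by positivity)
    (mul_nonneg hA0 hX0)
  have k4 := mul_le_mul_of_nonneg_left k3 (by positivity : (0 : ℝ) ≤ n + 1)
  refine (mul_le_mul_of_nonneg_left h1 (by positivity)).trans ?_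
  linarith

/-- The profile of the cutoff that equals `1` for `r ≤ j + 1` and vanishes for `r ≥ 2 (j + 1)`. -/
def outerCut (j : ℕ) (r : ℝ) : ℝ := Real.smoothTransition (-(1 / (j + 1 : ℝ)) * r + 2)

lemma contDiff_outerCut (j : ℕ) : ContDiff ℝ ∞ (outerCut j) :=
  contDiff_smoothTransition.comp (by fun_prop)

lemma deriv_outerCut (j : ℕ) (r : ℝ) : deriv (outerCut j) r =
    -(1 / (j + 1 : ℝ)) * deriv Real.smoothTransition (-(1 / (j + 1 : ℝ)) * r + 2) := by
  unfold outerCut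
  rw [deriv_comp_affine (differentiable_of_smooth contDiff_smoothTransition)]

lemma deriv_deriv_outerCut (j : ℕ) (r : ℝ) : deriv (deriv (outerCut j)) r =
    (-(1 / (j + 1 : ℝ))) ^ 2
      * deriv (deriv Real.smoothTransition) (-(1 / (j + 1 : ℝ)) * r + 2) := by
  unfold outerCut
  rw [deriv_deriv_comp_affine contDiff_smoothTransition]

lemma exists_bound_outerCut : ∃ K, 0 ≤ K ∧ ∀ (j : ℕ) r,
    |deriv (outerCut j) r| ≤ K * (1 / (j + 1)) ∧
    |deriv (deriv (outerCut j)) r| ≤ K * (1 / (j + 1)) ∧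
    (r < 1 → deriv (outerCut j) r = 0 ∧ deriv (deriv (outerCut j)) r = 0) := by
  obtain ⟨K, hK0, hK⟩ := exists_bound_smoothTransition
  refine ⟨K, hK0, fun j r => ?_⟩
  have hj : (0 : ℝ) < j + 1 := by positivity
  have h1 : 1 / (j + 1 : ℝ) ≤ 1 := by rw [div_le_one hj]; linarith [(j.cast_nonneg : (0 : ℝ) ≤ j)]
  have h0 : 0 < 1 / (j + 1 : ℝ) := by positivity
  rw [deriv_outerCut, deriv_deriv_outerCut]
  generalize 1 / (j + 1 : ℝ) = t at *
  refine ⟨?_, ?_, fun hr => ?_⟩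
  · rw [abs_mul, abs_neg, abs_of_pos h0, mul_comm]
    gcongr
    exact (hK _).1
  · rw [abs_mul, abs_of_nonneg (sq_nonneg _), neg_sq, mul_comm]
    have := (hK (-t * r + 2)).2
    calc _ ≤ K * t ^ 2 := by gcongr
      _ ≤ K * t := by gcongr; nlinarith
  · have hx : 1 < -t * r + 2 := by nlinarith
    rw [deriv_smoothTransition_of_one_lt hx, deriv_deriv_smoothTransition_of_one_lt hx]
    simp

lemma abs_outerCut_le (j : ℕ) (r : ℝ) : |outerCut j r| ≤ 1 := by
  rw [outerCut, abs_of_nonneg (Real.smoothTransition.nonneg _)]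
  exact Real.smoothTransition.le_one _

lemma Rapid.mul_outerCut (h : Rapid F) (j : ℕ) : Rapid fun r => F r * outerCut j r := by
  obtain ⟨K, hK0, hK⟩ := exists_bound_outerCut
  refine h.mul (contDiff_outerCut j) ((hK j 0).2.2 one_pos).1 (M := max 1 (K * (1 / (j + 1))))
    fun r => ⟨?_, ?_, ?_⟩
  · exact (abs_outerCut_le j r).trans (le_max_left _ _)
  · exact (hK j r).1.trans (le_max_right _ _)
  · exact (hK j r).2.1.trans (le_max_right _ _)

lemma Rapid.mul_innerCut (h : Rapid F) (j : ℕ) : Rapid fun r => F r * innerCut j r := by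
  obtain ⟨K, hK0, hK⟩ := exists_bound_smoothTransition
  have h0 : deriv (innerCut j) 0 = 0 := by
    have : innerCut j =ᶠ[𝓝 0] fun _ => 0 := by
      have hc : ∀ᶠ r : ℝ in 𝓝 0, (j : ℝ) * r < 1 := by
        have : Continuous fun r : ℝ => (j : ℝ) * r := by fun_prop
        exact this.continuousAt.eventually_lt continuousAt_const (by simp)
      filter_upwards [hc] with r hr using innerCut_zero hr.le
    rw [this.deriv_eq]; simp
  refine h.mul (contDiff_innerCut j) h0 (M := max 1 (max (j * K) ((j : ℝ) ^ 2 * K)))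
    fun r => ⟨?_, ?_, ?_⟩
  · exact (abs_innerCut_le j r).trans (le_max_left _ _)
  · refine le_trans ?_ ((le_max_left _ _).trans (le_max_right _ _))
    rw [deriv_innerCut, abs_mul, Nat.abs_cast]
    gcongr
    exact (hK _).1
  · refine le_trans ?_ ((le_max_right _ _).trans (le_max_right _ _))
    rw [deriv_deriv_innerCut, abs_mul, abs_of_nonneg (by positivity)]
    gcongr
    exact (hK _).2

lemma tendsto_radial_outerCut (z : ℂ) :
    Tendsto (fun j => radial (outerCut j) z) atTop (𝓝 1) := by
  refine tendsto_const_nhds.congr' ?_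
  obtain ⟨N, hN⟩ := exists_nat_gt (‖z‖ ^ 2)
  filter_upwards [eventually_ge_atTop N] with j hj
  have h1 : (N : ℝ) ≤ j := by exact_mod_cast hj
  have h2 : 1 / (j + 1 : ℝ) * ‖z‖ ^ 2 ≤ 1 := by
    rw [one_div_mul_eq_div, div_le_one (by positivity)]
    linarith
  rw [radial, outerCut, Real.smoothTransition.one_of_one_le
    (show 1 ≤ -(1 / (j + 1 : ℝ)) * ‖z‖ ^ 2 + 2 by linarith), ofReal_one]

/-- Removal of the cutoff at infinity. -/
lemma integral_eq_zero_of_outerCut (hg : MemLp g 2 area) (hF : Rapid F)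
    (hP : ∀ j, ∫ z, g z * (mode n (fun r => F r * outerCut j r) z
      + lap (mode n fun r => F r * outerCut j r) z) ∂area = 0) :
    ∫ z, g z * (mode n F z + lap (mode n F) z) ∂area = 0 := by
  refine integral_eq_zero_of_cut hg hF contDiff_outerCut abs_outerCut_le hF.mul_outerCut
    (fun z _ => tendsto_radial_outerCut z) ?_ hP
  obtain ⟨K, hK0, hK⟩ := exists_bound_outerCut
  have hi : Integrable (fun z => ‖g z * mode n F z‖ * (n + 2) + ‖g z * mode n (deriv F) z‖ * 2)
      area :=
    ((memLp_two_integrable_mul hg (hF.memLp_mode n)).norm.mul_const _).add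
      ((memLp_two_integrable_mul hg (hF.memLp_mode_deriv n)).norm.mul_const _)
  have hb : ∀ j : ℕ, ‖∫ z, g z * cutErr n F (outerCut j) z ∂area‖
      ≤ (∫ z, K * (‖g z * mode n F z‖ * (n + 2) + ‖g z * mode n (deriv F) z‖ * 2) ∂area)
        * (1 / (j + 1)) := by
    intro j
    rw [← integral_mul_const]
    refine norm_integral_le_of_norm_le ((hi.const_mul K).mul_const _) (ae_of_all _ fun z => ?_)
    have ht : (0 : ℝ) ≤ 1 / (j + 1) := by positivity
    obtain ⟨k1, k2, k3⟩ := hK j (‖z‖ ^ 2)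
    rcases lt_or_ge (‖z‖ ^ 2) 1 with hr | hr
    · have : cutErr n F (outerCut j) z = 0 := by simp [cutErr, k3 hr]
      rw [this, mul_zero, norm_zero]
      positivity
    · have e := norm_cutErr_le (n := n) (F := F) (χ := outerCut j) le_rfl le_rfl k1 k2
        (inv_le_one_of_one_le₀ hr)
      rw [← Rapid.norm_mode, ← Rapid.norm_mode] at e
      rw [norm_mul, norm_mul, norm_mul]
      calc _ ≤ ‖g z‖ * (2 * (‖mode n (deriv F) z‖ * (K * (1 / (j + 1))))
            + ‖mode n F z‖ * (K * (1 / (j + 1)))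
            + (n + 1) * (‖mode n F z‖ * (K * (1 / (j + 1))) * 1)) := by gcongr
        _ = _ := by ring
  refine squeeze_zero_norm hb ?_
  simpa using (tendsto_one_div_add_atTop_nhds_zero_nat (𝕜 := ℝ)).const_mul
    (∫ z, K * (‖g z * mode n F z‖ * (n + 2) + ‖g z * mode n (deriv F) z‖ * 2) ∂area)

/-- If `zⁿ F(r)` vanishes at the cone point like `|z|²`, then so it does up to a constant globally,
since `F` is bounded. -/
lemma Rapid.exists_bound_mode (hF : Rapid F) (h0 : F 0 = 0 ∨ 2 ≤ n) :
    ∃ C, ∀ z : ℂ, ‖z‖ ^ n * |F (‖z‖ ^ 2)| ≤ C * ‖z‖ ^ 2 ∧ ‖z‖ ^ n * |deriv F (‖z‖ ^ 2)| ≤ C := by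
  obtain ⟨C, c, hc, hb⟩ := hF.bound
  obtain ⟨C', hC'⟩ := hF.exists_bound_deriv
  have hC : 0 ≤ C := by simpa using (abs_nonneg _).trans (hb 0 le_rfl).1
  have hC0 : 0 ≤ C' := (abs_nonneg _).trans (hC' 0 le_rfl).1
  obtain ⟨A, hA0, hA⟩ := exists_pow_mul_exp_le n hc
  have hexp : ∀ z : ℂ, ‖z‖ ^ n * (C * Real.exp (-c * ‖z‖ ^ 2)) ≤ C * A := by
    intro z
    have h1 : Real.exp (-(c / 2) * ‖z‖ ^ 2) ≤ 1 :=
      Real.exp_le_one_iff.2 (by nlinarith [sq_nonneg ‖z‖])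
    calc _ = C * (‖z‖ ^ n * Real.exp (-c * ‖z‖ ^ 2)) := by ring
      _ ≤ C * (A * Real.exp (-(c / 2) * ‖z‖ ^ 2)) := mul_le_mul_of_nonneg_left (hA z) hC
      _ ≤ C * (A * 1) := by gcongr
      _ = _ := by ring
  refine ⟨C' + C * A, fun z => ⟨?_, ?_⟩⟩
  · rcases le_total ‖z‖ 1 with h1 | h1
    · have hz : ‖z‖ ^ n ≤ 1 := pow_le_one₀ (norm_nonneg z) h1
      have hr : 0 ≤ ‖z‖ ^ 2 := by positivity
      have : ‖z‖ ^ n * |F (‖z‖ ^ 2)| ≤ C' * ‖z‖ ^ 2 := by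
        rcases h0 with h0 | h0
        · have := Rapid.abs_sub_le hF.smooth (fun r hr => (hC' r hr).2.1) hr
          rw [h0, sub_zero] at this
          calc _ ≤ 1 * (C' * ‖z‖ ^ 2) := by gcongr
            _ = _ := one_mul _
        · have h2 : ‖z‖ ^ n ≤ ‖z‖ ^ 2 := pow_le_pow_of_le_one (norm_nonneg z) h1 h0
          calc _ ≤ ‖z‖ ^ 2 * C' := by gcongr; exact (hC' _ hr).1
            _ = _ := mul_comm _ _
      nlinarith [mul_nonneg hC hA0]
    · have h2 : 1 ≤ ‖z‖ ^ 2 := one_le_pow₀ h1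
      have h3 := (hb (‖z‖ ^ 2) (by positivity)).1
      calc _ ≤ ‖z‖ ^ n * (C * Real.exp (-c * ‖z‖ ^ 2)) := by gcongr
        _ ≤ C * A := hexp z
        _ ≤ C' + C * A := by linarith
        _ ≤ _ := le_mul_of_one_le_right (by positivity) h2
  · have h3 := (hb (‖z‖ ^ 2) (by positivity)).2.1
    calc _ ≤ ‖z‖ ^ n * (C * Real.exp (-c * ‖z‖ ^ 2)) := by gcongr
      _ ≤ C * A := hexp z
      _ ≤ C' + C * A := by linarith

/-- Removal of the cutoff at the cone point. -/
lemma integral_eq_zero_of_innerCut (hg : MemLp g 2 area) (hF : Rapid F) (h0 : F 0 = 0 ∨ 2 ≤ n)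
    (hP : ∀ j, ∫ z, g z * (mode n (fun r => F r * innerCut j r) z
      + lap (mode n fun r => F r * innerCut j r) z) ∂area = 0) :
    ∫ z, g z * (mode n F z + lap (mode n F) z) ∂area = 0 := by
  refine integral_eq_zero_of_cut hg hF contDiff_innerCut abs_innerCut_le hF.mul_innerCut
    (fun z hz => tendsto_radial_innerCut hz) ?_ hP
  obtain ⟨K, hK0, hK⟩ := exists_bound_smoothTransition
  obtain ⟨C, hC⟩ := hF.exists_bound_mode (n := n) h0
  have hC0 : 0 ≤ C := le_trans (by positivity) (hC 0).2
  have hout : ∀ (j : ℕ) (z : ℂ), z ∉ disc j → cutErr n F (innerCut j) z = 0 := by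
    intro j z hj
    have h2 : 2 < (j : ℝ) * ‖z‖ ^ 2 := not_le.1 hj
    simp [cutErr, deriv_innerCut, deriv_deriv_innerCut,
      deriv_smoothTransition_of_one_lt (show 1 < (j : ℝ) * ‖z‖ ^ 2 + -1 by linarith),
      deriv_deriv_smoothTransition_of_one_lt (show 1 < (j : ℝ) * ‖z‖ ^ 2 + -1 by linarith)]
  refine tendsto_integral_disc hg (C := K * C * (n + 5)) (fun j z => ?_) hout
  by_cases hz : z ∈ disc j
  · rcases eq_or_ne z 0 with rfl | hz0
    · have hK' : |deriv (deriv Real.smoothTransition) (-1)| = 0 := by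
        have : deriv Real.smoothTransition =ᶠ[𝓝 (-1)] fun _ => 0 := by
          filter_upwards [Iio_mem_nhds (show (-1 : ℝ) < 0 by norm_num)] with y hy
          have : Real.smoothTransition =ᶠ[𝓝 y] fun _ => 0 := by
            filter_upwards [Iio_mem_nhds (Set.mem_Iio.1 hy)] with x hx
            exact Real.smoothTransition.zero_of_nonpos (le_of_lt hx)
          rw [this.deriv_eq]; simp
        rw [this.deriv_eq]; simp
      have hK'' : deriv (deriv Real.smoothTransition) (-1) = 0 := abs_eq_zero.1 hK'
      have : cutErr n F (innerCut j) 0 = 0 := by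
        simp [cutErr, hF.deriv_zero, deriv_deriv_innerCut, hK'']
      rw [this, norm_zero]
      positivity
    · have hr : 0 < ‖z‖ ^ 2 := by positivity
      have hd : (j : ℝ) * ‖z‖ ^ 2 ≤ 2 := hz
      have h1 : |deriv (innerCut j) (‖z‖ ^ 2)| ≤ j * K := by
        rw [deriv_innerCut, abs_mul, Nat.abs_cast]; gcongr; exact (hK _).1
      have h2 : |deriv (deriv (innerCut j)) (‖z‖ ^ 2)| ≤ (j : ℝ) ^ 2 * K := by
        rw [deriv_deriv_innerCut, abs_mul, abs_of_nonneg (by positivity)]; gcongr; exact (hK _).2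
      have e := norm_cutErr_le (n := n) (F := F) (χ := innerCut j) (hC z).1 (hC z).2 h1 h2 le_rfl
      refine e.trans ?_
      have e3 : C * ‖z‖ ^ 2 * (j * K) * (‖z‖ ^ 2)⁻¹ = C * K * j := by field_simp
      have e4 : C * ‖z‖ ^ 2 * ((j : ℝ) ^ 2 * K) ≤ 2 * (C * K * j) := by
        calc _ = C * K * j * (j * ‖z‖ ^ 2) := by ring
          _ ≤ C * K * j * 2 := by gcongr
          _ = _ := by ring
      rw [e3]
      nlinarith
  · rw [hout j z hz, norm_zero]
    positivity

lemma isTest_mode_cut (hF : ContDiff ℝ ∞ F) (i j : ℕ) :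
    IsTest (mode n fun r => F r * innerCut i r * outerCut j r) := by
  have hs := (hF.mul (contDiff_innerCut i)).mul (contDiff_outerCut j)
  refine .of_smoothOff (smoothOff_mode hs) ?_ ?_
  · refine HasCompactSupport.intro (isCompact_closedBall (0 : ℂ) (√(2 * (j + 1)))) fun z hz => ?_
    rw [mem_closedBall_zero_iff, not_le] at hz
    have h2 : 2 * (j + 1 : ℝ) < ‖z‖ ^ 2 := Real.lt_sq_of_sqrt_lt hz
    have h3 : 2 ≤ 1 / (j + 1 : ℝ) * ‖z‖ ^ 2 := by
      rw [one_div_mul_eq_div, le_div_iff₀ (by positivity)]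
      exact h2.le
    have h4 : outerCut j (‖z‖ ^ 2) = 0 :=
      Real.smoothTransition.zero_of_nonpos (by linarith)
    simp [mode, radial, h4]
  · filter_upwards [radial_innerCut_eventually_zero i] with z hz
    have : innerCut i (‖z‖ ^ 2) = 0 := by simpa [radial] using hz
    simp [mode, radial, this]

lemma Annih.rapid (h : Annih ρ g) (hF : Rapid F) (h0 : F 0 = 0 ∨ 2 ≤ n) :
    ∫ z, g z * (mode n F z + lap (mode n F) z) ∂area = 0 :=
  integral_eq_zero_of_innerCut h.memLp hF h0 fun i =>
    integral_eq_zero_of_outerCut h.memLp (hF.mul_innerCut i) fun j =>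
      h.test _ (isTest_mode_cut hF.smooth i j)

/-- For `n = 0, 1` the function `zⁿ F(r)` does not vanish like `|z|²` at the cone point, but its
difference with `zⁿ ρ` does, and the latter is among the functions tested against. -/
lemma Annih.mode (hρ : IsCutoff ρ) (h : Annih ρ g) (hF : Rapid F) (h0 : F 0 = 1) (n : ℕ) :
    ∫ z, g z * (Cone.mode n F z + lap (Cone.mode n F) z) ∂area = 0 := by
  rcases Nat.lt_or_ge n 2 with hn | hn
  · have e := h.rapid (n := n) (hF.sub hρ.rapid) (Or.inl (by simp [h0, hρ.apply_zero]))
    have hb : ∫ z, g z * (Cone.mode n ρ z + lap (Cone.mode n ρ) z) ∂area = 0 := by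
      interval_cases n
      · exact h.base 0
      · exact h.base 1
    rw [← sub_zero (∫ z, _ ∂area)]
    conv_lhs => rw [← hb]
    have i1 : Integrable (fun z => g z * (Cone.mode n F z + lap (Cone.mode n F) z)) area :=
      memLp_two_integrable_mul h.memLp ((hF.memLp_mode n).add (hF.memLp_lap_mode n))
    have i2 : Integrable (fun z => g z * (Cone.mode n ρ z + lap (Cone.mode n ρ) z)) area :=
      memLp_two_integrable_mul h.memLp ((hρ.rapid.memLp_mode n).add (hρ.rapid.memLp_lap_mode n))
    rw [← integral_sub i1 i2, ← e]
    refine integral_congr_ae ?_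
    filter_upwards [ae_area_ne_zero] with z hz
    have d1 : deriv (fun r => F r - ρ r) = fun r => deriv F r - deriv ρ r := funext fun r =>
      deriv_fun_sub (differentiable_of_smooth hF.smooth r) (differentiable_of_smooth hρ.smooth r)
    have d2 : deriv (deriv fun r => F r - ρ r) =
        fun r => deriv (deriv F) r - deriv (deriv ρ) r := by
      rw [d1]
      exact funext fun r => deriv_fun_sub (differentiable_of_smooth (contDiff_deriv hF.smooth) r)
        (differentiable_of_smooth (contDiff_deriv hρ.smooth) r)
    rw [lap_mode hF.smooth hz, lap_mode hρ.smooth hz, lap_mode (hF.smooth.sub hρ.smooth) hz, d2, d1,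
      Cone.mode, Cone.mode, Cone.mode, radial, radial, radial]
    push_cast
    ring
  · exact h.rapid hF (Or.inr hn)

end

/-! ### The Laplace transform of the angular modes -/

/-- The profile `F(r) = (1 + a r) exp (-a r)`. The linear factor is the one for which `F'(0) = 0`,
so that `F'(r) / r` is again a polynomial times `exp (-a r)`. -/
def profile (a r : ℝ) : ℝ := (1 + a * r) * Real.exp (-a * r)

lemma hasDerivAt_exp_neg_mul (a r : ℝ) :
    HasDerivAt (fun r : ℝ => Real.exp (-a * r)) (-a * Real.exp (-a * r)) r := by
  simpa [mul_comm] using ((hasDerivAt_id r).const_mul (-a)).exp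

lemma contDiff_profile (a : ℝ) : ContDiff ℝ ∞ (profile a) := by
  unfold profile; fun_prop

lemma deriv_profile (a : ℝ) : deriv (profile a) = fun r => -a ^ 2 * r * Real.exp (-a * r) := by
  ext r
  have h1 : HasDerivAt (fun r : ℝ => 1 + a * r) a r := by
    simpa using ((hasDerivAt_id r).const_mul a).const_add 1
  unfold profile
  rw [(h1.fun_mul (hasDerivAt_exp_neg_mul a r)).deriv]
  ring

lemma deriv_deriv_profile (a : ℝ) :
    deriv (deriv (profile a)) = fun r => (-a ^ 2 + a ^ 3 * r) * Real.exp (-a * r) := by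
  rw [deriv_profile]
  ext r
  have h1 : HasDerivAt (fun r : ℝ => -a ^ 2 * r) (-a ^ 2) r := by
    simpa using (hasDerivAt_id r).const_mul (-a ^ 2)
  rw [(h1.fun_mul (hasDerivAt_exp_neg_mul a r)).deriv]
  ring

lemma rapid_profile {a : ℝ} (ha : 0 < a) : Rapid (profile a) := by
  refine ⟨contDiff_profile a, by rw [deriv_profile]; simp, 3 + 2 * a + 3 * a ^ 2, a / 2,
    half_pos ha, fun r hr => ?_⟩
  have e1 : Real.exp (-a * r) = Real.exp (-(a / 2) * r) * Real.exp (-(a / 2) * r) := by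
    rw [← Real.exp_add]; congr 1; ring
  have e2 : Real.exp (-(a / 2) * r) ≤ 1 := Real.exp_le_one_iff.2 (by nlinarith)
  have e3 : a * r * Real.exp (-(a / 2) * r) ≤ 2 := by
    have h := Real.add_one_le_exp (a / 2 * r)
    rw [neg_mul, Real.exp_neg, ← div_eq_mul_inv, div_le_iff₀ (Real.exp_pos _)]
    linarith
  have hE := Real.exp_pos (-(a / 2) * r)
  rw [deriv_deriv_profile, deriv_profile]
  simp only [profile]
  rw [e1]
  generalize Real.exp (-(a / 2) * r) = E at *
  have k0 : 0 ≤ a * r * E := by positivity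
  have k1 : a * r * E * E ≤ 2 * E := by gcongr
  have k2 : E * E ≤ E := mul_le_of_le_one_left hE.le e2
  have k3 : 0 ≤ E * E := by positivity
  have k4 : 0 ≤ a * r * E * E := by positivity
  have m1 := mul_le_mul_of_nonneg_left k1 ha.le
  have m2 := mul_le_mul_of_nonneg_left k1 (sq_nonneg a)
  have m3 := mul_le_mul_of_nonneg_left k2 (sq_nonneg a)
  have m4 := mul_nonneg ha.le k4
  have m5 := mul_nonneg (sq_nonneg a) k4
  have m6 := mul_nonneg (sq_nonneg a) k3
  have p1 : 0 ≤ a * E := by positivity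
  have p2 : 0 ≤ a ^ 2 * E := by positivity
  refine ⟨?_, ?_, ?_⟩ <;> rw [abs_le] <;> constructor <;> nlinarith

/-- The derivatives, up to sign, of the Laplace transform `∫ g zⁿ exp (-a r) dS` of an angular
mode. -/
def expMoment (g : ℂ → ℂ) (n k : ℕ) (a : ℝ) : ℂ :=
  ∫ z, g z * (z ^ n * ((((‖z‖ ^ 2) ^ k * Real.exp (-a * ‖z‖ ^ 2) : ℝ)) : ℂ)) ∂area

section

variable {g : ℂ → ℂ} {n k : ℕ} {ρ : ℝ → ℝ}

lemma memLp_pow_exp (n k : ℕ) {a : ℝ} (ha : 0 < a) : MemLp (fun z : ℂ =>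
    z ^ n * ((((‖z‖ ^ 2) ^ k * Real.exp (-a * ‖z‖ ^ 2) : ℝ)) : ℂ)) 2 area := by
  refine memLp_of_pow_exp (Continuous.aestronglyMeasurable (by fun_prop)) (n + 2 * k) ha (C := 1)
    fun z => le_of_eq ?_
  rw [norm_mul, norm_pow, norm_real, Real.norm_of_nonneg (by positivity)]
  ring

lemma hasDerivAt_expMoment (hg : MemLp g 2 area) (n k : ℕ) {a : ℝ} (ha : 0 < a) :
    HasDerivAt (expMoment g n k) (-expMoment g n (k + 1) a) a := by
  have hint : ∀ (k : ℕ) {b : ℝ}, 0 < b → Integrable (fun z => g z *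
      (z ^ n * ((((‖z‖ ^ 2) ^ k * Real.exp (-b * ‖z‖ ^ 2) : ℝ)) : ℂ))) area := fun k b hb =>
    memLp_two_integrable_mul hg (memLp_pow_exp n k hb)
  have h := (hasDerivAt_integral_of_dominated_loc_of_deriv_le (μ := area)
    (F := fun (b : ℝ) z => g z *
      (z ^ n * ((((‖z‖ ^ 2) ^ k * Real.exp (-b * ‖z‖ ^ 2) : ℝ)) : ℂ)))
    (F' := fun (b : ℝ) z => -(g z *
      (z ^ n * ((((‖z‖ ^ 2) ^ (k + 1) * Real.exp (-b * ‖z‖ ^ 2) : ℝ)) : ℂ))))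
    (bound := fun z => ‖g z *
      (z ^ n * ((((‖z‖ ^ 2) ^ (k + 1) * Real.exp (-(a / 2) * ‖z‖ ^ 2) : ℝ)) : ℂ))‖)
    (s := Set.Ioi (a / 2)) (x₀ := a) (Ioi_mem_nhds (half_lt_self ha)) ?_ (hint k ha)
    (hint (k + 1) ha).neg.1 ?_ (hint (k + 1) (half_pos ha)).norm ?_).2
  · rw [integral_neg] at h
    exact h
  · filter_upwards [Ioi_mem_nhds ha] with b hb using (hint k hb).1
  · refine ae_of_all _ fun z b hb => ?_
    have hb' : a / 2 < b := hb
    rw [norm_neg]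
    simp only [norm_mul, norm_real, Real.norm_eq_abs, Real.abs_exp]
    gcongr
  · refine ae_of_all _ fun z b _ => ?_
    have h1 : HasDerivAt (fun b : ℝ => Real.exp (-b * ‖z‖ ^ 2))
        (-‖z‖ ^ 2 * Real.exp (-b * ‖z‖ ^ 2)) b := by
      have := ((hasDerivAt_id b).neg.mul_const (‖z‖ ^ 2)).exp
      simpa [mul_comm] using this
    have h2 := ((h1.const_mul ((‖z‖ ^ 2) ^ k)).ofReal_comp.const_mul (z ^ n)).const_mul (g z)
    refine h2.congr_deriv ?_
    push_cast
    ring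

/-- The relation `g ⊥ (1 + Δ) (zⁿ (1 + a r) exp (-a r))` is a first-order differential equation
for the Laplace transform. -/
lemma Annih.expMoment_ode (hρ : IsCutoff ρ) (h : Annih ρ g) (n : ℕ) {a : ℝ} (ha : 0 < a) :
    (1 + (n + 2) * (a : ℂ) ^ 2) * expMoment g n 0 a
      + ((a : ℂ) - (a : ℂ) ^ 3) * expMoment g n 1 a = 0 := by
  have e := h.mode hρ (rapid_profile ha) (by simp [profile]) n
  rw [expMoment, expMoment, ← integral_const_mul, ← integral_const_mul, ← integral_add
    ((memLp_two_integrable_mul h.memLp (memLp_pow_exp n 0 ha)).const_mul _)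
    ((memLp_two_integrable_mul h.memLp (memLp_pow_exp n 1 ha)).const_mul _), ← e]
  refine integral_congr_ae ?_
  filter_upwards [ae_area_ne_zero] with z hz
  have hr : (‖z‖ : ℂ) ≠ 0 := by simpa using hz
  rw [lap_mode (contDiff_profile a) hz, deriv_deriv_profile, deriv_profile, Cone.mode, radial,
    profile]
  push_cast
  field_simp
  ring

/-- At `a = 1` the differential equation has a regular singular point at which all nonzero solutions
blow up, whereas the Laplace transform is smooth there. -/
lemma Annih.expMoment_zero (hρ : IsCutoff ρ) (h : Annih ρ g) (n : ℕ) {a : ℝ} (ha : 0 < a) :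
    expMoment g n 0 a = 0 := by
  set G := expMoment g n 0
  have hG : ∀ b : ℝ, 0 < b → HasDerivAt G (-expMoment g n 1 b) b := fun b hb =>
    hasDerivAt_expMoment h.memLp n 0 hb
  have hode : ∀ b : ℝ, 0 < b → (1 + (n + 2) * (b : ℂ) ^ 2) * G b
      + ((b : ℂ) - (b : ℂ) ^ 3) * expMoment g n 1 b = 0 := fun b hb => h.expMoment_ode hρ n hb
  rcases eq_or_ne a 1 with rfl | ha1
  · have e := hode 1 one_pos
    have hne : (n : ℂ) + 3 ≠ 0 := by exact_mod_cast (by omega : n + 3 ≠ 0)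
    refine (mul_eq_zero.1 (?_ : ((n : ℂ) + 3) * G 1 = 0)).resolve_left hne
    push_cast at e
    linear_combination e
  · -- The solutions are the multiples of `b (1 - b²) ^ (-(n + 3) / 2)`; squaring avoids the
    -- half-integral power. The resulting constant of motion is zero at `b = 1`.
    let Φ : ℝ → ℂ := fun b => G b ^ 2 * (1 - (b : ℂ) ^ 2) ^ (n + 3) * ((b : ℂ) ^ 2)⁻¹
    have hΦ : ∀ b : ℝ, 0 < b → HasDerivAt Φ 0 b := by
      intro b hb
      have hbc : (b : ℂ) ≠ 0 := by exact_mod_cast hb.ne'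
      have hid : HasDerivAt (fun b : ℝ => (b : ℂ)) 1 b := (hasDerivAt_id b).ofReal_comp
      have h1 : HasDerivAt (fun b : ℝ => (1 : ℂ) - (b : ℂ) ^ 2) (-(2 * (b : ℂ))) b := by
        simpa using (hid.fun_pow 2).const_sub 1
      have h2 : HasDerivAt (fun b : ℝ => ((b : ℂ) ^ 2)⁻¹) (-(2 * b) / ((b : ℂ) ^ 2) ^ 2) b := by
        simpa using (hid.fun_pow 2).fun_inv (pow_ne_zero 2 hbc)
      have h3 := (((hG b hb).fun_pow 2).fun_mul (h1.fun_pow (n + 3))).fun_mul h2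
      refine h3.congr_deriv ?_
      have e := hode b hb
      simp only [Nat.add_succ_sub_one, pow_succ (1 - (b : ℂ) ^ 2) (n + 2)]
      generalize (1 - (b : ℂ) ^ 2) ^ (n + 2) = P
      push_cast
      field_simp
      linear_combination (-2 * P * G b) * e
    have hconst := isOpen_Ioi.is_const_of_deriv_eq_zero (f := Φ) (s := Set.Ioi (0 : ℝ))
      isPreconnected_Ioi (fun b hb => (hΦ b hb).differentiableAt.differentiableWithinAt)
      (fun b hb => (hΦ b hb).deriv) (x := a) (y := 1) ha
      (Set.mem_Ioi.2 one_pos)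
    have h1 : Φ 1 = 0 := by simp [Φ]
    rw [h1] at hconst
    have hac : (a : ℂ) ≠ 0 := by exact_mod_cast ha.ne'
    have hne : 1 - (a : ℂ) ^ 2 ≠ 0 := by
      have : 1 - a ^ 2 ≠ 0 := by
        intro h0
        have : (a - 1) * (a + 1) = 0 := by linarith
        rcases mul_eq_zero.1 this with h2 | h2
        · exact ha1 (by linarith)
        · linarith
      exact_mod_cast this
    have h4 := (mul_eq_zero.1 hconst).resolve_right (inv_ne_zero (pow_ne_zero 2 hac))
    have h5 := (mul_eq_zero.1 h4).resolve_right (pow_ne_zero _ hne)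
    exact pow_eq_zero_iff two_ne_zero |>.1 h5

lemma Annih.expMoment_eq_zero (hρ : IsCutoff ρ) (h : Annih ρ g) (n k : ℕ) :
    ∀ {a : ℝ}, 0 < a → expMoment g n k a = 0 := by
  induction k with
  | zero => exact fun ha => h.expMoment_zero hρ n ha
  | succ k ih =>
    intro a ha
    have h1 : expMoment g n k =ᶠ[𝓝 a] fun _ => 0 := by
      filter_upwards [Ioi_mem_nhds ha] with b hb using ih hb
    have h2 := (hasDerivAt_expMoment h.memLp n k ha).congr_of_eventuallyEq h1.symm
    have h3 := h2.unique (hasDerivAt_const a (0 : ℂ))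
    exact neg_eq_zero.1 h3

/-! ### Completeness -/

/-- The Gaussian weight `exp (-r)`. -/
def gauss (z : ℂ) : ℂ := (Real.exp (-1 * ‖z‖ ^ 2) : ℂ)

lemma Annih.moment_eq_zero_of_le (hρ : IsCutoff ρ) (h : Annih ρ g) {p q : ℕ} (hqp : q ≤ p) :
    ∫ z, g z * (gauss z * (z ^ p * conj z ^ q)) ∂area = 0 := by
  rw [← h.expMoment_eq_zero hρ (p - q) q one_pos, expMoment]
  refine integral_congr_ae (ae_of_all _ fun z => ?_)
  have e : z ^ p * conj z ^ q = z ^ (p - q) * ((‖z‖ ^ 2 : ℝ) : ℂ) ^ q := by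
    rw [← conj_mul_self, mul_pow, ← Nat.sub_add_cancel hqp, pow_add, Nat.add_sub_cancel]
    ring
  simp only [e, gauss]
  push_cast
  ring

lemma Annih.moment_eq_zero (hρ : IsCutoff ρ) (h : Annih ρ g) (p q : ℕ) :
    ∫ z, g z * (gauss z * (z ^ p * conj z ^ q)) ∂area = 0 := by
  rcases le_total q p with hqp | hqp
  · exact h.moment_eq_zero_of_le hρ hqp
  · have e := congrArg conj ((h.star hρ).moment_eq_zero_of_le hρ hqp)
    rw [← integral_conj, map_zero] at e
    rw [← e]
    refine integral_congr_ae (ae_of_all _ fun z => ?_)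
    simp only [map_mul, map_pow, conj_conj, gauss, conj_ofReal]
    ring

lemma memLp_gauss_exp (A : ℝ) :
    MemLp (fun z => ((Real.exp (-1 * ‖z‖ ^ 2) * Real.exp (A * ‖z‖) : ℝ) : ℂ)) 2 area := by
  refine memLp_of_pow_exp (Continuous.aestronglyMeasurable (by fun_prop)) 0
    (c := 1 / 2) (by norm_num) (C := Real.exp (A ^ 2 / 2)) fun z => ?_
  rw [norm_real, Real.norm_of_nonneg (by positivity), pow_zero, one_mul, ← Real.exp_add,
    ← Real.exp_add]
  exact Real.exp_le_exp.2 (by nlinarith [sq_nonneg (A - ‖z‖)])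

/-- The exponential generating function of the moments. -/
lemma Annih.integral_exp_eq_zero (hρ : IsCutoff ρ) (h : Annih ρ g) (α β : ℂ) :
    ∫ z, g z * (gauss z * exp (α * z + β * conj z)) ∂area = 0 := by
  have hcont : Continuous gauss := by unfold gauss; fun_prop
  have hmom : ∀ p q, Integrable (fun z => g z * (gauss z * (z ^ p * conj z ^ q))) area := by
    intro p q
    refine memLp_two_integrable_mul h.memLp (memLp_of_pow_exp
      (Continuous.aestronglyMeasurable (by fun_prop)) (p + q) one_pos (C := 1) fun z => le_of_eq ?_)
    simp only [norm_mul, norm_pow, RCLike.norm_conj, gauss, norm_real, Real.norm_eq_abs,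
      Real.abs_exp]
    ring
  have hpow : ∀ m : ℕ, Integrable (fun z => g z * (gauss z * (α * z + β * conj z) ^ m)) area ∧
      ∫ z, g z * (gauss z * (α * z + β * conj z) ^ m) ∂area = 0 := by
    intro m
    have e : (fun z => g z * (gauss z * (α * z + β * conj z) ^ m)) = fun z =>
        ∑ i ∈ Finset.range (m + 1), α ^ i * β ^ (m - i) * (m.choose i)
          * (g z * (gauss z * (z ^ i * conj z ^ (m - i)))) := by
      ext z
      rw [add_pow, Finset.mul_sum, Finset.mul_sum]
      refine Finset.sum_congr rfl fun i _ => ?_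
      rw [mul_pow, mul_pow]
      ring
    rw [e]
    refine ⟨integrable_finsetSum _ fun i _ => (hmom _ _).const_mul _, ?_⟩
    rw [integral_finsetSum _ fun i _ => (hmom _ _).const_mul _]
    exact Finset.sum_eq_zero fun i _ => by
      rw [integral_const_mul, h.moment_eq_zero hρ, mul_zero]
  have hlim : Tendsto (fun N : ℕ => ∫ z, g z * (gauss z * ∑ m ∈ Finset.range N,
      (α * z + β * conj z) ^ m / (m.factorial : ℂ)) ∂area) atTop
      (𝓝 (∫ z, g z * (gauss z * exp (α * z + β * conj z)) ∂area)) := by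
    refine tendsto_integral_of_dominated_convergence (fun z => ‖g z *
      ((Real.exp (-1 * ‖z‖ ^ 2) * Real.exp ((‖α‖ + ‖β‖) * ‖z‖) : ℝ) : ℂ)‖) (fun N => ?_)
      (memLp_two_integrable_mul h.memLp (memLp_gauss_exp _)).norm
      (fun N => ae_of_all _ fun z => ?_) (ae_of_all _ fun z => ?_)
    · refine h.memLp.1.mul (Continuous.aestronglyMeasurable ?_)
      fun_prop
    · rw [norm_mul, norm_mul, norm_mul, norm_real, gauss, norm_real,
        Real.norm_of_nonneg (Real.exp_pos _).le, Real.norm_of_nonneg (by positivity)]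
      gcongr
      have hw : ‖α * z + β * conj z‖ ≤ (‖α‖ + ‖β‖) * ‖z‖ := by
        refine (norm_add_le _ _).trans (le_of_eq ?_)
        rw [norm_mul, norm_mul, RCLike.norm_conj]
        ring
      calc ‖∑ m ∈ Finset.range N, (α * z + β * conj z) ^ m / (m.factorial : ℂ)‖
          ≤ ∑ m ∈ Finset.range N, ‖α * z + β * conj z‖ ^ m / (m.factorial : ℝ) := by
            refine (norm_sum_le _ _).trans (le_of_eq (Finset.sum_congr rfl fun m _ => ?_))
            rw [norm_div, norm_pow, norm_natCast]
        _ ≤ Real.exp ‖α * z + β * conj z‖ := Real.sum_le_exp_of_nonneg (norm_nonneg _) N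
        _ ≤ _ := Real.exp_le_exp.2 hw
    · refine ((HasSum.tendsto_sum_nat ?_).const_mul _).const_mul _
      rw [Complex.exp_eq_exp_ℂ]
      exact NormedSpace.expSeries_div_hasSum_exp _
  have hz : ∀ N : ℕ, ∫ z, g z * (gauss z * ∑ m ∈ Finset.range N,
      (α * z + β * conj z) ^ m / (m.factorial : ℂ)) ∂area = 0 := by
    intro N
    have e : (fun z => g z * (gauss z * ∑ m ∈ Finset.range N,
        (α * z + β * conj z) ^ m / (m.factorial : ℂ))) = fun z => ∑ m ∈ Finset.range N,
        (m.factorial : ℂ)⁻¹ * (g z * (gauss z * (α * z + β * conj z) ^ m)) := by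
      ext z
      rw [Finset.mul_sum, Finset.mul_sum]
      exact Finset.sum_congr rfl fun m _ => by ring
    rw [e, integral_finsetSum _ fun m _ => (hpow m).1.const_mul _]
    exact Finset.sum_eq_zero fun m _ => by rw [integral_const_mul, (hpow m).2, mul_zero]
  simp only [hz] at hlim
  exact (tendsto_nhds_unique tendsto_const_nhds hlim).symm

open FourierTransform in
/-- An integrable function whose Fourier transform vanishes is zero almost everywhere, by duality
with Schwartz functions. -/
lemma ae_eq_zero_of_fourier {f : ℂ → ℂ} (hf : Integrable f) (h : ∀ ξ, 𝓕 f ξ = 0) :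
    f =ᵐ[volume] 0 := by
  refine ae_eq_zero_of_integral_contDiff_smul_eq_zero hf.locallyIntegrable fun ψ hψ hc => ?_
  have hc' : HasCompactSupport (ofRealCLM ∘ ψ) := hc.comp_left rfl
  have hψ' : ContDiff ℝ ∞ (ofRealCLM ∘ ψ) := ofRealCLM.contDiff.comp hψ
  let Ψ : SchwartzMap ℂ ℂ := hc'.toSchwartzMap hψ'
  let Θ : SchwartzMap ℂ ℂ := 𝓕⁻ Ψ
  have e := VectorFourier.integral_fourierIntegral_smul_eq_flip (L := innerₗ ℂ)
    (μ := (volume : Measure ℂ)) (ν := (volume : Measure ℂ)) Real.continuous_fourierChar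
    continuous_inner hf Θ.integrable
  have e1 : ∀ x, VectorFourier.fourierIntegral Real.fourierChar volume (innerₗ ℂ).flip Θ x
      = Ψ x := by
    intro x
    have : 𝓕 Θ = Ψ := FourierTransform.fourier_fourierInv_eq Ψ
    conv_rhs => rw [← this]
    rw [SchwartzMap.fourier_coe, flip_innerₗ]
    rfl
  have e2 : ∀ ξ, VectorFourier.fourierIntegral Real.fourierChar volume (innerₗ ℂ) f ξ = 0 := h
  simp only [e1, e2, zero_smul, integral_zero] at e
  rw [e]
  refine integral_congr_ae (ae_of_all _ fun x => ?_)
  simp only [real_smul, smul_eq_mul]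
  rw [mul_comm]
  rfl

open FourierTransform in
/-- The function `g exp (-r)`, multiplied by the density `4 |z|²`, is integrable and has vanishing
Fourier transform. -/
theorem Annih.ae_eq_zero (hρ : IsCutoff ρ) (h : Annih ρ g) : g =ᵐ[area] 0 := by
  have hm : MemLp gauss 2 area := by
    refine memLp_of_pow_exp (Continuous.aestronglyMeasurable (by unfold gauss; fun_prop)) 0
      one_pos (C := 1) fun z => le_of_eq ?_
    rw [gauss, norm_real, Real.norm_of_nonneg (Real.exp_pos _).le]
    ring
  have hf : Integrable fun z => ((4 * ‖z‖ ^ 2 : ℝ) : ℂ) * (g z * gauss z) := by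
    have := integrable_area_iff.1 (memLp_two_integrable_mul h.memLp hm)
    simpa only [real_smul] using this
  have h0 := ae_eq_zero_of_fourier hf fun ξ => by
    rw [Real.fourier_eq', ← h.integral_exp_eq_zero hρ (-(Real.pi * I) * conj ξ)
      (-(Real.pi * I) * ξ), integral_area]
    refine integral_congr_ae (ae_of_all _ fun z => ?_)
    have e : ((-2 * Real.pi * inner ℝ z ξ : ℝ) : ℂ) * I
        = -(Real.pi * I) * conj ξ * z + -(Real.pi * I) * ξ * conj z := by
      have e1 : ((inner ℝ z ξ : ℝ) : ℂ) = (conj z * ξ + z * conj ξ) / 2 := by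
        rw [Complex.inner]
        apply Complex.ext <;> simp <;> ring
      push_cast
      rw [e1]
      ring
    simp only [smul_eq_mul, e]
    ring
  refine area_absolutelyContinuous.ae_le ?_
  filter_upwards [h0, ae_ne_zero] with z hz hne
  have h1 : (‖z‖ : ℂ) ≠ 0 := by simpa using hne
  have h2 : gauss z ≠ 0 := by
    rw [gauss]; exact_mod_cast (Real.exp_pos _).ne'
  have h3 : ((4 * ‖z‖ ^ 2 : ℝ) : ℂ) ≠ 0 := by
    push_cast; exact mul_ne_zero (by norm_num) (pow_ne_zero 2 h1)
  have := (mul_eq_zero.1 hz).resolve_left h3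
  exact (mul_eq_zero.1 this).resolve_right h2

end

/-! ### The coefficient functionals -/

lemma D2.ext {U V : D2} (h : incl U = incl V) (k : Delta U = Delta V) : U = V :=
  Subtype.ext (Prod.ext h k)

/-- The test functions, as a subspace of `𝓓₂`. -/
def testD2 : Submodule ℂ D2 where
  carrier := {U | ∃ φ, IsTest φ ∧ incl U =ᵐ[area] φ ∧ Delta U =ᵐ[area] lap φ}
  add_mem' := by
    rintro U V ⟨φ, hφ, h1, h2⟩ ⟨ψ, hψ, k1, k2⟩
    refine ⟨φ + ψ, hφ.add hψ, ?_, ?_⟩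
    · rw [map_add]; exact (Lp.coeFn_add _ _).trans (h1.add k1)
    · rw [map_add, lap_add hφ hψ]; exact (Lp.coeFn_add _ _).trans (h2.add k2)
  zero_mem' := by
    refine ⟨0, IsTest.zero, ?_, ?_⟩
    · rw [map_zero]; exact Lp.coeFn_zero _ _ _
    · have : lap 0 = 0 := by simpa using lap_smul 0 IsTest.zero
      rw [map_zero, this]; exact Lp.coeFn_zero _ _ _
  smul_mem' := by
    rintro c U ⟨φ, hφ, h1, h2⟩
    refine ⟨c • φ, hφ.smul c, ?_, ?_⟩
    · rw [map_smul]; exact (Lp.coeFn_smul _ _).trans (h1.const_smul c)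
    · rw [map_smul, lap_smul c hφ]; exact (Lp.coeFn_smul _ _).trans (h2.const_smul c)

lemma IsTest.toD2_mem {φ : ℂ → ℂ} (h : IsTest φ) : h.isHarm.toD2 ∈ testD2 :=
  ⟨φ, h, h.isHarm.incl_toD2, h.isHarm.Delta_toD2⟩

lemma exists_of_mem_testD2 {U : D2} (h : U ∈ testD2) :
    ∃ φ, ∃ hφ : IsTest φ, U = hφ.isHarm.toD2 := by
  obtain ⟨φ, hφ, h1, h2⟩ := h
  exact ⟨φ, hφ, D2.ext (Lp.ext (h1.trans hφ.isHarm.incl_toD2.symm))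
    (Lp.ext (h2.trans hφ.isHarm.Delta_toD2.symm))⟩

section

variable {ρ : ℝ → ℝ}

/-- The functions `ρ`, `ρ z`, `ρ z̄` as elements of `𝓓₂`. -/
def IsCutoff.elem (h : IsCutoff ρ) (i : Fin 3) : D2 := (h.isHarm_base i).toD2

lemma IsCutoff.commutator_elem (h : IsCutoff ρ) (a b : ℂ) (i j : Fin 3) :
    commutator a b (h.elem i) (h.elem j) = -2 * Real.pi *
      (a * ((if i = 1 then 1 else 0) * (if j = 1 then 1 else 0)) +
        b * ((if i = 2 then 1 else 0) * (if j = 2 then 1 else 0))) := by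
  rw [elem, elem, (h.isHarm_base i).commutator_toD2, (h.hasWirtAt_base i).dz,
    (h.hasWirtAt_base j).dz, (h.hasWirtAt_base i).dzb, (h.hasWirtAt_base j).dzb]

/-- The functionals giving the coefficients of `1`, `z`, `z̄` in the expansion at the cone point.
They vanish on test functions and are dual to `ρ`, `z ρ`, `z̄ ρ`, see `IsCutoff.coeff_test` and
`IsCutoff.coeff_elem`. -/
def IsCutoff.coeff (h : IsCutoff ρ) : Fin 3 → DNeg2
  | 0 => (-(4 * Real.pi : ℂ)⁻¹) • h.logForm
  | 1 => (-(2 * Real.pi : ℂ)⁻¹) • commutator 1 0 (h.elem 1)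
  | 2 => (-(2 * Real.pi : ℂ)⁻¹) • commutator 0 1 (h.elem 2)

lemma IsCutoff.coeff_test (h : IsCutoff ρ) {φ : ℂ → ℂ} (hφ : IsTest φ) :
    ∀ i, h.coeff i hφ.isHarm.toD2 = 0
  | 0 => by simp only [coeff, smul_apply, h.logForm_test hφ, smul_zero]
  | 1 => by
    simp only [coeff, smul_apply]
    rw [commutator_symm, hφ.commutator_toD2, smul_zero]
  | 2 => by
    simp only [coeff, smul_apply]
    rw [commutator_symm, hφ.commutator_toD2, smul_zero]

lemma base_neg (ρ : ℝ → ℝ) : ∀ i : Fin 3, i ≠ 0 → ∀ z, base ρ i (-z) = -base ρ i z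
  | 0, h, _ => (h rfl).elim
  | 1, _, z => by simp [base, mode, radial]
  | 2, _, z => by simp [base, mode, radial]

lemma IsCutoff.logForm_elem (h : IsCutoff ρ) (i : Fin 3) :
    h.logForm (h.elem i) = if i = 0 then -4 * (Real.pi : ℂ) else 0 := by
  split_ifs with hi
  · subst hi
    exact h.logForm_mode_zero
  · exact h.logForm_odd _ (base_neg ρ i hi)

lemma IsCutoff.coeff_elem (h : IsCutoff ρ) (i j : Fin 3) :
    h.coeff i (h.elem j) = if j = i then 1 else 0 := by
  have hπ : (Real.pi : ℂ) ≠ 0 := by exact_mod_cast Real.pi_ne_zero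
  fin_cases i <;> simp only [coeff, Fin.isValue, Fin.reduceFinMk, Fin.zero_eta, Fin.mk_one,
    smul_apply, h.logForm_elem, h.commutator_elem, smul_eq_mul] <;> split_ifs <;>
    simp_all <;> field_simp

lemma IsCutoff.coeff_eq_zero (h : IsCutoff ρ) {V : D2} (hV : V ∈ testD2.topologicalClosure)
    (i : Fin 3) : h.coeff i V = 0 := by
  refine closure_minimal (s := (testD2 : Set D2)) (t := {V | h.coeff i V = 0}) ?_
    (isClosed_eq (h.coeff i).continuous continuous_const) hV
  intro V hV
  obtain ⟨φ, hφ, rfl⟩ := exists_of_mem_testD2 hV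
  exact h.coeff_test hφ i

lemma commutator_eq_zero {V : D2} (hV : V ∈ testD2.topologicalClosure) (a b : ℂ) (W : D2) :
    commutator a b V W = 0 := by
  refine closure_minimal (s := (testD2 : Set D2)) (t := {V | commutator a b V W = 0}) ?_
    (isClosed_eq ((commutator a b).flip W).continuous continuous_const) hV
  intro V hV
  obtain ⟨φ, hφ, rfl⟩ := exists_of_mem_testD2 hV
  exact hφ.commutator_toD2 a b W

/-! ### The decomposition of `𝓓₂` -/

/-- `1 + Δ` is expanding, because `Δ` is nonnegative. -/
lemma norm_incl_le (U : D2) : ‖incl U‖ ≤ ‖(incl + Delta) U‖ := by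
  have e := (grad_spec U).2 _ (grad_spec U).1
  simp only [inner_self_eq_norm_sq_to_K] at e
  have e1 : inner ℂ (incl U) ((incl + Delta) U) =
      ((‖incl U‖ ^ 2 + 2 * (‖(grad U).1‖ ^ 2 + ‖(grad U).2‖ ^ 2) : ℝ) : ℂ) := by
    rw [add_apply, inner_add_right, inner_self_eq_norm_sq_to_K]
    push_cast
    exact congrArg _ e.symm
  have e2 := norm_inner_le_norm (𝕜 := ℂ) (incl U) ((incl + Delta) U)
  rw [e1, norm_real, Real.norm_of_nonneg (by positivity)] at e2
  by_contra hlt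
  push Not at hlt
  have h0 : 0 < ‖incl U‖ := (norm_nonneg _).trans_lt hlt
  nlinarith [sq_nonneg ‖(grad U).1‖, sq_nonneg ‖(grad U).2‖]

lemma norm_le_mul_norm_incl_add_Delta (U : D2) : ‖U‖ ≤ 2 * ‖(incl + Delta) U‖ := by
  have h1 := norm_incl_le U
  have h2 : ‖Delta U‖ ≤ ‖(incl + Delta) U‖ + ‖incl U‖ := by
    have := norm_sub_le ((incl + Delta) U) (incl U)
    rwa [add_apply, add_sub_cancel_left] at this
  change max ‖incl U‖ ‖Delta U‖ ≤ _
  exact max_le (by linarith [norm_nonneg (incl U)]) (by linarith)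

/-- A closed subspace containing the test functions and the three singular functions is mapped by
`1 + Δ` onto a dense subspace of `L²`, hence is everything. -/
lemma IsCutoff.eq_top (h : IsCutoff ρ) (N : Submodule ℂ D2) (hN : IsClosed (N : Set D2))
    (ht : testD2 ≤ N) (he : ∀ i, h.elem i ∈ N) : N = ⊤ := by
  set S : D2 →L[ℂ] L2 := incl + Delta
  have hanti : AntilipschitzWith 2 S :=
    AddMonoidHomClass.antilipschitz_of_bound S fun U => norm_le_mul_norm_incl_add_Delta U
  have hind := (hanti.isUniformInducing S.uniformContinuous).isInducing
  have hdense : (N.map S.toLinearMap).topologicalClosure = ⊤ := by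
    rw [Submodule.topologicalClosure_eq_top_iff, Submodule.eq_bot_iff]
    intro g hg
    have hg' : ∀ (e : ℂ → ℂ) (he : IsHarm e), he.toD2 ∈ N →
        ∫ z, conj (g z) * (e z + lap e z) ∂area = 0 := by
      intro e he hmem
      rw [← inner_eq_integral g (u := S he.toD2) (f := fun z => e z + lap e z)
        ((Lp.coeFn_add _ _).trans (he.incl_toD2.add he.Delta_toD2))]
      exact Submodule.inner_left_of_mem_orthogonal (Submodule.mem_map_of_mem hmem) hg
    have hA : Annih ρ fun z => conj (g z) := ⟨memLp_conj (Lp.memLp g),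
      fun φ hφ => hg' φ hφ.isHarm (ht hφ.toD2_mem), fun i => hg' _ (h.isHarm_base i) (he i)⟩
    refine (Lp.eq_zero_iff_ae_eq_zero).2 ?_
    filter_upwards [hA.ae_eq_zero h] with z hz
    simpa using hz
  refine Submodule.eq_top_iff'.2 fun U => ?_
  have hU : S U ∈ closure (S '' (N : Set D2)) := by
    have : S U ∈ (N.map S.toLinearMap).topologicalClosure := by rw [hdense]; trivial
    exact this
  have : U ∈ closure (N : Set D2) := by
    rw [hind.closure_eq_preimage_closure_image]
    exact hU
  rwa [hN.closure_eq] at this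

/-- The remainder `u - L₀(u) ρ - L₁(u) z ρ - L₋₁(u) z̄ ρ` of the expansion. -/
def IsCutoff.remainder (h : IsCutoff ρ) : D2 →L[ℂ] D2 :=
  ContinuousLinearMap.id ℂ D2 - ∑ i, (h.coeff i).smulRight (h.elem i)

lemma IsCutoff.remainder_apply (h : IsCutoff ρ) (U : D2) :
    h.remainder U = U - ∑ i, h.coeff i U • h.elem i := by
  simp [remainder, sum_apply]

lemma IsCutoff.remainder_mem (h : IsCutoff ρ) (U : D2) :
    h.remainder U ∈ testD2.topologicalClosure := by
  have hN := h.eq_top (testD2.topologicalClosure.comap h.remainder.toLinearMap)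
    (testD2.isClosed_topologicalClosure.preimage h.remainder.continuous) ?_ ?_
  · have : U ∈ testD2.topologicalClosure.comap h.remainder.toLinearMap := by rw [hN]; trivial
    exact this
  · intro V hV
    have e : h.remainder V = V := by
      rw [h.remainder_apply, Finset.sum_eq_zero fun i _ => ?_, sub_zero]
      rw [h.coeff_eq_zero (testD2.le_topologicalClosure hV), zero_smul]
    change h.remainder V ∈ testD2.topologicalClosure
    rw [e]
    exact testD2.le_topologicalClosure hV
  · intro j
    have e : h.remainder (h.elem j) = 0 := by
      simp only [h.remainder_apply, h.coeff_elem, ite_smul, one_smul, zero_smul,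
        Finset.sum_ite_eq, Finset.mem_univ, if_true, sub_self]
    change h.remainder (h.elem j) ∈ testD2.topologicalClosure
    rw [e]
    exact Submodule.zero_mem _

lemma IsCutoff.decomp (h : IsCutoff ρ) (U : D2) :
    U = h.remainder U + ∑ i, h.coeff i U • h.elem i := by
  rw [h.remainder_apply, sub_add_cancel]

/-- Only the components of `U` and `V` along `z ρ` and `z̄ ρ` contribute to the commutator form. -/
theorem IsCutoff.commutator_eq_coeff (h : IsCutoff ρ) (a b : ℂ) (U : D2) : commutator a b U =
    (-2 * (Real.pi : ℂ)) • ((a * h.coeff 1 U) • h.coeff 1 + (b * h.coeff 2 U) • h.coeff 2) := by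
  ext V
  conv_lhs => rw [h.decomp U, h.decomp V]
  have hR := h.remainder_mem U
  have hR' := h.remainder_mem V
  have h1 : ∀ W, commutator a b W (h.remainder V) = 0 := fun W => by
    rw [commutator_symm, commutator_eq_zero hR']
  simp only [map_add, add_apply, commutator_eq_zero hR, h1, zero_add, map_smul,
    smul_apply, h.commutator_elem, Fin.sum_univ_three, smul_eq_mul]
  simp
  ring

end

/-! ### The domain of the closure of the Laplacian on test functions -/

instance : IsLocallyFiniteMeasure area :=
  IsLocallyFiniteMeasure.withDensity_ofReal (f := fun z : ℂ => 4 * ‖z‖ ^ 2) (by fun_prop)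

/-- Test functions separate the points of `L²`. -/
lemma eq_zero_of_pairing_test {h : L2}
    (hh : ∀ ψ (hψ : IsTest ψ), pairing (hψ.memLp.toLp ψ) h = 0) : h = 0 := by
  have hloc : LocallyIntegrable h area := (Lp.memLp h).locallyIntegrable (by norm_num)
  have key := isOpen_off.ae_eq_zero_of_integral_contDiff_smul_eq_zero
    (hloc.locallyIntegrableOn _) fun g hg hc hs => ?_
  · refine (Lp.eq_zero_iff_ae_eq_zero).2 ?_
    filter_upwards [key, ae_area_ne_zero] with z hz hne using hz hne
  · have hψ : IsTest (ofRealCLM ∘ g) := ⟨ofRealCLM.contDiff.comp hg, hc.comp_left rfl,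
      fun h0 => hs (closure_mono (Function.support_comp_subset (map_zero ofRealCLM) g) h0) rfl⟩
    rw [← hh _ hψ, pairing_eq hψ.memLp.coeFn_toLp (ae_eq_refl _)]
    rfl

lemma incl_mem_minDomain {V : D2} (hV : V ∈ testD2.topologicalClosure) : incl V ∈ minDomain :=
  ⟨Delta V, map_mem_closure (s := (testD2 : Set D2)) D2.toPair.continuous hV fun _ hW => hW⟩

/-- On `𝓓₂` the closure of the Laplacian on test functions agrees with the Friedrichs Laplacian,
both being the distributional Laplacian. -/
lemma mem_closure_of_incl_mem {V : D2} (hV : incl V ∈ minDomain) :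
    V ∈ testD2.topologicalClosure := by
  obtain ⟨f, hf⟩ := hV
  have hlift : ∀ p : L2 × L2, (∃ φ, IsTest φ ∧ p.1 =ᵐ[area] φ ∧ p.2 =ᵐ[area] lap φ) →
      ∃ W ∈ testD2, D2.toPair W = p := by
    rintro p ⟨φ, hφ, h1, h2⟩
    exact ⟨hφ.isHarm.toD2, hφ.toD2_mem, Prod.ext
      (Lp.ext (hφ.isHarm.incl_toD2.trans h1.symm)) (Lp.ext (hφ.isHarm.Delta_toD2.trans h2.symm))⟩
  have hpair : ∀ ψ (hψ : IsTest ψ),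
      pairing (hψ.memLp.toLp ψ) f = pairing (hψ.lap.memLp.toLp _) (incl V) := by
    intro ψ hψ
    refine closure_minimal (t := {p : L2 × L2 |
      pairing (hψ.memLp.toLp ψ) p.2 = pairing (hψ.lap.memLp.toLp _) p.1}) ?_
      (isClosed_eq (by fun_prop) (by fun_prop)) hf
    intro p hp
    obtain ⟨W, -, rfl⟩ := hlift p hp
    exact hψ.pairing_Delta W
  have hfV : f = Delta V := sub_eq_zero.1 <| eq_zero_of_pairing_test fun ψ hψ => by
    rw [map_sub, hpair ψ hψ, hψ.pairing_Delta, sub_self]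
  have hind : IsInducing D2.toPair := IsInducing.subtypeVal
  change V ∈ closure (testD2 : Set D2)
  rw [hind.closure_eq_preimage_closure_image]
  refine closure_mono (fun p hp => ?_) (hfV ▸ hf : (incl V, Delta V) ∈ _)
  exact hlift p hp

/-! ### The expansion at the cone point -/

lemma exists_isCutoff : ∃ ρ, IsCutoff ρ :=
  let b : ContDiffBump (0 : ℝ) := ⟨1, 2, one_pos, one_lt_two⟩
  ⟨b, b.contDiff, b.hasCompactSupport, b.eventuallyEq_one⟩

section

variable {ρ ρ' : ℝ → ℝ}

lemma IsCutoff.isTest_base_sub (h : IsCutoff ρ) (h' : IsCutoff ρ') (i : Fin 3) :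
    IsTest (base ρ i - base ρ' i) where
  smooth := (h.isHarm_base i).smooth.sub (h'.isHarm_base i).smooth
  compact := (h.isHarm_base i).compact.sub (h'.isHarm_base i).compact
  away := by
    rw [notMem_tsupport_iff_eventuallyEq]
    have h0 : ∀ᶠ r in 𝓝 0, ρ r - ρ' r = 0 := by
      filter_upwards [h.eq_one, h'.eq_one] with r h1 h2
      rw [h1, h2, sub_self]
    filter_upwards [eventually_apply_norm_sq_eq_zero h0] with z hz
    have e : radial ρ z = radial ρ' z := by
      rw [radial, radial, sub_eq_zero.1 hz]
    fin_cases i <;> simp [base, mode, e]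

lemma IsCutoff.elem_sub_mem (h : IsCutoff ρ) (h' : IsCutoff ρ') (i : Fin 3) :
    h.elem i - h'.elem i ∈ testD2.topologicalClosure := by
  have ht := h.isTest_base_sub h' i
  refine mem_closure_of_incl_mem ⟨ht.lap.memLp.toLp _, subset_closure
    ⟨_, ht, ?_, ht.lap.memLp.coeFn_toLp⟩⟩
  rw [map_sub]
  exact (Lp.coeFn_sub _ _).trans
    ((h.isHarm_base i).incl_toD2.sub (h'.isHarm_base i).incl_toD2)

lemma IsCutoff.incl_add_sum (h : IsCutoff ρ) (V : D2) (a : Fin 3 → ℂ) :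
    incl (V + ∑ i, a i • h.elem i) =ᵐ[area] fun z =>
      (a 0 + a 2 * conj z + a 1 * z) * (ρ (‖z‖ ^ 2) : ℂ) + incl V z := by
  simp only [Fin.sum_univ_three, map_add, map_smul]
  filter_upwards [Lp.coeFn_add (incl V)
      (a 0 • incl (h.elem 0) + a 1 • incl (h.elem 1) + a 2 • incl (h.elem 2)),
    Lp.coeFn_add (a 0 • incl (h.elem 0) + a 1 • incl (h.elem 1)) (a 2 • incl (h.elem 2)),
    Lp.coeFn_add (a 0 • incl (h.elem 0)) (a 1 • incl (h.elem 1)),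
    Lp.coeFn_smul (a 0) (incl (h.elem 0)), Lp.coeFn_smul (a 1) (incl (h.elem 1)),
    Lp.coeFn_smul (a 2) (incl (h.elem 2)), (h.isHarm_base 0).incl_toD2,
    (h.isHarm_base 1).incl_toD2, (h.isHarm_base 2).incl_toD2] with z h1 h2 h3 h4 h5 h6 k0 k1 k2
  rw [h1, Pi.add_apply, h2, Pi.add_apply, h3, Pi.add_apply, h4, h5, h6, Pi.smul_apply,
    Pi.smul_apply, Pi.smul_apply, elem, elem, elem, k0, k1, k2]
  simp [base, mode, radial]
  ring

/-- The coefficients computed with one cutoff are valid for all cutoffs, since the functions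
`base ρ i` for different `ρ` differ by test functions. -/
theorem IsCutoff.hasExpansion_iff (h : IsCutoff ρ) (U : D2) (am a₀ ap : ℂ) :
    HasExpansion (incl U) am a₀ ap ↔
      am = h.coeff 2 U ∧ a₀ = h.coeff 0 U ∧ ap = h.coeff 1 U := by
  constructor
  · intro hU
    obtain ⟨v, hv, e⟩ := hU ρ h
    let a : Fin 3 → ℂ := ![a₀, ap, am]
    have hV : incl (U - ∑ i, a i • h.elem i) = v := by
      refine Lp.ext ?_
      have e1 := h.incl_add_sum (U - ∑ i, a i • h.elem i) a
      rw [sub_add_cancel] at e1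
      filter_upwards [e, e1] with z h1 h2
      exact (add_left_cancel (h1.symm.trans h2)).symm
    have hc : ∀ i, a i = h.coeff i U := by
      intro i
      have e2 := h.coeff_eq_zero (mem_closure_of_incl_mem (hV ▸ hv)) i
      rw [map_sub, sub_eq_zero] at e2
      rw [e2]
      simp [h.coeff_elem]
    exact ⟨hc 2, hc 0, hc 1⟩
  · rintro ⟨rfl, rfl, rfl⟩ ρ' h'
    refine ⟨_, incl_mem_minDomain (V := U - ∑ i, h.coeff i U • h'.elem i) ?_, ?_⟩
    · have e : U - ∑ i, h.coeff i U • h'.elem i =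
          h.remainder U + ∑ i, h.coeff i U • (h.elem i - h'.elem i) := by
        simp only [h.remainder_apply, smul_sub, Finset.sum_sub_distrib]
        abel
      rw [e]
      exact Submodule.add_mem _ (h.remainder_mem U) (Submodule.sum_mem _ fun i _ =>
        Submodule.smul_mem _ _ (h.elem_sub_mem h' i))
    · have e1 := h'.incl_add_sum (U - ∑ i, h.coeff i U • h'.elem i) fun i => h.coeff i U
      rw [sub_add_cancel] at e1
      exact e1

end

/-! ### Domains of powers of the Laplacian -/

lemma exists_power_eq_mul {H : Type*} [NormedAddCommGroup H] [InnerProductSpace ℂ H]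
    [CompleteSpace H] (R : H →L[ℂ] H) {σ : ℝ} (hσ : 1 ≤ σ) :
    ∃ T : H →L[ℂ] H, power R σ = R * T := by
  rw [power, CFC.rpow_def]
  by_cases hR : 0 ≤ R
  · have hc : ContinuousOn (fun x : NNReal => x ^ (σ - 1)) (spectrum NNReal R) :=
      (NNReal.continuous_rpow_const (by linarith)).continuousOn
    have e : (fun x : NNReal => x ^ σ) = fun x => id x * x ^ (σ - 1) := by
      ext x
      have := NNReal.rpow_add_of_nonneg x zero_le_one (sub_nonneg.2 hσ)
      rw [add_sub_cancel, NNReal.rpow_one] at this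
      rw [this, id]
    exact ⟨cfc (fun x : NNReal => x ^ (σ - 1)) R, by
      rw [e, cfc_mul _ _ R continuousOn_id hc, cfc_id NNReal R]⟩
  · -- the functional calculus takes the value `0` outside the nonnegative operators
    exact ⟨0, by rw [cfc_apply_of_not_predicate R hR, mul_zero]⟩

lemma exists_incl_eq_of_mem_domain {k : ℝ} (hk : 2 ≤ k) {u : L2} (hu : u ∈ domain k) :
    ∃ U : D2, incl U = u := by
  obtain ⟨g, R, hR, f, rfl, -⟩ := hu
  obtain ⟨T, hT⟩ := exists_power_eq_mul R (σ := k / 2) (by linarith)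
  exact ⟨⟨_, hR (T f)⟩, by rw [hT]; rfl⟩

end Cone

end

theorem mainTheorem8 :
    ∃ Lm L₀ Lp : Cone.DNeg2,
      (∀ (U : Cone.D2) (am a₀ ap : ℂ), Cone.HasExpansion (Cone.incl U) am a₀ ap ↔
        am = Lm U ∧ a₀ = L₀ U ∧ ap = Lp U) ∧
      ∀ (Xw Xwbar : ℂ) (k : ℝ), 2 ≤ k → ∀ u ∈ Cone.domain k,
        ∃ U : Cone.D2, Cone.incl U = u ∧
          Cone.commutator Xw Xwbar U =
            (-2 * (Real.pi : ℂ)) • ((Xw * Lp U) • Lp + (Xwbar * Lm U) • Lm) := by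
  obtain ⟨ρ, h⟩ := Cone.exists_isCutoff
  refine ⟨h.coeff 2, h.coeff 0, h.coeff 1, h.hasExpansion_iff, fun Xw Xwbar k hk u hu => ?_⟩
  obtain ⟨U, hU⟩ := Cone.exists_incl_eq_of_mem_domain hk hu
  exact ⟨U, hU, h.commutator_eq_coeff Xw Xwbar U⟩
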